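/- Let $N,m\ge 1$ be integers, let $\gamma>0$, and let $\Omega\subset\mathbb{R}^N$ be a domain (a nonempty connected open set). Let $C^m$ be the class of all lower semicontinuous, nondecreasing functions $f:\mathbb{R}\to[0,\infty]$ such that $f^m$ is convex on $(-\infty,\sup\{t: f(t)<\infty\})$. For $f\in C^m$ put $f'_-(t)=\lim_{k\downarrow 0}\frac{f(t)-f(t-k)}{k}\in[0,\infty]$ if $f(t)<\infty$, and $f'_-(t)=\infty$ if $f(t)=\infty$. A function $u\in W^{1,2}_{\rm loc}(\Omega)$ is a weak solution of $-\Delta u=f(u)$ in $\Omega$ if $f(u)\in L^1_{\rm loc}(\Omega)$ and $$\int_\Omega \nabla u\cdot\nabla\varphi\,dx=\int_\Omega f(u)\varphi\,dx\qquad\text{for all }\varphi\in C^\infty_0(\Omega);$$ it is a stable solution if moreover $f'_-(u)\in L^1_{\rm loc}(\Omega)$ and $$\int_\Omega f'_-(u)\xi^2\,dx\le\int_\Omega|\nabla\xi|^2\,dx\qquad\text{for all }\xi\in C^\infty_0(\Omega).$$ Let $S^m(\Omega)$ be the set of all $u\in W^{1,2}_{\rm loc}(\Omega)$ that are stable solutions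 of $-\Delta u=f(u)$ in $\Omega$ for some $f\in C^m$. **Proposition.** Let $(u_k)_{k\in\mathbb{N}}\subset S^m(\Omega)$ (the nonlinearity $f_k\in C^m$ may depend on $k$) be locally bounded in $W^{1,2+\gamma}$, that is, for every compact $K\subset\Omega$, $$\sup_k\left(\|u_k\|_{L^{2+\gamma}(K)}+\|\nabla u_k\|_{L^{2+\gamma}(K)}\right)<\infty.$$ Then there exist a subsequence $(u_{k_j})_{j\in\mathbb{N}}$ and a function $u\in S^m(\Omega)$ such that $u_{k_j}\to u$ in $W^{1,2}_{\rm loc}(\Omega)$, that is, $\|u_{k_j}-u\|_{L^2(K)}+\|\nabla u_{k_j}-\nabla u\|_{L^2(K)}\to 0$ as $j\to\infty$ for every compact $K\subset\Omega$. -/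

import Mathlib

open MeasureTheory Filter Topology
open scoped ENNReal NNReal ContDiff

/-- The class `C^m`: lower semicontinuous, nondecreasing functions `f : ℝ → [0, ∞]` such that
`f ^ m` is convex on the open half-line `(-∞, sup {s | f s < ∞})`. The supremum is taken in the
extended reals, so the half-line may be empty or all of `ℝ`. On it `f` is finite by monotonicity,
so that `toReal` loses nothing there. -/
structure IsMConvexNonlinearity (m : ℕ) (f : ℝ → ℝ≥0∞) : Prop where
  lowerSemicontinuous : LowerSemicontinuous f
  monotone : Monotone f
  convexOn : ConvexOn ℝ {t : ℝ | (t : EReal) < ⨆ (s : ℝ) (_ : f s < ⊤), (s : EReal)}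
    (fun t => (f t).toReal ^ m)

open Classical in
/-- The left derivative `f'₋(t) = lim_{k ↓ 0} (f t - f (t - k)) / k ∈ [0, ∞]` where `f t < ∞`, and
`f'₋(t) = ∞` where `f t = ∞`. For `f` in `C^m` with `1 ≤ m` the limit always exists in `[0, ∞]`, so
it is the upper limit written here; the subtraction is a true one because `f` is nondecreasing. -/
noncomputable def leftDerivative (f : ℝ → ℝ≥0∞) (t : ℝ) : ℝ≥0∞ :=
  if f t = ⊤ then ⊤
  else limsup (fun k : ℝ => (f t - f (t - k)) / ENNReal.ofReal k) (𝓝[>] 0)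

/-- Test functions: `φ ∈ C^∞_0(Ω)`. -/
structure IsTestFunction {N : ℕ} (Ω : Set (EuclideanSpace ℝ (Fin N)))
    (φ : EuclideanSpace ℝ (Fin N) → ℝ) : Prop where
  contDiff : ContDiff ℝ ∞ φ
  hasCompactSupport : HasCompactSupport φ
  tsupport_subset : tsupport φ ⊆ Ω

/-- `g ∈ L^p_loc(Ω)`: `g` is in `L^p(K)` for every compact `K ⊆ Ω`. -/
def MemLpLoc {N : ℕ} {F : Type*} [NormedAddCommGroup F] (Ω : Set (EuclideanSpace ℝ (Fin N)))
    (p : ℝ≥0∞) (g : EuclideanSpace ℝ (Fin N) → F) : Prop :=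
  ∀ K : Set (EuclideanSpace ℝ (Fin N)), IsCompact K → K ⊆ Ω → MemLp g p (volume.restrict K)

/-- `g ∈ L^1_loc(Ω)` for a function `g` with values in `[0, ∞]`. -/
def LocIntegrableENNReal {N : ℕ} (Ω : Set (EuclideanSpace ℝ (Fin N)))
    (g : EuclideanSpace ℝ (Fin N) → ℝ≥0∞) : Prop :=
  ∀ K : Set (EuclideanSpace ℝ (Fin N)), IsCompact K → K ⊆ Ω →
    AEMeasurable g (volume.restrict K) ∧ ∫⁻ x in K, g x < ⊤

/-- `G` is the weak (distributional) gradient of `u` in `Ω`; it is unique up to null sets. -/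
structure IsWeakGradient {N : ℕ} (Ω : Set (EuclideanSpace ℝ (Fin N)))
    (u : EuclideanSpace ℝ (Fin N) → ℝ)
    (G : EuclideanSpace ℝ (Fin N) → EuclideanSpace ℝ (Fin N)) : Prop where
  memLpLoc_fun : MemLpLoc Ω 1 u
  memLpLoc_grad : MemLpLoc Ω 1 G
  integral_eq : ∀ φ : EuclideanSpace ℝ (Fin N) → ℝ, IsTestFunction Ω φ →
    ∫ x in Ω, u x • gradient φ x = - ∫ x in Ω, φ x • G x

/-- `u ∈ W^{1,2}_loc(Ω)` is a weak solution of `-Δu = f(u)` in `Ω`. -/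
def IsWeakSolution {N : ℕ} (Ω : Set (EuclideanSpace ℝ (Fin N))) (f : ℝ → ℝ≥0∞)
    (u : EuclideanSpace ℝ (Fin N) → ℝ) : Prop :=
  LocIntegrableENNReal Ω (fun x => f (u x)) ∧
  ∃ G : EuclideanSpace ℝ (Fin N) → EuclideanSpace ℝ (Fin N),
    IsWeakGradient Ω u G ∧ MemLpLoc Ω 2 u ∧ MemLpLoc Ω 2 G ∧
    ∀ φ : EuclideanSpace ℝ (Fin N) → ℝ, IsTestFunction Ω φ →
      ∫ x in Ω, inner ℝ (G x) (gradient φ x) = ∫ x in Ω, (f (u x)).toReal * φ x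

/-- `u` is a stable (weak) solution of `-Δu = f(u)` in `Ω`. -/
def IsStableSolution {N : ℕ} (Ω : Set (EuclideanSpace ℝ (Fin N))) (f : ℝ → ℝ≥0∞)
    (u : EuclideanSpace ℝ (Fin N) → ℝ) : Prop :=
  IsWeakSolution Ω f u ∧
  LocIntegrableENNReal Ω (fun x => leftDerivative f (u x)) ∧
  ∀ ξ : EuclideanSpace ℝ (Fin N) → ℝ, IsTestFunction Ω ξ →
    ∫⁻ x in Ω, leftDerivative f (u x) * ENNReal.ofReal (ξ x ^ 2)
      ≤ ∫⁻ x in Ω, ENNReal.ofReal (‖gradient ξ x‖ ^ 2)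

/-- `S^m(Ω)`: the functions that are stable solutions of `-Δu = f(u)` in `Ω` for some `f ∈ C^m`. -/
def stableClass {N : ℕ} (m : ℕ) (Ω : Set (EuclideanSpace ℝ (Fin N))) :
    Set (EuclideanSpace ℝ (Fin N) → ℝ) :=
  {u | ∃ f : ℝ → ℝ≥0∞, IsMConvexNonlinearity m f ∧ IsStableSolution Ω f u}

/-- The sequence `u` is locally bounded in `W^{1,p}(Ω)`: on each compact `K ⊆ Ω` the norms
`‖u k‖_{L^p(K)} + ‖∇u k‖_{L^p(K)}` are bounded independently of `k`. -/
def LocallyBoundedW1 {N : ℕ} (Ω : Set (EuclideanSpace ℝ (Fin N))) (p : ℝ≥0∞)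
    (u : ℕ → EuclideanSpace ℝ (Fin N) → ℝ) : Prop :=
  ∃ G : ℕ → EuclideanSpace ℝ (Fin N) → EuclideanSpace ℝ (Fin N),
    (∀ k, IsWeakGradient Ω (u k) (G k)) ∧
    ∀ K : Set (EuclideanSpace ℝ (Fin N)), IsCompact K → K ⊆ Ω →
      ∃ C : ℝ≥0, ∀ k, eLpNorm (u k) p (volume.restrict K) + eLpNorm (G k) p (volume.restrict K) ≤ C

/-- `u k → v` in `W^{1,p}_loc(Ω)`: on each compact `K ⊆ Ω`,
`‖u k - v‖_{L^p(K)} + ‖∇u k - ∇v‖_{L^p(K)} → 0`. -/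
def TendstoW1Loc {N : ℕ} (Ω : Set (EuclideanSpace ℝ (Fin N))) (p : ℝ≥0∞)
    (u : ℕ → EuclideanSpace ℝ (Fin N) → ℝ) (v : EuclideanSpace ℝ (Fin N) → ℝ) : Prop :=
  ∃ (G : ℕ → EuclideanSpace ℝ (Fin N) → EuclideanSpace ℝ (Fin N))
    (H : EuclideanSpace ℝ (Fin N) → EuclideanSpace ℝ (Fin N)),
    (∀ k, IsWeakGradient Ω (u k) (G k)) ∧ IsWeakGradient Ω v H ∧
    ∀ K : Set (EuclideanSpace ℝ (Fin N)), IsCompact K → K ⊆ Ω →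
      Tendsto (fun k => eLpNorm (u k - v) p (volume.restrict K)
        + eLpNorm (G k - H) p (volume.restrict K)) atTop (𝓝 0)

/-!
The limit `v` is produced by compactness, and a nonlinearity `F` for it by a selection argument; the
substance lies in showing that `v` solves `-Δv = F(v)`.

*Compactness.* The right-hand sides are nonnegative, so testing the equations with a cutoff function
bounds them in `L^1_loc`. Rellich's theorem gives a subsequence converging in `L^2_loc`. Testing the
difference of two equations with a bounded truncation of `u k - u l` at height `ε` shows that the
energy of `u k - u l` on the set where `|u k - u l| ≤ ε` is `O(ε)`; hence the gradients converge in
measure (`tendstoInMeasure_gradient_sub`), and by the bound in `L^{2+γ}` and Vitali's theorem they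
converge in `L^2_loc` (`exists_subseq_tendsto_W1Loc`).

*The nonlinearity.* By compactness of `[0, ∞]^ℚ` the functions `f k` converge on `ℚ` along a further
subsequence. The left-continuous extension `F` of the limit is again in `C^m`
(`isMConvexNonlinearity_leftLimitExtension`), and if `s k → t` then `F t ≤ liminf f k (s k)`, with a
limit instead of an inequality if `F` is finite somewhere to the right of `t`. Convexity makes the left
derivative a supremum of difference quotients, whence the same lower semicontinuity for left
derivatives. Fatou's lemma then yields the stability inequality for `v` and `-Δv ≥ F(v)`.

*No loss of mass.* For the reverse inequality, convexity of `f k ^ m` gives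
`f k (u k) ≤ f k (min (u k) t) + m (u k - t)₊ (f k)'₋(u k)`. For `t` in the interior of the half-line
`{F < ∞}` the first term converges by dominated convergence. The second is controlled by stability
tested with `(u k - t)₊ η` (`lintegral_leftDerivative_comp_mul_le`), that is, by the `L^2` norm of
the gradient of `(v - t)₊ η` in the limit. As `t` increases to the end point `T` of the half-line, this
norm tends to zero, because `v ≤ T` and `∇v = 0` almost everywhere on `{v = T}`
(`IsStableLimit.tendsto_compMulGradientBound`). So the equation holds when tested with `η ^ 2`,
and `IsStableLimit.limit_equation` extends it to all test functions `φ` by comparison with `M η ^ 2 ± φ`.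
-/

/-! ### Mollification and `L^2` estimates -/

section Translation

variable {N : ℕ} {F : Type*} [NormedAddCommGroup F]

theorem eLpNorm_two_sq {α : Type*} [MeasurableSpace α] (μ : Measure α) (f : α → F) :
    eLpNorm f 2 μ ^ 2 = ∫⁻ x, ‖f x‖ₑ ^ 2 ∂μ := by
  have := eLpNorm_nnreal_pow_eq_lintegral (μ := μ) (f := f) (p := 2) (by norm_num)
  simpa using this

/-- Translations act continuously on `L^2`. -/
theorem tendsto_eLpNorm_translate_sub {g : EuclideanSpace ℝ (Fin N) → F}
    (hg : MemLp g 2 volume) :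
    Tendsto (fun y => eLpNorm (fun x => g (x - y) - g x) 2 volume) (𝓝 0) (𝓝 0) := by
  have : Fact ((2 : ℝ≥0∞) ≠ ⊤) := ⟨by simp⟩
  have hc : Continuous fun y : EuclideanSpace ℝ (Fin N) =>
      (DomAddAct.mk (-y)) +ᵥ hg.toLp g :=
    (continuous_vadd.comp ((DomAddAct.continuous_mk.comp continuous_neg).prodMk continuous_const))
  have h1 : Tendsto (fun y : EuclideanSpace ℝ (Fin N) =>
      edist ((DomAddAct.mk (-y)) +ᵥ hg.toLp g) (hg.toLp g)) (𝓝 0) (𝓝 0) := by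
    have := (hc.edist (continuous_const (y := hg.toLp g))).tendsto 0
    simpa using this
  refine h1.congr fun y => ?_
  rw [DomAddAct.mk_vadd_toLp, Lp.edist_toLp_toLp]
  congr 1
  ext x
  simp [sub_eq_neg_add]

/-- Jensen's inequality for a probability density. -/
theorem enorm_integral_density_smul_sq_le {α : Type*} [MeasurableSpace α] {μ : Measure α}
    [NormedSpace ℝ F] {ρ : α → ℝ} (hρ : 0 ≤ ρ) (hρm : Measurable ρ) (hint : Integrable ρ μ)
    (hone : ∫ x, ρ x ∂μ = 1) {h : α → F} (hh : AEStronglyMeasurable h μ) :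
    ‖∫ x, ρ x • h x ∂μ‖ₑ ^ 2 ≤ ∫⁻ x, ENNReal.ofReal (ρ x) * ‖h x‖ₑ ^ 2 ∂μ := by
  have hm : Measurable fun x => ENNReal.ofReal (ρ x) := hρm.ennreal_ofReal
  set ν := μ.withDensity (fun x => ENNReal.ofReal (ρ x)) with hν
  have : IsProbabilityMeasure ν := by
    constructor
    rw [hν, withDensity_apply _ MeasurableSet.univ, Measure.restrict_univ,
      ← ofReal_integral_eq_lintegral_ofReal hint (Eventually.of_forall hρ), hone]
    simp
  have e1 : ∫ x, ρ x • h x ∂μ = ∫ x, h x ∂ν := by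
    rw [hν, integral_withDensity_eq_integral_toReal_smul hm (by simp)]
    simp [ENNReal.toReal_ofReal (hρ _)]
  have hhν : AEStronglyMeasurable h ν := hh.mono_ac (withDensity_absolutelyContinuous _ _)
  calc ‖∫ x, ρ x • h x ∂μ‖ₑ ^ 2 ≤ (∫⁻ x, ‖h x‖ₑ ∂ν) ^ 2 := by
        rw [e1]; gcongr; exact enorm_integral_le_lintegral_enorm _
    _ = (eLpNorm h 1 ν) ^ 2 := by rw [eLpNorm_one_eq_lintegral_enorm]
    _ ≤ (eLpNorm h 2 ν) ^ 2 := by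
        gcongr; exact eLpNorm_le_eLpNorm_of_exponent_le (by norm_num) hhν
    _ = ∫⁻ x, ‖h x‖ₑ ^ 2 ∂ν := eLpNorm_two_sq _ _
    _ = _ := by
        rw [hν, lintegral_withDensity_eq_lintegral_mul₀' hm.aemeasurable]
        · rfl
        · exact (hhν.enorm.pow_const 2)

/-- The `L^2` distance of a function to its mollification is controlled by its moduli of
continuity in `L^2`. -/
theorem lintegral_enorm_mollify_sub_sq_le [NormedSpace ℝ F] [CompleteSpace F]
    (φ : ContDiffBump (0 : EuclideanSpace ℝ (Fin N)))
    {g : EuclideanSpace ℝ (Fin N) → F} (hg : LocallyIntegrable g volume)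
    {K : Set (EuclideanSpace ℝ (Fin N))} {C : ℝ≥0∞}
    (hC : ∀ y, ‖y‖ < φ.rOut → ∫⁻ x in K, ‖g (x - y) - g x‖ₑ ^ 2 ≤ C) :
    ∫⁻ x in K, ‖(convolution (φ.normed volume) g (ContinuousLinearMap.lsmul ℝ ℝ) volume) x - g x‖ₑ ^ 2
      ≤ C := by
  have hρ : (0 : EuclideanSpace ℝ (Fin N) → ℝ) ≤ φ.normed volume := fun x => φ.nonneg_normed x
  have hρm : Measurable (φ.normed volume) := φ.continuous_normed.measurable
  have hex := φ.hasCompactSupport_normed (μ := volume).convolutionExists_left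
    (ContinuousLinearMap.lsmul ℝ ℝ) φ.continuous_normed hg
  have hgm : AEStronglyMeasurable g volume := hg.aestronglyMeasurable
  have step1 : ∀ x, ‖(convolution (φ.normed volume) g (ContinuousLinearMap.lsmul ℝ ℝ) volume) x
      - g x‖ₑ ^ 2 ≤ ∫⁻ y, ENNReal.ofReal (φ.normed volume y) * ‖g (x - y) - g x‖ₑ ^ 2 := by
    intro x
    have e : (convolution (φ.normed volume) g (ContinuousLinearMap.lsmul ℝ ℝ) volume) x - g x
        = ∫ y, φ.normed volume y • (g (x - y) - g x) := by
      simp_rw [smul_sub]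
      rw [integral_sub, integral_smul_const, φ.integral_normed, one_smul, convolution_lsmul]
      · exact hex x
      · exact φ.integrable_normed.smul_const _
    rw [e]
    refine enorm_integral_density_smul_sq_le hρ hρm φ.integrable_normed φ.integral_normed ?_
    exact (hgm.comp_quasiMeasurePreserving
      (quasiMeasurePreserving_sub_left_of_right_invariant volume x)).sub aestronglyMeasurable_const
  calc _ ≤ ∫⁻ x in K, ∫⁻ y, ENNReal.ofReal (φ.normed volume y) * ‖g (x - y) - g x‖ₑ ^ 2 :=
        lintegral_mono step1
    _ = ∫⁻ y, ∫⁻ x in K, ENNReal.ofReal (φ.normed volume y) * ‖g (x - y) - g x‖ₑ ^ 2 := by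
        apply lintegral_lintegral_swap
        have h1 : AEStronglyMeasurable (fun p : EuclideanSpace ℝ (Fin N) × EuclideanSpace ℝ (Fin N)
            => g (p.1 - p.2)) ((volume.restrict K).prod volume) := by
          refine hgm.comp_quasiMeasurePreserving ?_
          exact ((quasiMeasurePreserving_sub_of_right_invariant volume volume).mono
            (Measure.AbsolutelyContinuous.prod Measure.restrict_le_self.absolutelyContinuous
              Measure.AbsolutelyContinuous.rfl) Measure.AbsolutelyContinuous.rfl)
        have h2 : AEStronglyMeasurable (fun p : EuclideanSpace ℝ (Fin N) × EuclideanSpace ℝ (Fin N)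
            => g p.1) ((volume.restrict K).prod volume) := hgm.restrict.comp_fst
        exact ((hρm.comp measurable_snd).ennreal_ofReal.aemeasurable).mul
          ((h1.sub h2).enorm.pow_const 2)
    _ ≤ ∫⁻ y, ENNReal.ofReal (φ.normed volume y) * C := by
        refine lintegral_mono fun y => ?_
        rw [lintegral_const_mul' _ _ ENNReal.ofReal_ne_top]
        by_cases hy : ‖y‖ < φ.rOut
        · gcongr; exact hC y hy
        · have : φ.normed volume y = 0 := by
            have := φ.support_normed_eq (μ := volume)
            by_contra hne
            have : y ∈ Metric.ball (0 : EuclideanSpace ℝ (Fin N)) φ.rOut := this ▸ hne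
            exact hy (by simpa using this)
          simp [this]
    _ = C := by
        rw [lintegral_mul_const _ hρm.ennreal_ofReal,
          ← ofReal_integral_eq_lintegral_ofReal φ.integrable_normed (Eventually.of_forall hρ),
          φ.integral_normed]
        simp

end Translation

/-! ### Smooth approximation in `W^{1,2}` -/

section Mollification

variable {N : ℕ}

/-- A standard bump function of radius `δ` centred at the origin. -/
noncomputable def bumpOfRadius {δ : ℝ} (hδ : 0 < δ) :
    ContDiffBump (0 : EuclideanSpace ℝ (Fin N)) :=
  ⟨δ / 2, δ, half_pos hδ, half_lt_self hδ⟩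

/-- The mollification of `g` at scale `δ`. -/
noncomputable def mollify {F : Type*} [NormedAddCommGroup F] [NormedSpace ℝ F] {δ : ℝ} (hδ : 0 < δ)
    (g : EuclideanSpace ℝ (Fin N) → F) : EuclideanSpace ℝ (Fin N) → F :=
  convolution ((bumpOfRadius hδ).normed volume) g (ContinuousLinearMap.lsmul ℝ ℝ) volume

theorem mollify_eq {F : Type*} [NormedAddCommGroup F] [NormedSpace ℝ F] {δ : ℝ} (hδ : 0 < δ)
    (g : EuclideanSpace ℝ (Fin N) → F) (x : EuclideanSpace ℝ (Fin N)) :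
    mollify hδ g x = ∫ t, (bumpOfRadius hδ).normed volume (x - t) • g t := by
  rw [mollify, convolution_lsmul_swap]

theorem contDiff_mollify {δ : ℝ} (hδ : 0 < δ)
    {g : EuclideanSpace ℝ (Fin N) → ℝ} (hg : LocallyIntegrable g volume) :
    ContDiff ℝ ∞ (mollify hδ g) :=
  HasCompactSupport.contDiff_convolution_left _ (ContDiffBump.hasCompactSupport_normed _)
    (ContDiffBump.contDiff_normed _) hg

theorem gradient_mollify {δ : ℝ} (hδ : 0 < δ)
    {g : EuclideanSpace ℝ (Fin N) → ℝ} (hg : LocallyIntegrable g volume)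
    (x : EuclideanSpace ℝ (Fin N)) :
    gradient (mollify hδ g) x
      = ∫ t, g t • gradient ((bumpOfRadius hδ).normed volume) (x - t) := by
  have h := HasCompactSupport.hasFDerivAt_convolution_left (𝕜 := ℝ)
    (ContinuousLinearMap.lsmul ℝ ℝ) ((bumpOfRadius hδ).hasCompactSupport_normed (μ := volume))
    ((bumpOfRadius hδ).contDiff_normed (n := 1)) hg x
  rw [gradient, show mollify hδ g = convolution ((bumpOfRadius hδ).normed volume) g
    (ContinuousLinearMap.lsmul ℝ ℝ) volume from rfl, h.fderiv, convolution_eq_swap]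
  change (InnerProductSpace.toDual ℝ (EuclideanSpace ℝ (Fin N))).symm.toContinuousLinearEquiv _ = _
  rw [← ContinuousLinearEquiv.integral_comp_comm]
  refine integral_congr_ae (Eventually.of_forall fun t => ?_)
  have : (((ContinuousLinearMap.lsmul ℝ ℝ).precompL (EuclideanSpace ℝ (Fin N)))
      (fderiv ℝ ((bumpOfRadius hδ).normed volume) (x - t))) (g t)
      = g t • fderiv ℝ ((bumpOfRadius hδ).normed volume) (x - t) := by
    ext v
    simp [ContinuousLinearMap.precompL_apply, mul_comm]
  simp only [this]
  rw [map_smul]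
  rfl

theorem support_bumpOfRadius_normed {δ : ℝ} (hδ : 0 < δ) {z : EuclideanSpace ℝ (Fin N)}
    (hz : δ ≤ ‖z‖) : (bumpOfRadius hδ).normed volume z = 0 := by
  have := (bumpOfRadius (N := N) hδ).support_normed_eq (μ := volume)
  by_contra hne
  have hz' : z ∈ Metric.ball (0 : EuclideanSpace ℝ (Fin N)) δ := this ▸ hne
  simp at hz'
  linarith

theorem tsupport_bump_translate {δ : ℝ} (hδ : 0 < δ) (x : EuclideanSpace ℝ (Fin N)) :
    tsupport (fun t => (bumpOfRadius (N := N) hδ).normed volume (x - t))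
      ⊆ Metric.closedBall x δ := by
  refine closure_minimal (fun t ht => ?_) Metric.isClosed_closedBall
  by_contra hne
  refine ht (support_bumpOfRadius_normed hδ ?_)
  simp [dist_eq_norm, norm_sub_rev] at hne
  exact hne.le

theorem isTestFunction_bump_translate {Ω : Set (EuclideanSpace ℝ (Fin N))} {δ : ℝ} (hδ : 0 < δ)
    {x : EuclideanSpace ℝ (Fin N)} (hx : Metric.closedBall x δ ⊆ Ω) :
    IsTestFunction Ω (fun t => (bumpOfRadius (N := N) hδ).normed volume (x - t)) where
  contDiff := (ContDiffBump.contDiff_normed _).comp (contDiff_const.sub contDiff_id)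
  hasCompactSupport := (isCompact_closedBall x δ).of_isClosed_subset (isClosed_tsupport _)
    (tsupport_bump_translate hδ x)
  tsupport_subset := (tsupport_bump_translate hδ x).trans hx

theorem gradient_comp_const_sub {φ : EuclideanSpace ℝ (Fin N) → ℝ} (hφ : Differentiable ℝ φ)
    (x t : EuclideanSpace ℝ (Fin N)) :
    gradient (fun t => φ (x - t)) t = - gradient φ (x - t) := by
  have h := (hφ (x - t)).hasFDerivAt.comp t ((hasFDerivAt_id t).const_sub x)
  have e : fderiv ℝ (fun t => φ (x - t)) t = - fderiv ℝ φ (x - t) := by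
    rw [show (fun t => φ (x - t)) = φ ∘ HSub.hSub x from rfl, h.fderiv]
    ext v
    simp
  rw [gradient, e, map_neg]
  rfl

theorem gradient_eq_zero_of_notMem_tsupport {φ : EuclideanSpace ℝ (Fin N) → ℝ}
    {x : EuclideanSpace ℝ (Fin N)} (hx : x ∉ tsupport φ) : gradient φ x = 0 := by
  have : fderiv ℝ φ x = 0 := by
    by_contra h
    exact hx (support_fderiv_subset ℝ h)
  simp [gradient, this]

/-- The gradient of the mollification is the mollification of the weak gradient. -/
theorem IsWeakGradient.gradient_mollify_indicator {Ω : Set (EuclideanSpace ℝ (Fin N))}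
    {u : EuclideanSpace ℝ (Fin N) → ℝ} {G : EuclideanSpace ℝ (Fin N) → EuclideanSpace ℝ (Fin N)}
    (h : IsWeakGradient Ω u G) (hΩ : MeasurableSet Ω) {K : Set (EuclideanSpace ℝ (Fin N))}
    (hK : IsCompact K) (hKΩ : K ⊆ Ω)
    {δ : ℝ} (hδ : 0 < δ) {x : EuclideanSpace ℝ (Fin N)} (hx : Metric.closedBall x δ ⊆ K) :
    gradient (mollify hδ (K.indicator u)) x = mollify hδ (K.indicator G) x := by
  have hint : LocallyIntegrable (K.indicator u) volume :=
    ((memLp_one_iff_integrable.1 ((memLp_indicator_iff_restrict hK.measurableSet).2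
      (h.memLpLoc_fun K hK hKΩ)))).locallyIntegrable
  rw [gradient_mollify hδ hint, mollify_eq]
  have key := h.integral_eq _ (isTestFunction_bump_translate hδ (hx.trans hKΩ))
  set ζ := fun t => (bumpOfRadius (N := N) hδ).normed volume (x - t) with hζ
  have hsupp : ∀ t, t ∉ K → t ∉ tsupport ζ := fun t ht h' =>
    ht (hx (tsupport_bump_translate hδ x h'))
  have e1 : ∫ t in Ω, u t • gradient ζ t
      = - ∫ t, K.indicator u t • gradient ((bumpOfRadius hδ).normed volume) (x - t) := by
    rw [← integral_neg, ← integral_indicator hΩ]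
    refine integral_congr_ae (Eventually.of_forall fun t => ?_)
    simp only
    by_cases ht : t ∈ K
    · rw [Set.indicator_of_mem (hKΩ ht), Set.indicator_of_mem ht, hζ,
        gradient_comp_const_sub ((ContDiffBump.contDiff_normed _ (n := 1)).differentiable one_ne_zero),
        smul_neg]
    · have h0 := gradient_eq_zero_of_notMem_tsupport (hsupp t ht)
      by_cases htΩ : t ∈ Ω <;> simp [ht, htΩ, h0]
  have e2 : ∫ t in Ω, ζ t • G t = ∫ t, ζ t • K.indicator G t := by
    rw [← integral_indicator hΩ]
    refine integral_congr_ae (Eventually.of_forall fun t => ?_)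
    simp only
    by_cases ht : t ∈ K
    · rw [Set.indicator_of_mem (hKΩ ht), Set.indicator_of_mem ht]
    · have h0 : ζ t = 0 := image_eq_zero_of_notMem_tsupport (hsupp t ht)
      by_cases htΩ : t ∈ Ω <;> simp [ht, htΩ, h0]
  rw [e1, e2, neg_inj] at key
  exact key

/-- Mollifications of a square integrable function converge to it in `L^2`. -/
theorem tendsto_eLpNorm_mollify_sub {F : Type*} [NormedAddCommGroup F] [NormedSpace ℝ F]
    [CompleteSpace F] {g : EuclideanSpace ℝ (Fin N) → F} (hg : MemLp g 2 volume)
    {δ : ℕ → ℝ} (hδ : ∀ n, 0 < δ n) (hlim : Tendsto δ atTop (𝓝 0)) :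
    Tendsto (fun n => eLpNorm (mollify (hδ n) g - g) 2 volume) atTop (𝓝 0) := by
  rw [ENNReal.tendsto_nhds_zero]
  intro ε hε
  have h1 := ENNReal.tendsto_nhds_zero.1 (tendsto_eLpNorm_translate_sub hg) ε hε
  obtain ⟨r, hr, hball⟩ := Metric.eventually_nhds_iff.1 h1
  filter_upwards [hlim.eventually_lt_const hr] with n hn
  have := lintegral_enorm_mollify_sub_sq_le (bumpOfRadius (hδ n)) (g := g) (K := Set.univ)
    (C := ε ^ 2) (hg.locallyIntegrable (by norm_num)) (fun y hy => by
      rw [Measure.restrict_univ, ← eLpNorm_two_sq]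
      gcongr
      exact hball (by simpa using hy.trans hn))
  rw [Measure.restrict_univ] at this
  refine (ENNReal.pow_le_pow_left_iff two_ne_zero).1 ?_
  rw [eLpNorm_two_sq]
  exact this

/-- Local approximation of a Sobolev function by smooth functions. -/
theorem IsWeakGradient.exists_smooth_approx {Ω : Set (EuclideanSpace ℝ (Fin N))} (hΩ : IsOpen Ω)
    {u : EuclideanSpace ℝ (Fin N) → ℝ} {G : EuclideanSpace ℝ (Fin N) → EuclideanSpace ℝ (Fin N)}
    (h : IsWeakGradient Ω u G) (hu : MemLpLoc Ω 2 u) (hG : MemLpLoc Ω 2 G)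
    {K : Set (EuclideanSpace ℝ (Fin N))} (hK : IsCompact K) (hKΩ : K ⊆ Ω) :
    ∃ w : ℕ → EuclideanSpace ℝ (Fin N) → ℝ, (∀ n, ContDiff ℝ ∞ (w n)) ∧
      Tendsto (fun n => eLpNorm (w n - u) 2 (volume.restrict K)) atTop (𝓝 0) ∧
      Tendsto (fun n => eLpNorm (gradient (w n) - G) 2 (volume.restrict K)) atTop (𝓝 0) ∧
      ∀ᵐ x ∂volume.restrict K, Tendsto (fun n => w n x) atTop (𝓝 (u x)) := by
  obtain ⟨r, hr, hrΩ⟩ := hK.exists_cthickening_subset_open hΩ hKΩ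
  set K' := Metric.cthickening r K with hK'
  have hK'c : IsCompact K' := hK.cthickening
  have hKK' : K ⊆ K' := Metric.self_subset_cthickening K
  have hδ : ∀ n : ℕ, 0 < r * (1 / ((n : ℝ) + 1)) := fun n => by positivity
  have hlim : Tendsto (fun n : ℕ => r * (1 / ((n : ℝ) + 1))) atTop (𝓝 0) := by
    simpa using tendsto_one_div_add_atTop_nhds_zero_nat.const_mul r
  have hle : ∀ n : ℕ, r * (1 / ((n : ℝ) + 1)) ≤ r := fun n => by
    have : (1 : ℝ) / ((n : ℝ) + 1) ≤ 1 := by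
      rw [div_le_one (by positivity)]; linarith [n.cast_nonneg (α := ℝ)]
    nlinarith
  have huL : MemLp (K'.indicator u) 2 volume :=
    (memLp_indicator_iff_restrict hK'c.measurableSet).2 (hu K' hK'c hrΩ)
  have hGL : MemLp (K'.indicator G) 2 volume :=
    (memLp_indicator_iff_restrict hK'c.measurableSet).2 (hG K' hK'c hrΩ)
  set w := fun n => mollify (hδ n) (K'.indicator u) with hw
  have hsm : ∀ n, ContDiff ℝ ∞ (w n) := fun n =>
    contDiff_mollify (hδ n) (huL.locallyIntegrable (by norm_num))
  have c1 : Tendsto (fun n => eLpNorm (w n - u) 2 (volume.restrict K)) atTop (𝓝 0) := by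
    refine tendsto_of_tendsto_of_tendsto_of_le_of_le tendsto_const_nhds
      (tendsto_eLpNorm_mollify_sub huL hδ hlim) (fun _ => zero_le) fun n => ?_
    refine le_trans (le_of_eq ?_) (eLpNorm_mono_measure _ (Measure.restrict_le_self (s := K)))
    refine eLpNorm_congr_ae ?_
    filter_upwards [ae_restrict_mem hK.measurableSet] with x hx
    simp [hw, hKK' hx]
  have c2 : Tendsto (fun n => eLpNorm (gradient (w n) - G) 2 (volume.restrict K)) atTop (𝓝 0) := by
    refine tendsto_of_tendsto_of_tendsto_of_le_of_le tendsto_const_nhds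
      (tendsto_eLpNorm_mollify_sub hGL hδ hlim) (fun _ => zero_le) fun n => ?_
    refine le_trans (le_of_eq ?_) (eLpNorm_mono_measure _ (Measure.restrict_le_self (s := K)))
    refine eLpNorm_congr_ae ?_
    filter_upwards [ae_restrict_mem hK.measurableSet] with x hx
    have hb : Metric.closedBall x (r * (1 / ((n : ℝ) + 1))) ⊆ K' :=
      (Metric.closedBall_subset_cthickening hx _).trans (Metric.cthickening_mono (hle n) K)
    simp only [hw, Pi.sub_apply]
    rw [h.gradient_mollify_indicator hΩ.measurableSet hK'c hrΩ (hδ n) hb,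
      Set.indicator_of_mem (hKK' hx)]
  have hmeas : TendstoInMeasure (volume.restrict K) w atTop u := by
    refine tendstoInMeasure_of_tendsto_eLpNorm (p := 2) (by norm_num)
      (fun n => (hsm n).continuous.aestronglyMeasurable) (hu K hK hKΩ).1 c1
  obtain ⟨ns, hns, hae⟩ := hmeas.exists_seq_tendsto_ae
  exact ⟨fun n => w (ns n), fun n => hsm _, c1.comp hns.tendsto_atTop, c2.comp hns.tendsto_atTop,
    hae⟩

end Mollification

/-! ### Exhaustions and difference quotients -/

section Rellich

variable {N : ℕ}

/-- An open set has a sequence of compact subsets that absorbs all its compact subsets. -/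
theorem IsOpen.exists_absorbing_compacts {Ω : Set (EuclideanSpace ℝ (Fin N))} (hΩ : IsOpen Ω) :
    ∃ K : ℕ → Set (EuclideanSpace ℝ (Fin N)), (∀ n, IsCompact (K n)) ∧ (∀ n, K n ⊆ Ω) ∧
      Monotone K ∧ ∀ L, IsCompact L → L ⊆ Ω → ∃ n, L ⊆ K n := by
  refine ⟨fun n => Metric.closedBall 0 n \ Metric.thickening (1 / ((n : ℝ) + 1)) Ωᶜ,
    fun n => (isCompact_closedBall 0 _).diff Metric.isOpen_thickening, fun n x hx => ?_,
    fun n k hnk => ?_, fun L hL hLΩ => ?_⟩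
  · by_contra h
    exact hx.2 (Metric.self_subset_thickening (by positivity) _ h)
  · refine Set.sdiff_subset_sdiff (Metric.closedBall_subset_closedBall (by exact_mod_cast hnk))
      (Metric.thickening_mono ?_ _)
    have : (n : ℝ) ≤ k := by exact_mod_cast hnk
    gcongr
  · obtain ⟨δ, hδ, hdis⟩ := (disjoint_compl_right.mono_left hLΩ).exists_thickenings hL
      hΩ.isClosed_compl
    obtain ⟨R, hR⟩ := hL.isBounded.subset_closedBall 0
    obtain ⟨n1, hn1⟩ := exists_nat_ge R
    obtain ⟨n2, hn2⟩ := exists_nat_one_div_lt hδ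
    refine ⟨max n1 n2, fun x hx => ⟨?_, fun hx' => ?_⟩⟩
    · refine Metric.closedBall_subset_closedBall ?_ (hR hx)
      exact hn1.trans (by exact_mod_cast le_max_left _ _)
    · refine (Set.disjoint_left.1 hdis) (Metric.self_subset_thickening hδ _ hx)
        (Metric.thickening_mono ?_ _ hx')
      refine le_trans ?_ hn2.le
      have : (n2 : ℝ) ≤ (max n1 n2 : ℕ) := by exact_mod_cast le_max_right _ _
      gcongr

theorem norm_gradient {φ : EuclideanSpace ℝ (Fin N) → ℝ} (x : EuclideanSpace ℝ (Fin N)) :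
    ‖gradient φ x‖ = ‖fderiv ℝ φ x‖ := by
  rw [gradient, LinearIsometryEquiv.norm_map]

theorem continuous_gradient {φ : EuclideanSpace ℝ (Fin N) → ℝ} (hφ : ContDiff ℝ ∞ φ) :
    Continuous (gradient φ) :=
  (LinearIsometryEquiv.continuous _).comp (hφ.continuous_fderiv (by simp))

theorem lintegral_sq_unitInterval_le {h : ℝ → ℝ≥0∞} (hh : AEMeasurable h (volume.restrict (Set.Icc 0 1))) :
    (∫⁻ t in Set.Icc (0 : ℝ) 1, h t) ^ 2 ≤ ∫⁻ t in Set.Icc (0 : ℝ) 1, h t ^ 2 := by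
  have h2 := ENNReal.lintegral_mul_le_Lp_mul_Lq (volume.restrict (Set.Icc (0 : ℝ) 1))
    Real.HolderConjugate.two_two hh (aemeasurable_const (b := (1 : ℝ≥0∞)))
  simp only [Pi.mul_apply, mul_one, ENNReal.one_rpow, lintegral_const, one_mul] at h2
  rw [Measure.restrict_apply_univ, Real.volume_Icc] at h2
  simp only [sub_zero, ENNReal.ofReal_one, ENNReal.one_rpow, mul_one] at h2
  calc (∫⁻ t in Set.Icc (0 : ℝ) 1, h t) ^ 2
      ≤ ((∫⁻ t in Set.Icc (0 : ℝ) 1, h t ^ (2 : ℝ)) ^ (1 / 2 : ℝ)) ^ 2 := by gcongr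
    _ = _ := by
      rw [← ENNReal.rpow_natCast, ← ENNReal.rpow_mul]
      norm_num

/-- The `L^2` modulus of continuity of a smooth function is controlled by its gradient. -/
theorem lintegral_translate_sub_sq_le {w : EuclideanSpace ℝ (Fin N) → ℝ} (hw : ContDiff ℝ ∞ w)
    {K K' : Set (EuclideanSpace ℝ (Fin N))} (hK : MeasurableSet K) (hK' : MeasurableSet K')
    {y : EuclideanSpace ℝ (Fin N)} (hy : ∀ x ∈ K, Metric.closedBall x ‖y‖ ⊆ K') :
    ∫⁻ x in K, ‖w (x - y) - w x‖ₑ ^ 2 ≤ ‖y‖ₑ ^ 2 * ∫⁻ x in K', ‖gradient w x‖ₑ ^ 2 := by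
  have hgc := continuous_gradient hw
  have s1 : ∀ x, ‖w (x - y) - w x‖ₑ ^ 2
      ≤ ∫⁻ t in Set.Icc (0 : ℝ) 1, ‖y‖ₑ ^ 2 * ‖gradient w (x - t • y)‖ₑ ^ 2 := by
    intro x
    have hd : ∀ t : ℝ, HasDerivAt (fun t : ℝ => w (x - t • y)) (fderiv ℝ w (x - t • y) (-y)) t := by
      intro t
      have h1 : HasDerivAt (fun t : ℝ => x - t • y) (-y) t := by
        simpa using ((hasDerivAt_id t).smul_const y).const_sub x
      exact ((hw.differentiable (by simp) _).hasFDerivAt).comp_hasDerivAt t h1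
    have hC : ContDiff ℝ 1 (fun t : ℝ => w (x - t • y)) :=
      (hw.of_le (by norm_cast)).comp (contDiff_const.sub (contDiff_id.smul contDiff_const))
    have h2 := enorm_sub_le_lintegral_deriv_of_contDiffOn_Icc hC.contDiffOn (zero_le_one' ℝ)
    simp only [one_smul, zero_smul, sub_zero] at h2
    calc _ ≤ (∫⁻ t in Set.Icc (0 : ℝ) 1, ‖y‖ₑ * ‖gradient w (x - t • y)‖ₑ) ^ 2 := by
          gcongr
          refine h2.trans (lintegral_mono fun t => ?_)
          rw [(hd t).deriv]
          rw [← ofReal_norm, ← ofReal_norm, ← ofReal_norm, ← ENNReal.ofReal_mul (norm_nonneg _)]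
          refine ENNReal.ofReal_le_ofReal ?_
          rw [norm_gradient, mul_comm]
          simpa using (fderiv ℝ w (x - t • y)).le_opNorm (-y)
      _ ≤ _ := by
          refine (lintegral_sq_unitInterval_le ?_).trans (le_of_eq ?_)
          · have : Continuous fun t : ℝ => gradient w (x - t • y) := by fun_prop
            exact (this.enorm.measurable.const_mul _).aemeasurable
          · simp only [mul_pow]
  have hcont : Continuous fun p : EuclideanSpace ℝ (Fin N) × ℝ => gradient w (p.1 - p.2 • y) := by
    fun_prop
  calc _ ≤ ∫⁻ x in K, ∫⁻ t in Set.Icc (0 : ℝ) 1, ‖y‖ₑ ^ 2 * ‖gradient w (x - t • y)‖ₑ ^ 2 :=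
        lintegral_mono s1
    _ = ∫⁻ t in Set.Icc (0 : ℝ) 1, ∫⁻ x in K, ‖y‖ₑ ^ 2 * ‖gradient w (x - t • y)‖ₑ ^ 2 :=
        lintegral_lintegral_swap
          ((hcont.enorm.measurable.pow_const 2).const_mul _).aemeasurable
    _ ≤ ∫⁻ t in Set.Icc (0 : ℝ) 1, ‖y‖ₑ ^ 2 * ∫⁻ x in K', ‖gradient w x‖ₑ ^ 2 := by
        refine setLIntegral_mono measurable_const fun t ht => ?_
        rw [lintegral_const_mul' _ _ (by simp)]
        refine mul_le_mul' le_rfl ?_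
        rw [← lintegral_indicator hK, ← lintegral_indicator hK',
          ← lintegral_sub_right_eq_self (fun x => K'.indicator _ x) (t • y)]
        refine lintegral_mono fun x => ?_
        by_cases hx : x ∈ K
        · have : x - t • y ∈ K' := by
            refine hy x hx ?_
            simp only [Metric.mem_closedBall, dist_eq_norm, sub_sub_cancel_left, norm_neg, norm_smul,
              Real.norm_eq_abs, abs_of_nonneg ht.1]
            exact mul_le_of_le_one_left (norm_nonneg _) ht.2
          simp [hx, this]
        · simp [hx]
    _ = _ := by simp

/-- At a fixed scale, mollification maps bounded sets of `L^1` to bounded, equi-Lipschitz sets of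
functions. -/
theorem exists_norm_mollify_le {δ : ℝ} (hδ : 0 < δ) : ∃ B : ℝ, 0 ≤ B ∧
    ∀ g : EuclideanSpace ℝ (Fin N) → ℝ, Integrable g volume →
      (∀ x, |mollify hδ g x| ≤ B * ∫ t, |g t|) ∧
      ∀ x y, |mollify hδ g x - mollify hδ g y| ≤ B * ‖x - y‖ * ∫ t, |g t| := by
  set ρ := (bumpOfRadius (N := N) hδ).normed volume with hρ
  have hcs : HasCompactSupport ρ := (bumpOfRadius (N := N) hδ).hasCompactSupport_normed
  have hcd : ContDiff ℝ 1 ρ := (bumpOfRadius (N := N) hδ).contDiff_normed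
  obtain ⟨B, hB⟩ := hcs.exists_bound_of_continuous hcd.continuous
  obtain ⟨L, hL⟩ := hcd.lipschitzWith_of_hasCompactSupport hcs one_ne_zero
  have hB0 : 0 ≤ B := (norm_nonneg _).trans (hB 0)
  refine ⟨max B L, le_max_of_le_left hB0, fun g hg => ⟨fun x => ?_, fun x y => ?_⟩⟩
  · rw [mollify_eq, ← Real.norm_eq_abs]
    calc _ ≤ ∫ t, max B L * |g t| := by
          refine norm_integral_le_of_norm_le (hg.abs.const_mul _) (Eventually.of_forall fun t => ?_)
          rw [norm_smul, Real.norm_eq_abs (g t)]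
          gcongr
          exact (hB _).trans (le_max_left _ _)
      _ = _ := integral_const_mul _ _
  · have hi : ∀ x, Integrable (fun t => ρ (x - t) • g t) volume := fun x =>
      hg.bdd_mul (c := B) ((hcd.continuous.comp (continuous_const.sub continuous_id)).aestronglyMeasurable)
        (Eventually.of_forall fun t => hB _)
    rw [mollify_eq, mollify_eq, ← integral_sub (hi x) (hi y), ← Real.norm_eq_abs]
    calc _ ≤ ∫ t, max B L * ‖x - y‖ * |g t| := by
          refine norm_integral_le_of_norm_le (hg.abs.const_mul _) (Eventually.of_forall fun t => ?_)
          rw [← sub_smul, norm_smul, Real.norm_eq_abs (g t)]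
          gcongr
          have := hL.dist_le_mul (x - t) (y - t)
          rw [dist_sub_right, dist_eq_norm, dist_eq_norm] at this
          exact this.trans (by gcongr; exact le_max_right _ _)
      _ = _ := integral_const_mul _ _

end Rellich

/-! ### Local compactness for smooth functions -/

section RellichCompactness

variable {N : ℕ}

theorem Continuous.memLp_restrict_of_isCompact {F : Type*} [NormedAddCommGroup F]
    {g : EuclideanSpace ℝ (Fin N) → F} (hg : Continuous g) {K : Set (EuclideanSpace ℝ (Fin N))}
    (hK : IsCompact K) (p : ℝ≥0∞) : MemLp g p (volume.restrict K) := by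
  have : IsFiniteMeasure (volume.restrict K) := isFiniteMeasure_restrict.2 hK.measure_lt_top.ne
  obtain ⟨C, hC⟩ := hK.exists_bound_of_continuousOn hg.continuousOn
  exact MemLp.of_bound hg.aestronglyMeasurable C
    ((ae_restrict_mem hK.measurableSet).mono hC)

theorem integral_abs_indicator_le {K : Set (EuclideanSpace ℝ (Fin N))} (hK : IsCompact K)
    {g : EuclideanSpace ℝ (Fin N) → ℝ} (hg : MemLp g 2 (volume.restrict K)) {C : ℝ≥0}
    (hC : eLpNorm g 2 (volume.restrict K) ≤ C) :
    ∫ t, |K.indicator g t| ≤ C * (volume.real K) ^ (1 / 2 : ℝ) := by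
  have hfin : volume K ≠ ⊤ := hK.measure_lt_top.ne
  have h1 : ∫ t, |K.indicator g t| = (eLpNorm g 1 (volume.restrict K)).toReal := by
    have : (fun t => |K.indicator g t|) = K.indicator (fun t => ‖g t‖) := by
      ext t; by_cases ht : t ∈ K <;> simp [ht]
    rw [this, integral_indicator hK.measurableSet, integral_norm_eq_lintegral_enorm hg.1,
      eLpNorm_one_eq_lintegral_enorm]
  have h2 := eLpNorm_le_eLpNorm_mul_rpow_measure_univ (p := 1) (q := 2) (by norm_num) hg.1
  rw [h1, Measure.restrict_apply_univ] at *
  have h3 : eLpNorm g 1 (volume.restrict K) ≤ C * volume K ^ (1 / 2 : ℝ) := by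
    refine h2.trans ?_
    norm_num
    gcongr
  have h4 := ENNReal.toReal_mono (by finiteness) h3
  rwa [ENNReal.toReal_mul, ← ENNReal.toReal_rpow] at h4

/-- If the mollifications of a bounded sequence converge at the points of a dense sequence,
then they converge everywhere. -/
theorem cauchySeq_mollify {δ : ℝ} (hδ : 0 < δ) {g : ℕ → EuclideanSpace ℝ (Fin N) → ℝ}
    (hg : ∀ k, Integrable (g k) volume) {C : ℝ} (hC : ∀ᶠ k in atTop, ∫ t, |g k t| ≤ C)
    {ℓ : ℕ → EReal}
    (hℓ : ∀ i, Tendsto (fun k => ((mollify hδ (g k) (TopologicalSpace.denseSeq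
      (EuclideanSpace ℝ (Fin N)) i) : ℝ) : EReal)) atTop (𝓝 (ℓ i)))
    (x : EuclideanSpace ℝ (Fin N)) : CauchySeq (fun k => mollify hδ (g k) x) := by
  obtain ⟨B, hB0, hB⟩ := exists_norm_mollify_le (N := N) hδ
  have hC0 : 0 ≤ C := by
    obtain ⟨k, hk⟩ := hC.exists
    exact (integral_nonneg fun _ => abs_nonneg _).trans hk
  set X := TopologicalSpace.denseSeq (EuclideanSpace ℝ (Fin N)) with hX
  have hcs : ∀ i, CauchySeq (fun k => mollify hδ (g k) (X i)) := by
    intro i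
    have hbd : ∀ᶠ k in atTop, |mollify hδ (g k) (X i)| ≤ B * C := by
      filter_upwards [hC] with k hk
      exact ((hB _ (hg k)).1 _).trans (by gcongr)
    have hl : ((-(B * C) : ℝ) : EReal) ≤ ℓ i := by
      refine ge_of_tendsto (hℓ i) ?_
      filter_upwards [hbd] with k hk
      exact EReal.coe_le_coe_iff.2 (abs_le.1 hk).1
    have hu : ℓ i ≤ ((B * C : ℝ) : EReal) := by
      refine le_of_tendsto (hℓ i) ?_
      filter_upwards [hbd] with k hk
      exact EReal.coe_le_coe_iff.2 (abs_le.1 hk).2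
    have hreal : ((ℓ i).toReal : EReal) = ℓ i :=
      EReal.coe_toReal (hu.trans_lt (EReal.coe_lt_top _)).ne
        ((EReal.bot_lt_coe _).trans_le hl).ne'
    have := hℓ i
    rw [← hreal, EReal.tendsto_coe] at this
    exact this.cauchySeq
  rw [Metric.cauchySeq_iff']
  intro ε hε
  obtain ⟨i, hi⟩ : ∃ i, dist x (X i) < ε / (4 * (B * C + 1)) :=
    (TopologicalSpace.denseRange_denseSeq _).exists_dist_lt x (by positivity)
  obtain ⟨n1, hn1⟩ := eventually_atTop.1 hC
  obtain ⟨n2, hn2⟩ := Metric.cauchySeq_iff.1 (hcs i) (ε / 2) (by positivity)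
  have hclose : ∀ k ≥ n1, |mollify hδ (g k) x - mollify hδ (g k) (X i)| ≤ ε / 4 := by
    intro k hk
    refine ((hB _ (hg k)).2 _ _).trans ?_
    rw [← dist_eq_norm]
    calc B * dist x (X i) * ∫ t, |g k t| ≤ B * dist x (X i) * C := by gcongr; exact hn1 k hk
      _ = (B * C) * dist x (X i) := by ring
      _ ≤ (B * C + 1) * (ε / (4 * (B * C + 1))) := by gcongr; linarith
      _ = ε / 4 := by field_simp
  refine ⟨max n1 n2, fun k hk => ?_⟩
  have h1 := hclose k ((le_max_left _ _).trans hk)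
  have h2 := hclose _ (le_max_left n1 n2)
  have h3 := hn2 k ((le_max_right _ _).trans hk) _ (le_max_right n1 n2)
  rw [Real.dist_eq] at h3 ⊢
  rw [abs_le] at h1 h2
  rw [abs_lt] at h3 ⊢
  constructor <;> linarith

/-- The Rellich compactness theorem for smooth functions that are locally bounded in `W^{1,2}`. -/
theorem exists_subseq_cauchy_of_smooth {Ω : Set (EuclideanSpace ℝ (Fin N))} (hΩ : IsOpen Ω)
    {w : ℕ → EuclideanSpace ℝ (Fin N) → ℝ} (hw : ∀ k, ContDiff ℝ ∞ (w k))
    (hb : ∀ K, IsCompact K → K ⊆ Ω → ∃ C : ℝ≥0, ∀ᶠ k in atTop,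
      eLpNorm (w k) 2 (volume.restrict K) ≤ C ∧
      eLpNorm (gradient (w k)) 2 (volume.restrict K) ≤ C) :
    ∃ σ : ℕ → ℕ, StrictMono σ ∧ ∀ K, IsCompact K → K ⊆ Ω →
      Tendsto (fun p : ℕ × ℕ => eLpNorm (w (σ p.1) - w (σ p.2)) 2 (volume.restrict K))
        atTop (𝓝 0) := by
  obtain ⟨K, hKc, hKΩ, -, hKabs⟩ := hΩ.exists_absorbing_compacts
  choose r hr hrΩ using fun n => (hKc n).exists_cthickening_subset_open hΩ (hKΩ n)
  set K' := fun n => Metric.cthickening (r n) (K n) with hK'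
  have hK'c : ∀ n, IsCompact (K' n) := fun n => (hKc n).cthickening
  have hδ : ∀ n j : ℕ, 0 < r n * (1 / ((j : ℝ) + 1)) := fun n j => mul_pos (hr n) (by positivity)
  have hwL : ∀ k n, MemLp (w k) 2 (volume.restrict (K' n)) := fun k n =>
    (hw k).continuous.memLp_restrict_of_isCompact (hK'c n) 2
  -- all mollifications, at all points of a dense sequence, converge along one subsequence; values in
  -- the compact space `EReal` spare a diagonal argument
  set a : ℕ → (ℕ × ℕ × ℕ) → EReal := fun k q =>
    ((mollify (hδ q.1 q.2.1) ((K' q.1).indicator (w k))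
      (TopologicalSpace.denseSeq (EuclideanSpace ℝ (Fin N)) q.2.2) : ℝ) : EReal) with ha
  obtain ⟨ℓ, σ, hσ, hlim⟩ := CompactSpace.tendsto_subseq a
  refine ⟨σ, hσ, fun L hL hLΩ => ?_⟩
  obtain ⟨n, hn⟩ := hKabs L hL hLΩ
  refine tendsto_of_tendsto_of_tendsto_of_le_of_le tendsto_const_nhds ?_ (fun _ => zero_le)
    (fun p => eLpNorm_mono_measure _ (Measure.restrict_mono_set volume hn))
  obtain ⟨C, hC⟩ := hb (K' n) (hK'c n) (hrΩ n)
  have hC' := hσ.tendsto_atTop.eventually hC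
  rw [ENNReal.tendsto_nhds_zero]
  intro ε hε
  obtain ⟨j, hj⟩ : ∃ j : ℕ, ENNReal.ofReal (r n * (1 / ((j : ℝ) + 1))) * C ≤ ε / 3 := by
    have h0 : Tendsto (fun j : ℕ => ENNReal.ofReal (r n * (1 / ((j : ℝ) + 1))) * C) atTop (𝓝 0) := by
      have h1 : Tendsto (fun j : ℕ => r n * (1 / ((j : ℝ) + 1))) atTop (𝓝 0) := by
        simpa using tendsto_one_div_add_atTop_nhds_zero_nat.const_mul (r n)
      have := ENNReal.Tendsto.mul_const (b := (C : ℝ≥0∞)) (ENNReal.tendsto_ofReal h1)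
        (Or.inr ENNReal.coe_ne_top)
      simpa using this
    have hε3 : 0 < ε / 3 := ENNReal.div_pos hε.ne' (by simp)
    exact ((ENNReal.tendsto_nhds_zero.1 h0) _ hε3).exists
  set δ := r n * (1 / ((j : ℝ) + 1)) with hδdef
  have hδr : δ ≤ r n := by
    have : (1 : ℝ) / ((j : ℝ) + 1) ≤ 1 := by
      rw [div_le_one (by positivity)]; linarith [j.cast_nonneg (α := ℝ)]
    nlinarith [hr n]
  set g := fun k => (K' n).indicator (w (σ k)) with hg
  have hgint : ∀ k, Integrable (g k) volume := fun k =>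
    (integrable_indicator_iff (hK'c n).measurableSet).2
      ((hw _).continuous.continuousOn.integrableOn_compact (hK'c n))
  have hgC : ∀ᶠ k in atTop, ∫ t, |g k t| ≤ C * (volume.real (K' n)) ^ (1 / 2 : ℝ) := by
    filter_upwards [hC'] with k hk
    exact integral_abs_indicator_le (hK'c n) (hwL _ n) hk.1
  have hmc : ∀ k, Continuous (mollify (hδ n j) (g k)) := fun k =>
    (contDiff_mollify (hδ n j) (hgint k).locallyIntegrable).continuous
  -- the mollification error is of order `δ`
  have herr : ∀ᶠ k in atTop,
      eLpNorm (w (σ k) - mollify (hδ n j) (g k)) 2 (volume.restrict (K n)) ≤ ε / 3 := by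
    filter_upwards [hC'] with k hk
    refine le_trans ?_ hj
    rw [eLpNorm_sub_comm]
    refine (ENNReal.pow_le_pow_left_iff two_ne_zero).1 ?_
    rw [eLpNorm_two_sq]
    have hcov : ∀ y : EuclideanSpace ℝ (Fin N), ‖y‖ < δ → ∀ x ∈ K n, Metric.closedBall x ‖y‖ ⊆ K' n :=
      fun y hy x hx => (Metric.closedBall_subset_cthickening hx _).trans
        (Metric.cthickening_mono (hy.le.trans hδr) _)
    have h1 := lintegral_enorm_mollify_sub_sq_le (bumpOfRadius (hδ n j)) (g := g k) (K := K n)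
      (C := (ENNReal.ofReal δ * C) ^ 2) (hgint k).locallyIntegrable (fun y hy => by
        have hyδ : ‖y‖ < δ := hy
        calc ∫⁻ x in K n, ‖g k (x - y) - g k x‖ₑ ^ 2
            = ∫⁻ x in K n, ‖w (σ k) (x - y) - w (σ k) x‖ₑ ^ 2 := by
              refine setLIntegral_congr_fun (hKc n).measurableSet fun x hx => ?_
              have m1 : x - y ∈ K' n := hcov y hyδ x hx (by simp)
              have m2 : x ∈ K' n := hcov y hyδ x hx (by simp)
              simp [hg, m1, m2]
          _ ≤ ‖y‖ₑ ^ 2 * ∫⁻ x in K' n, ‖gradient (w (σ k)) x‖ₑ ^ 2 :=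
              lintegral_translate_sub_sq_le (hw _) (hKc n).measurableSet (hK'c n).measurableSet
                (hcov y hyδ)
          _ ≤ (ENNReal.ofReal δ * C) ^ 2 := by
              rw [← eLpNorm_two_sq, ← mul_pow]
              gcongr
              · rw [← ofReal_norm]; exact ENNReal.ofReal_le_ofReal hyδ.le
              · exact hk.2)
    refine le_trans (le_of_eq ?_) h1
    refine setLIntegral_congr_fun (hKc n).measurableSet fun x hx => ?_
    have m2 : x ∈ K' n := Metric.self_subset_cthickening _ hx
    simp [hg, m2, mollify]
  -- the mollifications converge pointwise and boundedly
  have hpt := fun x => cauchySeq_mollify (hδ n j) hgint hgC (fun i => by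
    exact (tendsto_pi_nhds.1 hlim) (n, j, i)) x
  obtain ⟨B, hB0, hB⟩ := exists_norm_mollify_le (N := N) (hδ n j)
  set D := B * (C * (volume.real (K' n)) ^ (1 / 2 : ℝ)) with hD
  have hmid : Tendsto (fun p : ℕ × ℕ => eLpNorm (mollify (hδ n j) (g p.1) - mollify (hδ n j) (g p.2))
      2 (volume.restrict (K n)) ^ 2) atTop (𝓝 0) := by
    simp_rw [eLpNorm_two_sq]
    have h0 : ∫⁻ x in K n, (0 : ℝ≥0∞) = 0 := by simp
    rw [← h0]
    refine tendsto_lintegral_filter_of_dominated_convergence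
      (fun _ => ENNReal.ofReal (2 * D) ^ 2) ?_ ?_ ?_ ?_
    · exact Eventually.of_forall fun p => (((hmc _).sub (hmc _)).enorm.measurable).pow_const 2
    · have e1 : ∀ᶠ p : ℕ × ℕ in atTop, (∫ t, |g p.1 t| ≤ C * (volume.real (K' n)) ^ (1 / 2 : ℝ)) ∧
          ∫ t, |g p.2 t| ≤ C * (volume.real (K' n)) ^ (1 / 2 : ℝ) := by
        rw [← prod_atTop_atTop_eq]
        exact hgC.prod_mk hgC
      filter_upwards [e1] with p hp
      refine Eventually.of_forall fun x => ?_
      gcongr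
      rw [← ofReal_norm]
      refine ENNReal.ofReal_le_ofReal ?_
      have b1 : |mollify (hδ n j) (g p.1) x| ≤ D := ((hB _ (hgint p.1)).1 x).trans (by
        rw [hD]; gcongr; exact hp.1)
      have b2 : |mollify (hδ n j) (g p.2) x| ≤ D := ((hB _ (hgint p.2)).1 x).trans (by
        rw [hD]; gcongr; exact hp.2)
      calc _ ≤ |mollify (hδ n j) (g p.1) x| + |mollify (hδ n j) (g p.2) x| := norm_sub_le _ _
        _ ≤ 2 * D := by linarith
    · simp only [lintegral_const]
      have : volume (K n) < ⊤ := (hKc n).measure_lt_top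
      rw [Measure.restrict_apply_univ]
      finiteness
    · refine Eventually.of_forall fun x => ?_
      have h1 := cauchySeq_iff_tendsto_dist_atTop_0.1 (hpt x)
      have h2 : Tendsto (fun p : ℕ × ℕ => ENNReal.ofReal
          (dist (mollify (hδ n j) (g p.1) x) (mollify (hδ n j) (g p.2) x)) ^ 2) atTop (𝓝 0) := by
        have := (ENNReal.continuous_pow 2).tendsto _ |>.comp (ENNReal.tendsto_ofReal h1)
        simpa [Function.comp_def] using this
      refine h2.congr fun p => ?_
      rw [dist_eq_norm, ofReal_norm]
      rfl
  have hε3 : 0 < (ε / 3) ^ 2 :=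
    pos_iff_ne_zero.2 (pow_ne_zero 2 (ENNReal.div_pos hε.ne' (by simp)).ne')
  have herr2 : ∀ᶠ p : ℕ × ℕ in atTop,
      eLpNorm (w (σ p.1) - mollify (hδ n j) (g p.1)) 2 (volume.restrict (K n)) ≤ ε / 3 ∧
      eLpNorm (w (σ p.2) - mollify (hδ n j) (g p.2)) 2 (volume.restrict (K n)) ≤ ε / 3 := by
    rw [← prod_atTop_atTop_eq]
    exact herr.prod_mk herr
  filter_upwards [herr2, ENNReal.tendsto_nhds_zero.1 hmid _ hε3] with p hp hp2
  have hp3 := (ENNReal.pow_le_pow_left_iff two_ne_zero).1 hp2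
  have edec : w (σ p.1) - w (σ p.2) = (w (σ p.1) - mollify (hδ n j) (g p.1))
      + (mollify (hδ n j) (g p.1) - mollify (hδ n j) (g p.2))
      - (w (σ p.2) - mollify (hδ n j) (g p.2)) := by abel
  have hwm := fun k => ((hw (σ k)).continuous.aestronglyMeasurable (μ := volume.restrict (K n)))
  have hmm := fun k => ((hmc k).aestronglyMeasurable (μ := volume.restrict (K n)))
  rw [edec]
  calc _ ≤ eLpNorm ((w (σ p.1) - mollify (hδ n j) (g p.1))
      + (mollify (hδ n j) (g p.1) - mollify (hδ n j) (g p.2))) 2 (volume.restrict (K n)) +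
      eLpNorm (w (σ p.2) - mollify (hδ n j) (g p.2)) 2 (volume.restrict (K n)) :=
        eLpNorm_sub_le (((hwm _).sub (hmm _)).add ((hmm _).sub (hmm _)))
          ((hwm _).sub (hmm _)) (by norm_num)
    _ ≤ (ε / 3 + ε / 3) + ε / 3 := by
        gcongr
        · exact (eLpNorm_add_le ((hwm _).sub (hmm _)) ((hmm _).sub (hmm _)) (by norm_num)).trans
            (add_le_add hp.1 hp3)
        · exact hp.2
    _ = ε := ENNReal.add_thirds ε

end RellichCompactness

/-! ### Local compactness and `L^2` limits -/

section SobolevCompactness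

variable {N : ℕ}

/-- The Rellich compactness theorem: a sequence that is locally bounded in `W^{1,2}` has a
subsequence that is Cauchy in `L^2_loc`. -/
theorem exists_subseq_cauchy_of_weakGradient {Ω : Set (EuclideanSpace ℝ (Fin N))} (hΩ : IsOpen Ω)
    {u : ℕ → EuclideanSpace ℝ (Fin N) → ℝ}
    {G : ℕ → EuclideanSpace ℝ (Fin N) → EuclideanSpace ℝ (Fin N)}
    (h : ∀ k, IsWeakGradient Ω (u k) (G k)) (hu : ∀ k, MemLpLoc Ω 2 (u k))
    (hG : ∀ k, MemLpLoc Ω 2 (G k))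
    (hb : ∀ K, IsCompact K → K ⊆ Ω → ∃ C : ℝ≥0, ∀ k,
      eLpNorm (u k) 2 (volume.restrict K) ≤ C ∧ eLpNorm (G k) 2 (volume.restrict K) ≤ C) :
    ∃ σ : ℕ → ℕ, StrictMono σ ∧ ∀ K, IsCompact K → K ⊆ Ω →
      Tendsto (fun p : ℕ × ℕ => eLpNorm (u (σ p.1) - u (σ p.2)) 2 (volume.restrict K))
        atTop (𝓝 0) := by
  obtain ⟨K, hKc, hKΩ, hKm, hKabs⟩ := hΩ.exists_absorbing_compacts
  -- replace `u k` by a smooth function that is `1 / (k + 1)`-close to it on `K k`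
  have happ : ∀ k : ℕ, ∃ w : EuclideanSpace ℝ (Fin N) → ℝ, ContDiff ℝ ∞ w ∧
      eLpNorm (w - u k) 2 (volume.restrict (K k)) ≤ ((k : ℝ≥0∞) + 1)⁻¹ ∧
      eLpNorm (gradient w - G k) 2 (volume.restrict (K k)) ≤ ((k : ℝ≥0∞) + 1)⁻¹ := by
    intro k
    obtain ⟨w, hw, h1, h2, -⟩ := (h k).exists_smooth_approx hΩ (hu k) (hG k) (hKc k) (hKΩ k)
    have hpos : (0 : ℝ≥0∞) < ((k : ℝ≥0∞) + 1)⁻¹ := by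
      rw [ENNReal.inv_pos]; finiteness
    obtain ⟨n, hn1, hn2⟩ := ((ENNReal.tendsto_nhds_zero.1 h1 _ hpos).and
      (ENNReal.tendsto_nhds_zero.1 h2 _ hpos)).exists
    exact ⟨w n, hw n, hn1, hn2⟩
  choose w hw hw1 hw2 using happ
  have hle1 : ∀ k : ℕ, ((k : ℝ≥0∞) + 1)⁻¹ ≤ 1 := fun k => by
    rw [ENNReal.inv_le_one]; exact le_add_self
  have huK : ∀ k n, MemLp (u k) 2 (volume.restrict (K n)) := fun k n => hu k _ (hKc n) (hKΩ n)
  have hGK : ∀ k n, MemLp (G k) 2 (volume.restrict (K n)) := fun k n => hG k _ (hKc n) (hKΩ n)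
  have hwm : ∀ k n, AEStronglyMeasurable (w k) (volume.restrict (K n)) := fun k n =>
    (hw k).continuous.aestronglyMeasurable
  have hgm : ∀ k n, AEStronglyMeasurable (gradient (w k)) (volume.restrict (K n)) := fun k n =>
    (continuous_gradient (hw k)).aestronglyMeasurable
  have hdist : ∀ n k, n ≤ k → eLpNorm (w k - u k) 2 (volume.restrict (K n)) ≤ ((k : ℝ≥0∞) + 1)⁻¹ :=
    fun n k hnk => (eLpNorm_mono_measure _ (Measure.restrict_mono_set volume (hKm hnk))).trans
      (hw1 k)
  obtain ⟨σ, hσ, hc⟩ := exists_subseq_cauchy_of_smooth hΩ hw (fun L hL hLΩ => by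
    obtain ⟨n, hn⟩ := hKabs L hL hLΩ
    obtain ⟨C, hC⟩ := hb (K n) (hKc n) (hKΩ n)
    refine ⟨1 + C, ?_⟩
    filter_upwards [eventually_ge_atTop n] with k hk
    constructor
    · refine (eLpNorm_mono_measure _ (Measure.restrict_mono_set volume hn)).trans ?_
      calc eLpNorm (w k) 2 (volume.restrict (K n))
          = eLpNorm ((w k - u k) + u k) 2 (volume.restrict (K n)) := by rw [sub_add_cancel]
        _ ≤ _ := eLpNorm_add_le ((hwm k n).sub (huK k n).1) (huK k n).1 (by norm_num)
        _ ≤ 1 + C := add_le_add ((hdist n k hk).trans (hle1 k)) (hC k).1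
        _ = _ := by push_cast; rfl
    · refine (eLpNorm_mono_measure _ (Measure.restrict_mono_set volume hn)).trans ?_
      calc eLpNorm (gradient (w k)) 2 (volume.restrict (K n))
          = eLpNorm ((gradient (w k) - G k) + G k) 2 (volume.restrict (K n)) := by
            rw [sub_add_cancel]
        _ ≤ _ := eLpNorm_add_le ((hgm k n).sub (hGK k n).1) (hGK k n).1 (by norm_num)
        _ ≤ 1 + C := add_le_add (((eLpNorm_mono_measure _ (Measure.restrict_mono_set volume
            (hKm hk))).trans (hw2 k)).trans (hle1 k)) (hC k).2
        _ = _ := by push_cast; rfl)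
  refine ⟨σ, hσ, fun L hL hLΩ => ?_⟩
  obtain ⟨n, hn⟩ := hKabs L hL hLΩ
  have hinv : Tendsto (fun k : ℕ => ((σ k : ℝ≥0∞) + 1)⁻¹) atTop (𝓝 0) := by
    have h1 : Tendsto (fun k : ℕ => ((k + 1 : ℕ) : ℝ≥0∞)⁻¹) atTop (𝓝 0) :=
      ENNReal.tendsto_inv_nat_nhds_zero.comp (tendsto_add_atTop_nat 1)
    simpa [Function.comp_def] using h1.comp hσ.tendsto_atTop
  have hsum : Tendsto (fun p : ℕ × ℕ => ((σ p.1 : ℝ≥0∞) + 1)⁻¹ +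
      eLpNorm (w (σ p.1) - w (σ p.2)) 2 (volume.restrict (K n)) + ((σ p.2 : ℝ≥0∞) + 1)⁻¹)
      atTop (𝓝 0) := by
    have h1 : Tendsto (fun p : ℕ × ℕ => ((σ p.1 : ℝ≥0∞) + 1)⁻¹) atTop (𝓝 0) := by
      rw [← prod_atTop_atTop_eq]; exact hinv.comp tendsto_fst
    have h2 : Tendsto (fun p : ℕ × ℕ => ((σ p.2 : ℝ≥0∞) + 1)⁻¹) atTop (𝓝 0) := by
      rw [← prod_atTop_atTop_eq]; exact hinv.comp tendsto_snd
    simpa using (h1.add (hc (K n) (hKc n) (hKΩ n))).add h2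
  refine tendsto_of_tendsto_of_tendsto_of_le_of_le' tendsto_const_nhds hsum
    (Eventually.of_forall fun _ => zero_le) ?_
  have hev : ∀ᶠ p : ℕ × ℕ in atTop, n ≤ σ p.1 ∧ n ≤ σ p.2 := by
    rw [← prod_atTop_atTop_eq]
    exact (hσ.tendsto_atTop.eventually_ge_atTop n).prod_mk
      (hσ.tendsto_atTop.eventually_ge_atTop n)
  filter_upwards [hev] with p hp
  refine (eLpNorm_mono_measure _ (Measure.restrict_mono_set volume hn)).trans ?_
  have edec : u (σ p.1) - u (σ p.2) = ((u (σ p.1) - w (σ p.1)) + (w (σ p.1) - w (σ p.2)))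
      + (w (σ p.2) - u (σ p.2)) := by abel
  rw [edec]
  have m1 := (huK (σ p.1) n).1.sub (hwm (σ p.1) n)
  have m2 := (hwm (σ p.1) n).sub (hwm (σ p.2) n)
  have m3 := (hwm (σ p.2) n).sub (huK (σ p.2) n).1
  refine (eLpNorm_add_le (m1.add m2) m3 (by norm_num)).trans (add_le_add ?_ (hdist _ _ hp.2))
  refine (eLpNorm_add_le m1 m2 (by norm_num)).trans (add_le_add ?_ le_rfl)
  rw [eLpNorm_sub_comm]
  exact hdist _ _ hp.1

/-- Vitali's theorem: on a finite measure space, a family that is bounded in `L^p`, `p > 2`, and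
tends to zero in measure tends to zero in `L^2`. -/
theorem tendsto_eLpNorm_two_of_tendstoInMeasure {α ι F : Type*} [MeasurableSpace α]
    [NormedAddCommGroup F] {ν : Measure α} [IsFiniteMeasure ν] {l : Filter ι} {f : ι → α → F}
    {r : ℝ} (hr : 2 < r) (hm : ∀ i, AEStronglyMeasurable (f i) ν) {C : ℝ≥0}
    (hC : ∀ i, eLpNorm (f i) (ENNReal.ofReal r) ν ≤ C)
    (h0 : TendstoInMeasure ν f l 0) :
    Tendsto (fun i => eLpNorm (f i) 2 ν) l (𝓝 0) := by
  have hs : 0 < 1 / 2 - 1 / r := by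
    rw [sub_pos]; exact one_div_lt_one_div_of_lt (by norm_num) hr
  have key : ∀ ε : ℝ≥0, 0 < ε → ∀ i, eLpNorm (f i) 2 ν ≤
      C * ν {x | (ε : ℝ≥0∞) ≤ edist (f i x) ((0 : α → F) x)} ^ (1 / 2 - 1 / r)
        + ε * ν Set.univ ^ (1 / 2 : ℝ) := by
    intro ε hε i
    set T := toMeasurable ν {x | (ε : ℝ≥0∞) ≤ edist (f i x) ((0 : α → F) x)} with hT
    have hTm : MeasurableSet T := measurableSet_toMeasurable _ _
    have hsplit : f i = T.indicator (f i) + Tᶜ.indicator (f i) :=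
      (Set.indicator_self_add_compl T (f i)).symm
    have h1 : eLpNorm (T.indicator (f i)) 2 ν ≤
        C * ν {x | (ε : ℝ≥0∞) ≤ edist (f i x) ((0 : α → F) x)} ^ (1 / 2 - 1 / r) := by
      rw [eLpNorm_indicator_eq_eLpNorm_restrict hTm]
      have h2r : (2 : ℝ≥0∞) ≤ ENNReal.ofReal r := by
        rw [← ENNReal.ofReal_ofNat]; exact ENNReal.ofReal_le_ofReal hr.le
      refine (eLpNorm_le_eLpNorm_mul_rpow_measure_univ h2r (hm i).restrict).trans ?_
      rw [Measure.restrict_apply_univ, hT, measure_toMeasurable,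
        ENNReal.toReal_ofReal (by linarith), ENNReal.toReal_ofNat]
      gcongr
      exact (eLpNorm_mono_measure _ Measure.restrict_le_self).trans (hC i)
    have h2 : eLpNorm (Tᶜ.indicator (f i)) 2 ν ≤ ε * ν Set.univ ^ (1 / 2 : ℝ) := by
      have := eLpNorm_le_of_ae_enorm_bound (p := 2) (μ := ν) (f := Tᶜ.indicator (f i)) (C := ε)
        (Eventually.of_forall fun x => by
          by_cases hx : x ∈ T
          · simp [hx]
          · have hx' : x ∉ {x | (ε : ℝ≥0∞) ≤ edist (f i x) ((0 : α → F) x)} := fun h' =>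
              hx (subset_toMeasurable _ _ h')
            simp only [Pi.zero_apply, edist_zero_right, Set.mem_ofPred_eq, not_le] at hx'
            simpa [hx] using hx'.le)
      refine this.trans (le_of_eq ?_)
      simp
    calc eLpNorm (f i) 2 ν = eLpNorm (T.indicator (f i) + Tᶜ.indicator (f i)) 2 ν := by
          rw [← hsplit]
      _ ≤ _ := eLpNorm_add_le ((hm i).indicator hTm) ((hm i).indicator hTm.compl) (by norm_num)
      _ ≤ _ := add_le_add h1 h2
  rw [ENNReal.tendsto_nhds_zero]
  intro η hη
  have hηt : 0 < η / 2 := ENNReal.half_pos hη.ne'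
  obtain ⟨ε, hε, hεη⟩ : ∃ ε : ℝ≥0, 0 < ε ∧ (ε : ℝ≥0∞) * ν Set.univ ^ (1 / 2 : ℝ) ≤ η / 2 := by
    have h1 : Tendsto (fun ε : ℝ≥0 => (ε : ℝ≥0∞) * ν Set.univ ^ (1 / 2 : ℝ)) (𝓝[>] 0) (𝓝 0) := by
      have h2 : Tendsto (fun ε : ℝ≥0 => (ε : ℝ≥0∞)) (𝓝 0) (𝓝 ((0 : ℝ≥0) : ℝ≥0∞)) :=
        ENNReal.tendsto_coe.2 tendsto_id
      have := ENNReal.Tendsto.mul_const (b := ν Set.univ ^ (1 / 2 : ℝ)) h2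
        (Or.inr (by finiteness))
      simp only [ENNReal.coe_zero, zero_mul] at this
      exact this.mono_left nhdsWithin_le_nhds
    obtain ⟨ε, h3, h4⟩ := ((ENNReal.tendsto_nhds_zero.1 h1 _ hηt).and self_mem_nhdsWithin).exists
    exact ⟨ε, h4, h3⟩
  have h5 : Tendsto (fun i => (C : ℝ≥0∞) *
      ν {x | (ε : ℝ≥0∞) ≤ edist (f i x) ((0 : α → F) x)} ^ (1 / 2 - 1 / r)) l (𝓝 0) := by
    have := (ENNReal.continuous_rpow_const (y := 1 / 2 - 1 / r)).tendsto 0 |>.comp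
      (h0 ε (by exact_mod_cast hε))
    rw [ENNReal.zero_rpow_of_pos hs] at this
    simpa using ENNReal.Tendsto.const_mul (a := (C : ℝ≥0∞)) this (Or.inr ENNReal.coe_ne_top)
  filter_upwards [ENNReal.tendsto_nhds_zero.1 h5 _ hηt] with i hi
  calc _ ≤ _ := key ε hε i
    _ ≤ η / 2 + η / 2 := add_le_add hi hεη
    _ = η := ENNReal.add_halves η

theorem exists_tendsto_of_cauchy_eLpNorm_two {α F : Type*} [MeasurableSpace α]
    [NormedAddCommGroup F] [CompleteSpace F] {ν : Measure α} {f : ℕ → α → F}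
    (hf : ∀ k, MemLp (f k) 2 ν)
    (hc : Tendsto (fun p : ℕ × ℕ => eLpNorm (f p.1 - f p.2) 2 ν) atTop (𝓝 0)) :
    ∃ g, MemLp g 2 ν ∧ Tendsto (fun k => eLpNorm (f k - g) 2 ν) atTop (𝓝 0) := by
  have hcs : CauchySeq (fun k => (hf k).toLp (f k)) := by
    rw [EMetric.cauchySeq_iff]
    intro ε hε
    have h1 := (ENNReal.tendsto_nhds_zero.1 hc) (ε / 2) (ENNReal.half_pos hε.ne')
    by_cases hεt : ε = ⊤
    · subst hεt
      exact ⟨0, fun m _ n _ => edist_lt_top _ _⟩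
    obtain ⟨⟨a, b⟩, hab⟩ := eventually_atTop.1 h1
    refine ⟨max a b, fun m hm n hn => ?_⟩
    rw [Lp.edist_toLp_toLp]
    exact (hab (m, n) ⟨(le_max_left _ _).trans hm, (le_max_right _ _).trans hn⟩).trans_lt
      (ENNReal.half_lt_self hε.ne' hεt)
  obtain ⟨g, hg⟩ := cauchySeq_tendsto_of_complete hcs
  refine ⟨g, Lp.memLp g, ?_⟩
  rw [Lp.tendsto_Lp_iff_tendsto_eLpNorm'] at hg
  refine hg.congr fun k => eLpNorm_congr_ae ?_
  filter_upwards [(hf k).coeFn_toLp] with x hx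
  simp [hx]

/-- Smooth cutoff functions. -/
theorem exists_cutoff {Ω : Set (EuclideanSpace ℝ (Fin N))} (hΩ : IsOpen Ω)
    {K : Set (EuclideanSpace ℝ (Fin N))} (hK : IsCompact K) (hKΩ : K ⊆ Ω) :
    ∃ η : EuclideanSpace ℝ (Fin N) → ℝ, IsTestFunction Ω η ∧ (∀ x, 0 ≤ η x) ∧ (∀ x, η x ≤ 1) ∧
      ∀ x ∈ K, η x = 1 := by
  obtain ⟨r, hr, hrΩ⟩ := hK.exists_cthickening_subset_open hΩ hKΩ
  obtain ⟨f, hf, hfr, hfs, hf1⟩ := exists_contMDiff_support_eq_eq_one_iff (n := ⊤)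
    (modelWithCornersSelf ℝ (EuclideanSpace ℝ (Fin N))) (Metric.isOpen_thickening (δ := r) (E := K))
    hK.isClosed (Metric.self_subset_thickening hr K)
  have hts : tsupport f ⊆ Metric.cthickening r K := by
    rw [tsupport, hfs]; exact Metric.closure_thickening_subset_cthickening r K
  refine ⟨f, ⟨hf.contDiff, hK.cthickening.of_isClosed_subset (isClosed_tsupport f) hts,
    hts.trans hrΩ⟩, fun x => (hfr ⟨x, rfl⟩).1, fun x => (hfr ⟨x, rfl⟩).2, fun x hx => (hf1 x).1 hx⟩

end SobolevCompactness

/-! ### Testing a Poisson equation with truncations -/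

section Energy

variable {N : ℕ}

/-- `u ∈ W^{1,2}_loc(Ω)`, with weak gradient `G`, solves `-Δu = g` in the sense of distributions,
where `g ∈ L^1_loc(Ω)`. -/
structure IsPoissonSolution (Ω : Set (EuclideanSpace ℝ (Fin N))) (u : EuclideanSpace ℝ (Fin N) → ℝ)
    (G : EuclideanSpace ℝ (Fin N) → EuclideanSpace ℝ (Fin N)) (g : EuclideanSpace ℝ (Fin N) → ℝ) :
    Prop where
  isWeakGradient : IsWeakGradient Ω u G
  memLpLoc_fun : MemLpLoc Ω 2 u
  memLpLoc_grad : MemLpLoc Ω 2 G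
  memLpLoc_rhs : MemLpLoc Ω 1 g
  integral_eq : ∀ φ : EuclideanSpace ℝ (Fin N) → ℝ, IsTestFunction Ω φ →
    ∫ x in Ω, inner ℝ (G x) (gradient φ x) = ∫ x in Ω, g x * φ x

theorem IsTestFunction.continuous {Ω : Set (EuclideanSpace ℝ (Fin N))}
    {φ : EuclideanSpace ℝ (Fin N) → ℝ} (h : IsTestFunction Ω φ) : Continuous φ :=
  h.contDiff.continuous

theorem IsTestFunction.continuous_gradient {Ω : Set (EuclideanSpace ℝ (Fin N))}
    {φ : EuclideanSpace ℝ (Fin N) → ℝ} (h : IsTestFunction Ω φ) : Continuous (gradient φ) :=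
  _root_.continuous_gradient h.contDiff

theorem IsTestFunction.gradient_eq_zero {Ω : Set (EuclideanSpace ℝ (Fin N))}
    {φ : EuclideanSpace ℝ (Fin N) → ℝ} (_h : IsTestFunction Ω φ) {x : EuclideanSpace ℝ (Fin N)}
    (hx : x ∉ tsupport φ) : gradient φ x = 0 :=
  gradient_eq_zero_of_notMem_tsupport hx

theorem IsTestFunction.exists_bound {Ω : Set (EuclideanSpace ℝ (Fin N))}
    {φ : EuclideanSpace ℝ (Fin N) → ℝ} (h : IsTestFunction Ω φ) :
    ∃ M : ℝ, 0 ≤ M ∧ (∀ x, |φ x| ≤ M) ∧ ∀ x, ‖gradient φ x‖ ≤ M := by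
  obtain ⟨M1, h1⟩ := h.hasCompactSupport.exists_bound_of_continuous h.continuous
  obtain ⟨M2, h2⟩ := (h.hasCompactSupport.fderiv ℝ).exists_bound_of_continuous
    (h.contDiff.continuous_fderiv (by simp))
  refine ⟨max M1 M2, le_max_of_le_left ((norm_nonneg _).trans (h1 0)),
    fun x => (h1 x).trans (le_max_left _ _), fun x => ?_⟩
  rw [norm_gradient]
  exact (h2 x).trans (le_max_right _ _)

/-- Integrals over `Ω` of functions vanishing off the support of a test function. -/
theorem setIntegral_eq_tsupport {F : Type*} [NormedAddCommGroup F] [NormedSpace ℝ F]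
    {Ω : Set (EuclideanSpace ℝ (Fin N))} (hΩ : IsOpen Ω) {φ : EuclideanSpace ℝ (Fin N) → ℝ}
    (hφ : IsTestFunction Ω φ) {f : EuclideanSpace ℝ (Fin N) → F} (hf : ∀ x, x ∉ tsupport φ → f x = 0) :
    ∫ x in Ω, f x = ∫ x in tsupport φ, f x :=
  setIntegral_eq_of_subset_of_forall_sdiff_eq_zero hΩ.measurableSet hφ.tsupport_subset
    fun x hx => hf x hx.2

theorem gradient_mul {w η : EuclideanSpace ℝ (Fin N) → ℝ} {x : EuclideanSpace ℝ (Fin N)}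
    (hw : DifferentiableAt ℝ w x) (hη : DifferentiableAt ℝ η x) :
    gradient (fun y => w y * η y) x = w x • gradient η x + η x • gradient w x := by
  simp only [gradient]
  rw [fderiv_fun_mul hw hη, map_add, map_smul, map_smul]

theorem gradient_comp_mul {T : ℝ → ℝ} (hT : Differentiable ℝ T)
    {w η : EuclideanSpace ℝ (Fin N) → ℝ} {x : EuclideanSpace ℝ (Fin N)}
    (hw : DifferentiableAt ℝ w x) (hη : DifferentiableAt ℝ η x) :
    gradient (fun y => T (w y) * η y) x
      = T (w x) • gradient η x + (η x * deriv T (w x)) • gradient w x := by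
  have h1 : HasFDerivAt (fun y => T (w y)) (deriv T (w x) • fderiv ℝ w x) x :=
    (hT (w x)).hasDerivAt.comp_hasFDerivAt x hw.hasFDerivAt
  rw [gradient_mul h1.differentiableAt hη, mul_smul]
  congr 2
  simp only [gradient]
  rw [h1.fderiv, map_smul]

theorem IsTestFunction.comp_mul {Ω : Set (EuclideanSpace ℝ (Fin N))}
    {η : EuclideanSpace ℝ (Fin N) → ℝ} (hη : IsTestFunction Ω η) {T : ℝ → ℝ} (hT : ContDiff ℝ ∞ T)
    {w : EuclideanSpace ℝ (Fin N) → ℝ} (hw : ContDiff ℝ ∞ w) :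
    IsTestFunction Ω (fun y => T (w y) * η y) where
  contDiff := (hT.comp hw).mul hη.contDiff
  hasCompactSupport := hη.hasCompactSupport.mul_left
  tsupport_subset := (closure_mono fun x hx => by
    simp only [Function.mem_support] at hx ⊢
    exact right_ne_zero_of_mul hx).trans hη.tsupport_subset

theorem integrable_inner_of_memLp_two {α F : Type*} [MeasurableSpace α] [NormedAddCommGroup F]
    [InnerProductSpace ℝ F] {μ : Measure α} {W V : α → F} (hW : MemLp W 2 μ) (hV : MemLp V 2 μ) :
    Integrable (fun x => inner ℝ (W x) (V x)) μ := by
  refine Integrable.mono' ((hW.integrable_norm_pow (by norm_num)).add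
    (hV.integrable_norm_pow (by norm_num))) (hW.1.inner hV.1) (Eventually.of_forall fun x => ?_)
  refine (norm_inner_le_norm _ _).trans ?_
  simp only [Pi.add_apply]
  nlinarith [sq_nonneg (‖W x‖ - ‖V x‖), sq_nonneg (‖W x‖ + ‖V x‖)]

theorem tendsto_integral_bdd_inner {α F : Type*} [MeasurableSpace α] [NormedAddCommGroup F]
    [InnerProductSpace ℝ F] {μ : Measure α} {W : α → F} (hW : MemLp W 2 μ) {V : ℕ → α → F}
    (hV : Tendsto (fun n => eLpNorm (V n) 2 μ) atTop (𝓝 0)) (hVm : ∀ n, AEStronglyMeasurable (V n) μ)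
    {b : ℕ → α → ℝ} {M : ℝ} (hb : ∀ n x, |b n x| ≤ M) :
    Tendsto (fun n => ∫ x, b n x * inner ℝ (W x) (V n x) ∂μ) atTop (𝓝 0) := by
  have hlim : Tendsto (fun n => ENNReal.ofReal M * (eLpNorm W 2 μ * eLpNorm (V n) 2 μ)) atTop (𝓝 0) := by
    have := ENNReal.Tendsto.const_mul (a := eLpNorm W 2 μ) hV (Or.inr hW.2.ne)
    rw [mul_zero] at this
    simpa using ENNReal.Tendsto.const_mul (a := ENNReal.ofReal M) this (Or.inr ENNReal.ofReal_ne_top)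
  rw [tendsto_iff_edist_tendsto_0]
  refine tendsto_of_tendsto_of_tendsto_of_le_of_le tendsto_const_nhds hlim (fun _ => zero_le)
    fun n => ?_
  simp only [edist_zero_right]
  refine (enorm_integral_le_lintegral_enorm _).trans ?_
  have h2 := ENNReal.lintegral_mul_le_Lp_mul_Lq μ Real.HolderConjugate.two_two hW.1.enorm
    (hVm n).enorm
  calc _ ≤ ∫⁻ x, ENNReal.ofReal M * (‖W x‖ₑ * ‖V n x‖ₑ) ∂μ := by
        refine lintegral_mono fun x => ?_
        rw [enorm_mul]
        gcongr
        · rw [← ofReal_norm]; exact ENNReal.ofReal_le_ofReal (hb n x)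
        · rw [← ofReal_norm, ← ofReal_norm, ← ofReal_norm, ← ENNReal.ofReal_mul (norm_nonneg _)]
          exact ENNReal.ofReal_le_ofReal (norm_inner_le_norm _ _)
    _ = ENNReal.ofReal M * ∫⁻ x, (‖W x‖ₑ * ‖V n x‖ₑ) ∂μ :=
        lintegral_const_mul' _ _ ENNReal.ofReal_ne_top
    _ ≤ _ := by
        refine mul_le_mul' le_rfl (h2.trans (le_of_eq ?_))
        simp [eLpNorm_eq_lintegral_rpow_enorm_toReal]

/-- A solution of `-Δw = g` may be tested with `T(w) η`, where `T` is a smooth bounded function with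
bounded derivative. -/
theorem IsPoissonSolution.integral_comp_mul {Ω : Set (EuclideanSpace ℝ (Fin N))} (hΩ : IsOpen Ω)
    {w : EuclideanSpace ℝ (Fin N) → ℝ} {W : EuclideanSpace ℝ (Fin N) → EuclideanSpace ℝ (Fin N)}
    {g : EuclideanSpace ℝ (Fin N) → ℝ} (h : IsPoissonSolution Ω w W g)
    {T : ℝ → ℝ} (hT : ContDiff ℝ ∞ T) {A B : ℝ} (hA : ∀ s, |T s| ≤ A) (hB : ∀ s, |deriv T s| ≤ B)
    {η : EuclideanSpace ℝ (Fin N) → ℝ} (hη : IsTestFunction Ω η) :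
    Integrable (fun x => η x * deriv T (w x) * ‖W x‖ ^ 2) (volume.restrict (tsupport η)) ∧
    (∫ x in tsupport η, T (w x) * inner ℝ (W x) (gradient η x))
      + (∫ x in tsupport η, η x * deriv T (w x) * ‖W x‖ ^ 2)
      = ∫ x in tsupport η, g x * (T (w x) * η x) := by
  set K := tsupport η with hK
  have hKc : IsCompact K := hη.hasCompactSupport
  have hKΩ : K ⊆ Ω := hη.tsupport_subset
  have hfin : IsFiniteMeasure (volume.restrict K) := isFiniteMeasure_restrict.2 hKc.measure_lt_top.ne
  obtain ⟨M, hM0, hM1, hM2⟩ := hη.exists_bound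
  have hA0 : 0 ≤ A := (abs_nonneg _).trans (hA 0)
  have hB0 : 0 ≤ B := (abs_nonneg _).trans (hB 0)
  have hTd : Differentiable ℝ T := hT.differentiable (by simp)
  have hT' : Continuous (deriv T) := hT.continuous_deriv (by simp)
  obtain ⟨v, hv, hv1, hv2, hv3⟩ := h.isWeakGradient.exists_smooth_approx hΩ h.memLpLoc_fun
    h.memLpLoc_grad hKc hKΩ
  have hw := h.memLpLoc_fun K hKc hKΩ
  have hW := h.memLpLoc_grad K hKc hKΩ
  have hg := h.memLpLoc_rhs K hKc hKΩ
  have hW1 : Integrable W (volume.restrict K) := hW.integrable (by norm_num)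
  have hg1 : Integrable g (volume.restrict K) := memLp_one_iff_integrable.1 hg
  have hWsq : Integrable (fun x => ‖W x‖ ^ 2) (volume.restrict K) := hW.integrable_norm_pow (by norm_num)
  have hηm : AEStronglyMeasurable η (volume.restrict K) := hη.continuous.aestronglyMeasurable
  have hgm : AEStronglyMeasurable (gradient η) (volume.restrict K) :=
    hη.continuous_gradient.aestronglyMeasurable
  have hvm : ∀ n, AEStronglyMeasurable (v n) (volume.restrict K) := fun n =>
    (hv n).continuous.aestronglyMeasurable
  have hvgm : ∀ n, AEStronglyMeasurable (gradient (v n)) (volume.restrict K) := fun n =>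
    (continuous_gradient (hv n)).aestronglyMeasurable
  -- integrability of the pieces, for any measurable function in place of `w`
  have i1 : ∀ s : EuclideanSpace ℝ (Fin N) → ℝ, AEStronglyMeasurable s (volume.restrict K) →
      Integrable (fun x => T (s x) * inner ℝ (W x) (gradient η x)) (volume.restrict K) := by
    intro s hs
    refine Integrable.mono' (hW1.norm.const_mul (A * M))
      ((hT.continuous.comp_aestronglyMeasurable hs).mul (hW.1.inner hgm))
      (Eventually.of_forall fun x => ?_)
    rw [norm_mul, mul_assoc]
    refine mul_le_mul (hA _) ((norm_inner_le_norm _ _).trans ?_) (norm_nonneg _) hA0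
    rw [mul_comm]; gcongr; exact hM2 x
  have i2 : ∀ s : EuclideanSpace ℝ (Fin N) → ℝ, AEStronglyMeasurable s (volume.restrict K) →
      Integrable (fun x => η x * deriv T (s x) * ‖W x‖ ^ 2) (volume.restrict K) := by
    intro s hs
    refine Integrable.mono' (hWsq.const_mul (M * B))
      ((hηm.mul (hT'.comp_aestronglyMeasurable hs)).mul (hW.1.norm.pow 2))
      (Eventually.of_forall fun x => ?_)
    rw [norm_mul, norm_mul, norm_pow, norm_norm]
    gcongr
    · exact hM1 x
    · exact hB _
  refine ⟨i2 w hw.1, ?_⟩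
  have lim1 : Tendsto (fun n => ∫ x in K, T (v n x) * inner ℝ (W x) (gradient η x)) atTop
      (𝓝 (∫ x in K, T (w x) * inner ℝ (W x) (gradient η x))) := by
    refine tendsto_integral_of_dominated_convergence (fun x => A * M * ‖W x‖)
      (fun n => (i1 _ (hvm n)).1) (hW1.norm.const_mul _) (fun n => Eventually.of_forall fun x => ?_) ?_
    · rw [norm_mul, mul_assoc]
      refine mul_le_mul (hA _) ((norm_inner_le_norm _ _).trans ?_) (norm_nonneg _) hA0
      rw [mul_comm]; gcongr; exact hM2 x
    · filter_upwards [hv3] with x hx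
      exact ((hT.continuous.tendsto _).comp hx).mul_const _
  have lim2 : Tendsto (fun n => ∫ x in K, η x * deriv T (v n x) * ‖W x‖ ^ 2) atTop
      (𝓝 (∫ x in K, η x * deriv T (w x) * ‖W x‖ ^ 2)) := by
    refine tendsto_integral_of_dominated_convergence (fun x => M * B * ‖W x‖ ^ 2)
      (fun n => (i2 _ (hvm n)).1) (hWsq.const_mul _) (fun n => Eventually.of_forall fun x => ?_) ?_
    · rw [norm_mul, norm_mul, norm_pow, norm_norm]
      gcongr
      · exact hM1 x
      · exact hB _
    · filter_upwards [hv3] with x hx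
      exact (((hT'.tendsto _).comp hx).const_mul _).mul_const _
  have hbdd : ∀ n x, |η x * deriv T (v n x)| ≤ M * B := fun n x => by
    rw [abs_mul]; exact mul_le_mul (hM1 x) (hB _) (abs_nonneg _) hM0
  have lim3 : Tendsto (fun n => ∫ x in K, η x * deriv T (v n x) *
      inner ℝ (W x) ((gradient (v n) - W) x)) atTop (𝓝 0) :=
    tendsto_integral_bdd_inner hW hv2 (fun n => (hvgm n).sub hW.1) hbdd
  have lim4 : Tendsto (fun n => ∫ x in K, g x * (T (v n x) * η x)) atTop
      (𝓝 (∫ x in K, g x * (T (w x) * η x))) := by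
    refine tendsto_integral_of_dominated_convergence (fun x => A * M * ‖g x‖)
      (fun n => hg.1.mul ((hT.continuous.comp_aestronglyMeasurable (hvm n)).mul hηm))
      (hg1.norm.const_mul _) (fun n => Eventually.of_forall fun x => ?_) ?_
    · rw [norm_mul, norm_mul, mul_comm]
      gcongr
      · exact hA _
      · exact hM1 x
    · filter_upwards [hv3] with x hx
      exact (((hT.continuous.tendsto _).comp hx).mul_const _).const_mul _
  have heq : ∀ n, (∫ x in K, T (v n x) * inner ℝ (W x) (gradient η x))
      + ((∫ x in K, η x * deriv T (v n x) * ‖W x‖ ^ 2) + ∫ x in K, η x * deriv T (v n x) *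
      inner ℝ (W x) ((gradient (v n) - W) x)) = ∫ x in K, g x * (T (v n x) * η x) := by
    intro n
    have hφ := hη.comp_mul hT (hv n)
    have h1 := h.integral_eq _ hφ
    have hg0 : ∀ x, gradient (fun y => T (v n y) * η y) x
        = T (v n x) • gradient η x + (η x * deriv T (v n x)) • gradient (v n) x := fun x =>
      gradient_comp_mul hTd ((hv n).differentiable (by simp) x)
        (hη.contDiff.differentiable (by simp) x)
    rw [setIntegral_eq_tsupport hΩ hη, setIntegral_eq_tsupport hΩ hη] at h1
    · rw [← h1]
      have i3 : Integrable (fun x => η x * deriv T (v n x) * inner ℝ (W x) ((gradient (v n) - W) x))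
          (volume.restrict K) := by
        have hvL : MemLp (gradient (v n) - W) 2 (volume.restrict K) :=
          ((continuous_gradient (hv n)).memLp_restrict_of_isCompact hKc 2).sub hW
        exact (integrable_inner_of_memLp_two hW hvL).bdd_mul (c := M * B)
          (hηm.mul (hT'.comp_aestronglyMeasurable (hvm n))) (Eventually.of_forall fun x => hbdd n x)
      have i23 : Integrable (fun x => η x * deriv T (v n x) * ‖W x‖ ^ 2 +
          η x * deriv T (v n x) * inner ℝ (W x) ((gradient (v n) - W) x)) (volume.restrict K) :=
        (i2 _ (hvm n)).add i3
      rw [← integral_add (i2 _ (hvm n)) i3, ← integral_add (i1 _ (hvm n)) i23]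
      refine integral_congr_ae (Eventually.of_forall fun x => ?_)
      simp only [hg0, inner_add_right, inner_smul_right, Pi.sub_apply, inner_sub_right,
        real_inner_self_eq_norm_sq]
      ring
    · intro x hx
      simp [image_eq_zero_of_notMem_tsupport hx]
    · intro x hx
      rw [hg0, hη.gradient_eq_zero hx, image_eq_zero_of_notMem_tsupport hx]
      simp
  have hL := (lim1.add (lim2.add lim3)).congr heq
  simpa using tendsto_nhds_unique hL lim4

/-- The truncated energy of a solution of `-Δw = g`. -/
theorem IsPoissonSolution.integral_deriv_mul_sq_le {Ω : Set (EuclideanSpace ℝ (Fin N))}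
    (hΩ : IsOpen Ω)
    {w : EuclideanSpace ℝ (Fin N) → ℝ} {W : EuclideanSpace ℝ (Fin N) → EuclideanSpace ℝ (Fin N)}
    {g : EuclideanSpace ℝ (Fin N) → ℝ} (h : IsPoissonSolution Ω w W g)
    {T : ℝ → ℝ} (hT : ContDiff ℝ ∞ T) {A B : ℝ} (hA : ∀ s, |T s| ≤ A) (hB : ∀ s, |deriv T s| ≤ B)
    {η : EuclideanSpace ℝ (Fin N) → ℝ} (hη : IsTestFunction Ω η) :
    ∫ x in tsupport η, η x * deriv T (w x) * ‖W x‖ ^ 2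
      ≤ A * ((∫ x in tsupport η, ‖g x * η x‖) + ∫ x in tsupport η, ‖W x‖ * ‖gradient η x‖) := by
  obtain ⟨-, h2⟩ := h.integral_comp_mul hΩ hT hA hB hη
  have hKc : IsCompact (tsupport η) := hη.hasCompactSupport
  have hfin : IsFiniteMeasure (volume.restrict (tsupport η)) :=
    isFiniteMeasure_restrict.2 hKc.measure_lt_top.ne
  obtain ⟨M, hM0, hM1, hM2⟩ := hη.exists_bound
  have hA0 : 0 ≤ A := (abs_nonneg _).trans (hA 0)
  have hW1 : Integrable W (volume.restrict (tsupport η)) :=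
    (h.memLpLoc_grad _ hKc hη.tsupport_subset).integrable (by norm_num)
  have hg1 : Integrable g (volume.restrict (tsupport η)) :=
    memLp_one_iff_integrable.1 (h.memLpLoc_rhs _ hKc hη.tsupport_subset)
  have b1 : ‖∫ x in tsupport η, g x * (T (w x) * η x)‖ ≤ ∫ x in tsupport η, A * ‖g x * η x‖ := by
    refine norm_integral_le_of_norm_le (Integrable.const_mul ?_ _) (Eventually.of_forall fun x => ?_)
    · exact (hg1.mul_bdd (c := M) hη.continuous.aestronglyMeasurable
        (Eventually.of_forall hM1)).norm
    · rw [mul_left_comm, norm_mul]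
      gcongr
      exact hA _
  have b2 : ‖∫ x in tsupport η, T (w x) * inner ℝ (W x) (gradient η x)‖
      ≤ ∫ x in tsupport η, A * (‖W x‖ * ‖gradient η x‖) := by
    refine norm_integral_le_of_norm_le (Integrable.const_mul ?_ _) (Eventually.of_forall fun x => ?_)
    · exact hW1.norm.mul_bdd (c := M) hη.continuous_gradient.norm.aestronglyMeasurable
        (Eventually.of_forall fun x => by rw [norm_norm]; exact hM2 x)
    · rw [norm_mul]
      gcongr
      · exact hA _
      · exact norm_inner_le_norm _ _
  rw [integral_const_mul] at b1 b2
  rw [Real.norm_eq_abs, abs_le] at b1 b2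
  linarith

end Energy

/-! ### Convergence of gradients in measure -/

section GradientConvergence

variable {N : ℕ}

theorem MemLpLoc.mono_exponent {F : Type*} [NormedAddCommGroup F]
    {Ω : Set (EuclideanSpace ℝ (Fin N))} {p q : ℝ≥0∞} {f : EuclideanSpace ℝ (Fin N) → F}
    (hf : MemLpLoc Ω q f) (hpq : p ≤ q) : MemLpLoc Ω p f := fun K hK hKΩ => by
  have : IsFiniteMeasure (volume.restrict K) := isFiniteMeasure_restrict.2 hK.measure_lt_top.ne
  exact (hf K hK hKΩ).mono_exponent hpq

theorem MemLpLoc.sub {F : Type*} [NormedAddCommGroup F]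
    {Ω : Set (EuclideanSpace ℝ (Fin N))} {p : ℝ≥0∞} {f g : EuclideanSpace ℝ (Fin N) → F}
    (hf : MemLpLoc Ω p f) (hg : MemLpLoc Ω p g) : MemLpLoc Ω p (f - g) := fun K hK hKΩ =>
  (hf K hK hKΩ).sub (hg K hK hKΩ)

theorem IsTestFunction.integrableOn {Ω : Set (EuclideanSpace ℝ (Fin N))} (hΩ : IsOpen Ω)
    {φ : EuclideanSpace ℝ (Fin N) → ℝ} (hφ : IsTestFunction Ω φ) {F F' : Type*}
    [NormedAddCommGroup F] [NormedAddCommGroup F'] {f : EuclideanSpace ℝ (Fin N) → F}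
    (hf : MemLpLoc Ω 1 f) {h : EuclideanSpace ℝ (Fin N) → F'}
    (hm : AEStronglyMeasurable h (volume.restrict (tsupport φ))) {M : ℝ}
    (hle : ∀ x, ‖h x‖ ≤ M * ‖f x‖) (h0 : ∀ x, x ∉ tsupport φ → h x = 0) :
    IntegrableOn h Ω volume := by
  have h1 : IntegrableOn h (tsupport φ) volume :=
    Integrable.mono' ((memLp_one_iff_integrable.1 (hf _ hφ.hasCompactSupport
      hφ.tsupport_subset)).norm.const_mul M) hm (Eventually.of_forall hle)
  exact h1.of_forall_sdiff_eq_zero hΩ.measurableSet fun x hx => h0 x hx.2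

theorem IsTestFunction.integrableOn_smul_gradient {Ω : Set (EuclideanSpace ℝ (Fin N))}
    (hΩ : IsOpen Ω) {φ : EuclideanSpace ℝ (Fin N) → ℝ} (hφ : IsTestFunction Ω φ)
    {u : EuclideanSpace ℝ (Fin N) → ℝ} (hu : MemLpLoc Ω 1 u) :
    IntegrableOn (fun x => u x • gradient φ x) Ω volume := by
  obtain ⟨M, hM0, hM1, hM2⟩ := hφ.exists_bound
  refine hφ.integrableOn hΩ hu (M := M) ?_ (fun x => ?_) fun x hx => ?_
  · exact (hu _ hφ.hasCompactSupport hφ.tsupport_subset).1.smul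
      hφ.continuous_gradient.aestronglyMeasurable
  · rw [norm_smul, mul_comm]
    gcongr
    exact hM2 x
  · rw [hφ.gradient_eq_zero hx, smul_zero]

theorem IsTestFunction.integrableOn_smul {F : Type*} [NormedAddCommGroup F] [NormedSpace ℝ F]
    {Ω : Set (EuclideanSpace ℝ (Fin N))}
    (hΩ : IsOpen Ω) {φ : EuclideanSpace ℝ (Fin N) → ℝ} (hφ : IsTestFunction Ω φ)
    {G : EuclideanSpace ℝ (Fin N) → F} (hG : MemLpLoc Ω 1 G) :
    IntegrableOn (fun x => φ x • G x) Ω volume := by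
  obtain ⟨M, hM0, hM1, hM2⟩ := hφ.exists_bound
  refine hφ.integrableOn hΩ hG (M := M) ?_ (fun x => ?_) fun x hx => ?_
  · exact hφ.continuous.aestronglyMeasurable.smul
      (hG _ hφ.hasCompactSupport hφ.tsupport_subset).1
  · rw [norm_smul]
    gcongr
    exact hM1 x
  · rw [image_eq_zero_of_notMem_tsupport hx, zero_smul]

theorem IsTestFunction.integrableOn_inner_gradient {Ω : Set (EuclideanSpace ℝ (Fin N))}
    (hΩ : IsOpen Ω) {φ : EuclideanSpace ℝ (Fin N) → ℝ} (hφ : IsTestFunction Ω φ)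
    {G : EuclideanSpace ℝ (Fin N) → EuclideanSpace ℝ (Fin N)} (hG : MemLpLoc Ω 1 G) :
    IntegrableOn (fun x => inner ℝ (G x) (gradient φ x)) Ω volume := by
  obtain ⟨M, hM0, hM1, hM2⟩ := hφ.exists_bound
  refine hφ.integrableOn hΩ hG (M := M) ?_ (fun x => ?_) fun x hx => ?_
  · exact (hG _ hφ.hasCompactSupport hφ.tsupport_subset).1.inner
      hφ.continuous_gradient.aestronglyMeasurable
  · refine (norm_inner_le_norm _ _).trans ?_
    rw [mul_comm]
    gcongr
    exact hM2 x
  · rw [hφ.gradient_eq_zero hx, inner_zero_right]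

theorem IsPoissonSolution.sub {Ω : Set (EuclideanSpace ℝ (Fin N))} (hΩ : IsOpen Ω)
    {u v : EuclideanSpace ℝ (Fin N) → ℝ} {G H : EuclideanSpace ℝ (Fin N) → EuclideanSpace ℝ (Fin N)}
    {f g : EuclideanSpace ℝ (Fin N) → ℝ}
    (hu : IsPoissonSolution Ω u G f) (hv : IsPoissonSolution Ω v H g) :
    IsPoissonSolution Ω (u - v) (G - H) (f - g) where
  isWeakGradient :=
    { memLpLoc_fun := hu.isWeakGradient.memLpLoc_fun.sub hv.isWeakGradient.memLpLoc_fun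
      memLpLoc_grad := hu.isWeakGradient.memLpLoc_grad.sub hv.isWeakGradient.memLpLoc_grad
      integral_eq := fun φ hφ => by
        simp only [Pi.sub_apply, sub_smul, smul_sub]
        rw [integral_sub (hφ.integrableOn_smul_gradient hΩ hu.isWeakGradient.memLpLoc_fun)
          (hφ.integrableOn_smul_gradient hΩ hv.isWeakGradient.memLpLoc_fun),
          integral_sub (hφ.integrableOn_smul hΩ hu.isWeakGradient.memLpLoc_grad)
          (hφ.integrableOn_smul hΩ hv.isWeakGradient.memLpLoc_grad),
          hu.isWeakGradient.integral_eq φ hφ, hv.isWeakGradient.integral_eq φ hφ]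
        abel }
  memLpLoc_fun := hu.memLpLoc_fun.sub hv.memLpLoc_fun
  memLpLoc_grad := hu.memLpLoc_grad.sub hv.memLpLoc_grad
  memLpLoc_rhs := hu.memLpLoc_rhs.sub hv.memLpLoc_rhs
  integral_eq := fun φ hφ => by
    have i1 := hφ.integrableOn_smul hΩ hu.memLpLoc_rhs
    have i2 := hφ.integrableOn_smul hΩ hv.memLpLoc_rhs
    simp only [smul_eq_mul, mul_comm (φ _)] at i1 i2
    simp only [Pi.sub_apply, inner_sub_left, sub_mul]
    rw [integral_sub (hφ.integrableOn_inner_gradient hΩ hu.isWeakGradient.memLpLoc_grad)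
      (hφ.integrableOn_inner_gradient hΩ hv.isWeakGradient.memLpLoc_grad), integral_sub i1 i2,
      hu.integral_eq φ hφ, hv.integral_eq φ hφ]

/-- A smooth bounded substitute for the truncation of `s - c` at height `ε`. -/
noncomputable def arctanTruncation (c ε s : ℝ) : ℝ := ε * Real.arctan ((s - c) / ε)

theorem contDiff_arctanTruncation (c ε : ℝ) : ContDiff ℝ ∞ (arctanTruncation c ε) := by
  unfold arctanTruncation
  exact contDiff_const.mul (Real.contDiff_arctan.comp
    ((contDiff_id.sub contDiff_const).div_const ε))

theorem abs_arctanTruncation_le (c : ℝ) {ε : ℝ} (hε : 0 < ε) (s : ℝ) :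
    |arctanTruncation c ε s| ≤ 2 * ε := by
  have h1 : |Real.arctan ((s - c) / ε)| ≤ 2 := by
    have := Real.arctan_lt_pi_div_two ((s - c) / ε)
    have := Real.neg_pi_div_two_lt_arctan ((s - c) / ε)
    rw [abs_le]
    constructor <;> linarith [Real.pi_le_four]
  rw [arctanTruncation, abs_mul, abs_of_pos hε, mul_comm]
  gcongr

theorem deriv_arctanTruncation (c : ℝ) {ε : ℝ} (hε : 0 < ε) (s : ℝ) :
    deriv (arctanTruncation c ε) s = 1 / (1 + ((s - c) / ε) ^ 2) := by
  have h1 : HasDerivAt (fun s : ℝ => (s - c) / ε) (1 / ε) s :=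
    ((hasDerivAt_id s).sub_const c).div_const ε
  have h2 : HasDerivAt (arctanTruncation c ε) (ε * (1 / (1 + ((s - c) / ε) ^ 2) * (1 / ε))) s :=
    ((Real.hasDerivAt_arctan _).comp s h1).const_mul ε
  rw [h2.deriv]
  field_simp

theorem deriv_arctanTruncation_nonneg (c : ℝ) {ε : ℝ} (hε : 0 < ε) (s : ℝ) :
    0 ≤ deriv (arctanTruncation c ε) s := by
  rw [deriv_arctanTruncation c hε]; positivity

theorem abs_deriv_arctanTruncation_le (c : ℝ) {ε : ℝ} (hε : 0 < ε) (s : ℝ) :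
    |deriv (arctanTruncation c ε) s| ≤ 1 := by
  rw [abs_of_nonneg (deriv_arctanTruncation_nonneg c hε s), deriv_arctanTruncation c hε,
    div_le_one (by positivity)]
  nlinarith [sq_nonneg ((s - c) / ε)]

theorem half_le_deriv_arctanTruncation {c ε : ℝ} (hε : 0 < ε) {s : ℝ} (hs : |s - c| ≤ ε) :
    1 / 2 ≤ deriv (arctanTruncation c ε) s := by
  rw [deriv_arctanTruncation c hε]
  have : ((s - c) / ε) ^ 2 ≤ 1 := by
    rw [sq_le_one_iff_abs_le_one, abs_div, abs_of_pos hε]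
    exact div_le_one_of_le₀ hs hε.le
  exact one_div_le_one_div_of_le (by positivity) (by linarith)

theorem integral_norm_mul_le_of_eLpNorm_le {F : Type*} [NormedAddCommGroup F]
    {K : Set (EuclideanSpace ℝ (Fin N))} (hK : IsCompact K)
    {G : EuclideanSpace ℝ (Fin N) → F} (hG : MemLp G 2 (volume.restrict K)) {C : ℝ≥0}
    (hC : eLpNorm G 2 (volume.restrict K) ≤ C) :
    ∫ x in K, ‖G x‖ ≤ C * (volume.real K) ^ (1 / 2 : ℝ) := by
  have hfin : volume K ≠ ⊤ := hK.measure_lt_top.ne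
  have h2 := eLpNorm_le_eLpNorm_mul_rpow_measure_univ (p := 1) (q := 2) (by norm_num) hG.1
  rw [Measure.restrict_apply_univ] at h2
  have h3 : eLpNorm G 1 (volume.restrict K) ≤ C * volume K ^ (1 / 2 : ℝ) := by
    refine h2.trans ?_
    norm_num
    gcongr
  have h4 := ENNReal.toReal_mono (by finiteness) h3
  rwa [ENNReal.toReal_mul, ← ENNReal.toReal_rpow, eLpNorm_one_eq_lintegral_enorm,
    ← integral_norm_eq_lintegral_enorm hG.1] at h4

/-- Local `L^1` bounds for the right-hand sides of a sequence of solutions of `-Δu = g`, `g ≥ 0`: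
testing with `η` bounds the integral of `g η` by the flux through the support of `∇η`. -/
theorem exists_bound_rhs_and_flux {Ω : Set (EuclideanSpace ℝ (Fin N))} (hΩ : IsOpen Ω)
    {u : ℕ → EuclideanSpace ℝ (Fin N) → ℝ}
    {G : ℕ → EuclideanSpace ℝ (Fin N) → EuclideanSpace ℝ (Fin N)}
    {g : ℕ → EuclideanSpace ℝ (Fin N) → ℝ} (h : ∀ k, IsPoissonSolution Ω (u k) (G k) (g k))
    (hg : ∀ k x, 0 ≤ g k x)
    (hb : ∀ K, IsCompact K → K ⊆ Ω → ∃ C : ℝ≥0, ∀ k, eLpNorm (G k) 2 (volume.restrict K) ≤ C)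
    {η : EuclideanSpace ℝ (Fin N) → ℝ} (hη : IsTestFunction Ω η) (hη0 : ∀ x, 0 ≤ η x) :
    ∃ C : ℝ, 0 ≤ C ∧ ∀ k, (∫ x in tsupport η, ‖g k x * η x‖) ≤ C ∧
      (∫ x in tsupport η, ‖G k x‖ * ‖gradient η x‖) ≤ C := by
  have hKc : IsCompact (tsupport η) := hη.hasCompactSupport
  obtain ⟨M, hM0, hM1, hM2⟩ := hη.exists_bound
  obtain ⟨C, hC⟩ := hb _ hKc hη.tsupport_subset
  have hflux : ∀ k, (∫ x in tsupport η, ‖G k x‖ * ‖gradient η x‖)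
      ≤ M * (C * (volume.real (tsupport η)) ^ (1 / 2 : ℝ)) := by
    intro k
    have hGk := (h k).memLpLoc_grad _ hKc hη.tsupport_subset
    have hG1 := memLp_one_iff_integrable.1
      ((h k).isWeakGradient.memLpLoc_grad _ hKc hη.tsupport_subset)
    calc _ ≤ ∫ x in tsupport η, M * ‖G k x‖ := by
          refine integral_mono_of_nonneg (Eventually.of_forall fun x => by positivity)
            (hG1.norm.const_mul _) (Eventually.of_forall fun x => ?_)
          simp only
          rw [mul_comm]
          gcongr
          exact hM2 x
      _ = M * ∫ x in tsupport η, ‖G k x‖ := integral_const_mul _ _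
      _ ≤ _ := by gcongr; exact integral_norm_mul_le_of_eLpNorm_le hKc hGk (hC k)
  refine ⟨M * (C * (volume.real (tsupport η)) ^ (1 / 2 : ℝ)), by positivity, fun k => ⟨?_, hflux k⟩⟩
  refine le_trans ?_ (hflux k)
  have e1 := (h k).integral_eq η hη
  rw [setIntegral_eq_tsupport hΩ hη (fun x hx => by rw [hη.gradient_eq_zero hx, inner_zero_right]),
    setIntegral_eq_tsupport hΩ hη (fun x hx => by
      rw [image_eq_zero_of_notMem_tsupport hx, mul_zero])] at e1
  have e2 : ∫ x in tsupport η, ‖g k x * η x‖ = ∫ x in tsupport η, g k x * η x :=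
    integral_congr_ae (Eventually.of_forall fun x => by
      simp only [Real.norm_eq_abs, abs_of_nonneg (mul_nonneg (hg k x) (hη0 x))])
  rw [e2, ← e1]
  refine (le_abs_self _).trans ?_
  rw [← Real.norm_eq_abs]
  refine norm_integral_le_of_norm_le ?_ (Eventually.of_forall fun x => norm_inner_le_norm _ _)
  have hG1 := memLp_one_iff_integrable.1
    ((h k).isWeakGradient.memLpLoc_grad _ hKc hη.tsupport_subset)
  exact hG1.norm.mul_bdd (c := M) hη.continuous_gradient.norm.aestronglyMeasurable
        (Eventually.of_forall fun x => by rw [norm_norm]; exact hM2 x)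

/-- The gradients of a sequence of supersolutions that converges in `L^2_loc` form a Cauchy sequence
in measure: where `|u k - u l| ≤ ε`, the energy of `u k - u l` is `O(ε)`. -/
theorem tendstoInMeasure_gradient_sub {Ω : Set (EuclideanSpace ℝ (Fin N))} (hΩ : IsOpen Ω)
    {u : ℕ → EuclideanSpace ℝ (Fin N) → ℝ}
    {G : ℕ → EuclideanSpace ℝ (Fin N) → EuclideanSpace ℝ (Fin N)}
    {g : ℕ → EuclideanSpace ℝ (Fin N) → ℝ} (h : ∀ k, IsPoissonSolution Ω (u k) (G k) (g k))
    (hg : ∀ k x, 0 ≤ g k x)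
    (hb : ∀ K, IsCompact K → K ⊆ Ω → ∃ C : ℝ≥0, ∀ k, eLpNorm (G k) 2 (volume.restrict K) ≤ C)
    {K : Set (EuclideanSpace ℝ (Fin N))} (hK : IsCompact K) (hKΩ : K ⊆ Ω)
    (hc : Tendsto (fun p : ℕ × ℕ => eLpNorm (u p.1 - u p.2) 2 (volume.restrict K)) atTop (𝓝 0)) :
    TendstoInMeasure (volume.restrict K) (fun p : ℕ × ℕ => G p.1 - G p.2) atTop 0 := by
  have hfin : IsFiniteMeasure (volume.restrict K) := isFiniteMeasure_restrict.2 hK.measure_lt_top.ne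
  obtain ⟨η, hη, hη0, hη1, hηK⟩ := exists_cutoff hΩ hK hKΩ
  have hKη : K ⊆ tsupport η := fun x hx => subset_tsupport η (by simp [hηK x hx])
  obtain ⟨C, hC0, hC⟩ := exists_bound_rhs_and_flux hΩ h hg hb hη hη0
  have hum : TendstoInMeasure (volume.restrict K) (fun p : ℕ × ℕ => u p.1 - u p.2) atTop 0 :=
    tendstoInMeasure_of_tendsto_eLpNorm (p := 2) (by norm_num)
      (fun p => (((h _).memLpLoc_fun K hK hKΩ).sub ((h _).memLpLoc_fun K hK hKΩ)).1)
      aestronglyMeasurable_zero (by simpa using hc)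
  rw [tendstoInMeasure_iff_measureReal_norm] at hum ⊢
  simp only [Pi.zero_apply, sub_zero] at hum ⊢
  intro a ha
  -- the energy of the difference on the set where the functions are `ε`-close
  have key : ∀ ε : ℝ, 0 < ε → ∀ p : ℕ × ℕ,
      (volume.restrict K).real {x | a ≤ ‖(G p.1 - G p.2) x‖}
        ≤ (volume.restrict K).real {x | ε ≤ ‖(u p.1 - u p.2) x‖} + (16 * C / a ^ 2) * ε := by
    intro ε hε p
    have hs := (h p.1).sub hΩ (h p.2)
    have hT := contDiff_arctanTruncation 0 ε
    have hE := hs.integral_deriv_mul_sq_le hΩ hT (abs_arctanTruncation_le 0 hε)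
      (abs_deriv_arctanTruncation_le 0 hε) hη
    have hI := (hs.integral_comp_mul hΩ hT (abs_arctanTruncation_le 0 hε)
      (abs_deriv_arctanTruncation_le 0 hε) hη).1
    set E := fun x => η x * deriv (arctanTruncation 0 ε) ((u p.1 - u p.2) x)
      * ‖(G p.1 - G p.2) x‖ ^ 2 with hEdef
    have hE0 : ∀ x, 0 ≤ E x := fun x => mul_nonneg (mul_nonneg (hη0 x)
      (deriv_arctanTruncation_nonneg 0 hε _)) (sq_nonneg _)
    have hrhs : (∫ x in tsupport η, ‖(g p.1 - g p.2) x * η x‖) +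
        (∫ x in tsupport η, ‖(G p.1 - G p.2) x‖ * ‖gradient η x‖) ≤ 4 * C := by
      obtain ⟨M, hM0, hM1, hM2⟩ := hη.exists_bound
      have ig : ∀ k, Integrable (fun x => ‖g k x * η x‖) (volume.restrict (tsupport η)) := fun k =>
        ((memLp_one_iff_integrable.1 ((h k).memLpLoc_rhs _ hη.hasCompactSupport
          hη.tsupport_subset)).mul_bdd (c := M) hη.continuous.aestronglyMeasurable
          (Eventually.of_forall hM1)).norm
      have iG : ∀ k, Integrable (fun x => ‖G k x‖ * ‖gradient η x‖)
          (volume.restrict (tsupport η)) := fun k =>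
        (memLp_one_iff_integrable.1 ((h k).isWeakGradient.memLpLoc_grad _ hη.hasCompactSupport
          hη.tsupport_subset)).norm.mul_bdd (c := M)
          hη.continuous_gradient.norm.aestronglyMeasurable
          (Eventually.of_forall fun x => by rw [norm_norm]; exact hM2 x)
      have b1 : (∫ x in tsupport η, ‖(g p.1 - g p.2) x * η x‖) ≤ C + C := by
        refine le_trans ?_ (add_le_add (hC p.1).1 (hC p.2).1)
        rw [← integral_add (ig _) (ig _)]
        refine integral_mono_of_nonneg (Eventually.of_forall fun x => norm_nonneg _)
          ((ig _).add (ig _)) (Eventually.of_forall fun x => ?_)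
        simp only [Pi.sub_apply, sub_mul]
        exact norm_sub_le _ _
      have b2 : (∫ x in tsupport η, ‖(G p.1 - G p.2) x‖ * ‖gradient η x‖) ≤ C + C := by
        refine le_trans ?_ (add_le_add (hC p.1).2 (hC p.2).2)
        rw [← integral_add (iG _) (iG _)]
        refine integral_mono_of_nonneg (Eventually.of_forall fun x => by positivity)
          ((iG _).add (iG _)) (Eventually.of_forall fun x => ?_)
        simp only [Pi.sub_apply, ← add_mul]
        gcongr
        exact norm_sub_le _ _
      linarith
    have hE2 : ∫ x in K, E x ≤ 8 * C * ε := by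
      refine (setIntegral_mono_set hI (Eventually.of_forall hE0) (Eventually.of_forall hKη)).trans ?_
      refine hE.trans ?_
      calc _ ≤ 2 * ε * (4 * C) := by gcongr
        _ = _ := by ring
    have hmk := mul_meas_ge_le_integral_of_nonneg (μ := volume.restrict K)
      (Eventually.of_forall hE0) (hI.mono_measure (Measure.restrict_mono_set volume hKη)) (a ^ 2 / 2)
    have hsub : (volume.restrict K).real {x | a ≤ ‖(G p.1 - G p.2) x‖} ≤
        (volume.restrict K).real ({x | ε ≤ ‖(u p.1 - u p.2) x‖} ∪ {x | a ^ 2 / 2 ≤ E x}) := by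
      have : ({x | a ≤ ‖(G p.1 - G p.2) x‖} : Set (EuclideanSpace ℝ (Fin N))) ≤ᵐ[volume.restrict K]
          ({x | ε ≤ ‖(u p.1 - u p.2) x‖} ∪ {x | a ^ 2 / 2 ≤ E x} : Set _) := by
        filter_upwards [ae_restrict_mem hK.measurableSet] with x hx
        intro hax
        by_cases hux : ε ≤ ‖(u p.1 - u p.2) x‖
        · exact Or.inl hux
        · refine Or.inr ?_
          have hd := half_le_deriv_arctanTruncation (c := 0) hε (s := (u p.1 - u p.2) x) (by
            rw [sub_zero]; exact (not_le.1 hux).le)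
          have hax' : a ≤ ‖(G p.1 - G p.2) x‖ := hax
          change a ^ 2 / 2 ≤ η x * deriv (arctanTruncation 0 ε) ((u p.1 - u p.2) x)
            * ‖(G p.1 - G p.2) x‖ ^ 2
          rw [hηK x hx, one_mul]
          calc a ^ 2 / 2 = 1 / 2 * a ^ 2 := by ring
            _ ≤ _ := by gcongr
      exact ENNReal.toReal_mono (measure_ne_top _ _) (measure_mono_ae this)
    refine hsub.trans ((measureReal_union_le _ _).trans ?_)
    gcongr
    rw [div_mul_eq_mul_div, le_div_iff₀ (by positivity)]
    have := hmk.trans hE2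
    nlinarith
  rw [Metric.tendsto_nhds]
  intro δ hδ
  set ε := δ / 2 / (16 * C / a ^ 2 + 1) with hε
  have hεpos : 0 < ε := by positivity
  have hsmall : (16 * C / a ^ 2) * ε ≤ δ / 2 := by
    rw [hε, mul_div_assoc', div_le_iff₀ (by positivity)]
    have : 0 ≤ 16 * C / a ^ 2 := by positivity
    nlinarith
  filter_upwards [(hum ε hεpos).eventually_lt_const (half_pos hδ)] with p hp
  rw [Real.dist_eq, sub_zero, abs_of_nonneg measureReal_nonneg]
  linarith [key ε hεpos p]

end GradientConvergence

/-! ### Compactness for nonnegative right-hand sides -/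

section WeightedMeasure

variable {N : ℕ}

/-- A weighted sum of the restrictions of the volume to a sequence of sets. With positive weights
that decay fast enough it is a finite measure, and convergence in `L^2` of this measure implies
convergence in `L^2` of each of the sets. -/
noncomputable def weightedMeasure (K : ℕ → Set (EuclideanSpace ℝ (Fin N))) (δ : ℕ → ℝ≥0) :
    Measure (EuclideanSpace ℝ (Fin N)) :=
  Measure.sum fun n => (δ n : ℝ≥0∞) • volume.restrict (K n)

theorem restrict_le_weightedMeasure (K : ℕ → Set (EuclideanSpace ℝ (Fin N))) {δ : ℕ → ℝ≥0}
    (hδ : ∀ n, 0 < δ n) (n : ℕ) :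
    volume.restrict (K n) ≤ ((δ n : ℝ≥0∞)⁻¹) • weightedMeasure K δ := by
  have h1 : (δ n : ℝ≥0∞) • volume.restrict (K n) ≤ weightedMeasure K δ :=
    Measure.le_sum (fun n => (δ n : ℝ≥0∞) • volume.restrict (K n)) n
  calc volume.restrict (K n) = ((δ n : ℝ≥0∞)⁻¹) • ((δ n : ℝ≥0∞) • volume.restrict (K n)) := by
        rw [smul_smul, ENNReal.inv_mul_cancel (by exact_mod_cast (hδ n).ne') (by simp), one_smul]
    _ ≤ _ := by gcongr

theorem lintegral_weightedMeasure (K : ℕ → Set (EuclideanSpace ℝ (Fin N))) (δ : ℕ → ℝ≥0)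
    (f : EuclideanSpace ℝ (Fin N) → ℝ≥0∞) :
    ∫⁻ x, f x ∂weightedMeasure K δ = ∑' n, (δ n : ℝ≥0∞) * ∫⁻ x in K n, f x := by
  rw [weightedMeasure, lintegral_sum_measure]
  simp only [lintegral_smul_measure, smul_eq_mul]

theorem aestronglyMeasurable_weightedMeasure {F : Type*} [NormedAddCommGroup F]
    {K : ℕ → Set (EuclideanSpace ℝ (Fin N))} {δ : ℕ → ℝ≥0} {f : EuclideanSpace ℝ (Fin N) → F}
    (hf : ∀ n, AEStronglyMeasurable f (volume.restrict (K n))) :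
    AEStronglyMeasurable f (weightedMeasure K δ) := by
  rw [weightedMeasure, aestronglyMeasurable_sum_measure_iff]
  exact fun n => (hf n).mono_ac Measure.smul_absolutelyContinuous

theorem eLpNorm_weightedMeasure_le_one {F : Type*} [NormedAddCommGroup F]
    {K : ℕ → Set (EuclideanSpace ℝ (Fin N))} {δ : ℕ → ℝ≥0} {f : EuclideanSpace ℝ (Fin N) → F}
    {r : ℝ} (hr : 0 < r) {C : ℕ → ℝ≥0}
    (hf : ∀ n, eLpNorm f (ENNReal.ofReal r) (volume.restrict (K n)) ≤ C n)
    (hδ : ∑' n, (δ n : ℝ≥0∞) * (C n : ℝ≥0∞) ^ r ≤ 1) :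
    eLpNorm f (ENNReal.ofReal r) (weightedMeasure K δ) ≤ 1 := by
  have hr0 : ENNReal.ofReal r ≠ 0 := by simpa using hr
  have hrt : (ENNReal.ofReal r).toReal = r := ENNReal.toReal_ofReal hr.le
  have hpow : ∀ μ : Measure (EuclideanSpace ℝ (Fin N)),
      eLpNorm f (ENNReal.ofReal r) μ = (∫⁻ x, ‖f x‖ₑ ^ r ∂μ) ^ (1 / r) := fun μ => by
    rw [eLpNorm_eq_lintegral_rpow_enorm_toReal hr0 ENNReal.ofReal_ne_top, hrt]
  rw [hpow, lintegral_weightedMeasure]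
  refine ENNReal.rpow_le_one (le_trans (ENNReal.tsum_le_tsum fun n => ?_) hδ) (by positivity)
  gcongr
  have := hf n
  rw [hpow] at this
  calc _ = ((∫⁻ x in K n, ‖f x‖ₑ ^ r) ^ (1 / r)) ^ r := by
        rw [← ENNReal.rpow_mul, one_div_mul_cancel hr.ne', ENNReal.rpow_one]
    _ ≤ _ := by gcongr

theorem tendstoInMeasure_weightedMeasure {F : Type*} [NormedAddCommGroup F]
    {K : ℕ → Set (EuclideanSpace ℝ (Fin N))} {δ : ℕ → ℝ≥0}
    (hfin : ∑' n, (δ n : ℝ≥0∞) * volume (K n) ≠ ⊤) {ι : Type*} {l : Filter ι}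
    [l.IsCountablyGenerated] {f : ι → EuclideanSpace ℝ (Fin N) → F}
    (hf : ∀ n, TendstoInMeasure (volume.restrict (K n)) f l 0)
    (hm : ∀ i n, AEStronglyMeasurable (f i) (volume.restrict (K n))) :
    TendstoInMeasure (weightedMeasure K δ) f l 0 := by
  intro ε hε
  have hnull : ∀ i, NullMeasurableSet {x | ε ≤ edist (f i x) ((0 : EuclideanSpace ℝ (Fin N) → F) x)}
      (weightedMeasure K δ) := fun i => by
    have h1 : AEStronglyMeasurable (f i) (weightedMeasure K δ) :=
      aestronglyMeasurable_weightedMeasure (hm i)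
    have h2 : AEMeasurable (fun x => edist (f i x) ((0 : EuclideanSpace ℝ (Fin N) → F) x))
        (weightedMeasure K δ) := by
      simpa using h1.enorm
    exact nullMeasurableSet_le aemeasurable_const h2
  have e : ∀ i, weightedMeasure K δ {x | ε ≤ edist (f i x) ((0 : EuclideanSpace ℝ (Fin N) → F) x)}
      = ∫⁻ n : ℕ, (δ n : ℝ≥0∞) * volume.restrict (K n)
        {x | ε ≤ edist (f i x) ((0 : EuclideanSpace ℝ (Fin N) → F) x)} ∂Measure.count := fun i => by
    rw [lintegral_count, weightedMeasure, Measure.sum_apply₀ _ (hnull i)]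
    simp
  simp_rw [e]
  have h0 : ∫⁻ _n : ℕ, (0 : ℝ≥0∞) ∂Measure.count = 0 := by simp
  rw [← h0]
  refine tendsto_lintegral_filter_of_dominated_convergence (fun n => (δ n : ℝ≥0∞) * volume (K n))
    (Eventually.of_forall fun i => measurable_of_countable _)
    (Eventually.of_forall fun i => Eventually.of_forall fun n => ?_) ?_
    (Eventually.of_forall fun n => ?_)
  · exact mul_le_mul' le_rfl
      ((measure_mono (Set.subset_univ _)).trans_eq (Measure.restrict_apply_univ _))
  · rw [lintegral_count]; exact hfin
  · simpa using ENNReal.Tendsto.const_mul (a := (δ n : ℝ≥0∞)) (hf n ε hε) (Or.inr (by simp))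

theorem tendsto_eLpNorm_restrict_of_weightedMeasure {F : Type*} [NormedAddCommGroup F]
    {K : ℕ → Set (EuclideanSpace ℝ (Fin N))} {δ : ℕ → ℝ≥0} (hδ : ∀ n, 0 < δ n)
    {ι : Type*} {l : Filter ι} {f : ι → EuclideanSpace ℝ (Fin N) → F}
    (hf : Tendsto (fun i => eLpNorm (f i) 2 (weightedMeasure K δ)) l (𝓝 0)) (n : ℕ) :
    Tendsto (fun i => eLpNorm (f i) 2 (volume.restrict (K n))) l (𝓝 0) := by
  have h1 := ENNReal.Tendsto.const_mul (a := ((δ n : ℝ≥0∞)⁻¹) ^ (1 / (2 : ℝ≥0∞)).toReal) hf (Or.inr (by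
    have : (δ n : ℝ≥0∞)⁻¹ ≠ ⊤ := by
      rw [Ne, ENNReal.inv_eq_top]; exact_mod_cast (hδ n).ne'
    finiteness))
  rw [mul_zero] at h1
  refine tendsto_of_tendsto_of_tendsto_of_le_of_le tendsto_const_nhds h1 (fun _ => zero_le)
    fun i => ?_
  refine (eLpNorm_mono_measure _ (restrict_le_weightedMeasure K hδ n)).trans (le_of_eq ?_)
  rw [eLpNorm_smul_measure_of_ne_top (by norm_num)]
  rfl

end WeightedMeasure

section Compactness

variable {N : ℕ}

theorem eLpNorm_two_le_of_eLpNorm_le {F : Type*} [NormedAddCommGroup F] {r : ℝ} (hr : 2 < r)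
    {K : Set (EuclideanSpace ℝ (Fin N))} (hK : IsCompact K) (C : ℝ≥0) :
    ∃ C' : ℝ≥0, ∀ f : EuclideanSpace ℝ (Fin N) → F, AEStronglyMeasurable f (volume.restrict K) →
      eLpNorm f (ENNReal.ofReal r) (volume.restrict K) ≤ C →
      eLpNorm f 2 (volume.restrict K) ≤ C' := by
  have h2r : (2 : ℝ≥0∞) ≤ ENNReal.ofReal r := by
    rw [← ENNReal.ofReal_ofNat]; exact ENNReal.ofReal_le_ofReal hr.le
  have hfin : volume K ≠ ⊤ := hK.measure_lt_top.ne
  have hs : 0 ≤ 1 / 2 - 1 / r := by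
    rw [sub_nonneg]; exact one_div_le_one_div_of_le (by norm_num) hr.le
  refine ⟨(C * volume K ^ (1 / 2 - 1 / r)).toNNReal, fun f hf hC => ?_⟩
  rw [ENNReal.coe_toNNReal (by finiteness)]
  refine (eLpNorm_le_eLpNorm_mul_rpow_measure_univ h2r hf).trans ?_
  rw [Measure.restrict_apply_univ, ENNReal.toReal_ofReal (by linarith), ENNReal.toReal_ofNat]
  gcongr

theorem tendsto_setIntegral_of_tendsto_eLpNorm_two {F F' : Type*} [NormedAddCommGroup F]
    [NormedAddCommGroup F'] [NormedSpace ℝ F'] {Ω : Set (EuclideanSpace ℝ (Fin N))} (hΩ : IsOpen Ω)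
    {φ : EuclideanSpace ℝ (Fin N) → ℝ} (hφ : IsTestFunction Ω φ)
    {f : ℕ → EuclideanSpace ℝ (Fin N) → F} {f₀ : EuclideanSpace ℝ (Fin N) → F}
    (hf : ∀ k, MemLp (f k) 2 (volume.restrict (tsupport φ)))
    (hf₀ : MemLp f₀ 2 (volume.restrict (tsupport φ)))
    (hlim : Tendsto (fun k => eLpNorm (f k - f₀) 2 (volume.restrict (tsupport φ))) atTop (𝓝 0))
    {h : ℕ → EuclideanSpace ℝ (Fin N) → F'} {h₀ : EuclideanSpace ℝ (Fin N) → F'}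
    (hi : ∀ k, IntegrableOn (h k) Ω volume) (hi₀ : IntegrableOn h₀ Ω volume) {M : ℝ≥0}
    (hle : ∀ k x, ‖h k x - h₀ x‖ ≤ M * ‖f k x - f₀ x‖) (hz : ∀ k x, x ∉ tsupport φ → h k x = 0)
    (hz₀ : ∀ x, x ∉ tsupport φ → h₀ x = 0) :
    Tendsto (fun k => ∫ x in Ω, h k x) atTop (𝓝 (∫ x in Ω, h₀ x)) := by
  have hK : IsCompact (tsupport φ) := hφ.hasCompactSupport
  have hfin : volume (tsupport φ) ≠ ⊤ := hK.measure_lt_top.ne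
  simp_rw [fun k => setIntegral_eq_tsupport hΩ hφ (hz k)]
  rw [setIntegral_eq_tsupport hΩ hφ hz₀]
  refine tendsto_integral_of_L1' h₀ (hi₀.mono_set hφ.tsupport_subset).1
    (Eventually.of_forall fun k => (hi k).mono_set hφ.tsupport_subset) ?_
  have h1 := ENNReal.Tendsto.const_mul (a := (M : ℝ≥0∞) * volume (tsupport φ) ^ (1 / 2 : ℝ)) hlim
    (Or.inr (by finiteness))
  rw [mul_zero] at h1
  refine tendsto_of_tendsto_of_tendsto_of_le_of_le tendsto_const_nhds h1 (fun _ => zero_le)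
    fun k => ?_
  have h2 : eLpNorm (h k - h₀) 1 (volume.restrict (tsupport φ))
      ≤ M • eLpNorm (f k - f₀) 1 (volume.restrict (tsupport φ)) :=
    eLpNorm_le_nnreal_smul_eLpNorm_of_ae_le_mul (Eventually.of_forall fun x => hle k x) 1
  have h3 := eLpNorm_le_eLpNorm_mul_rpow_measure_univ (p := 1) (q := 2) (by norm_num)
    ((hf k).sub hf₀).1
  rw [Measure.restrict_apply_univ] at h3
  norm_num at h3
  calc _ ≤ _ := h2
    _ ≤ M • (eLpNorm (f k - f₀) 2 (volume.restrict (tsupport φ)) * volume (tsupport φ) ^ (1 / 2 : ℝ)) := by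
        gcongr
    _ = _ := by rw [ENNReal.smul_def, smul_eq_mul]; ring

/-- Strong compactness in `W^{1,2}_loc` of sequences of solutions of `-Δu = g`, `g ≥ 0`, that are
locally bounded in `W^{1,r}` for some `r > 2`. -/
theorem exists_subseq_tendsto_W1Loc {Ω : Set (EuclideanSpace ℝ (Fin N))} (hΩ : IsOpen Ω)
    {u : ℕ → EuclideanSpace ℝ (Fin N) → ℝ}
    {G : ℕ → EuclideanSpace ℝ (Fin N) → EuclideanSpace ℝ (Fin N)}
    {g : ℕ → EuclideanSpace ℝ (Fin N) → ℝ} (h : ∀ k, IsPoissonSolution Ω (u k) (G k) (g k))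
    (hg : ∀ k x, 0 ≤ g k x) {r : ℝ} (hr : 2 < r)
    (hb : ∀ K, IsCompact K → K ⊆ Ω → ∃ C : ℝ≥0, ∀ k,
      eLpNorm (u k) (ENNReal.ofReal r) (volume.restrict K) ≤ C ∧
      eLpNorm (G k) (ENNReal.ofReal r) (volume.restrict K) ≤ C) :
    ∃ σ : ℕ → ℕ, StrictMono σ ∧ ∃ (v : EuclideanSpace ℝ (Fin N) → ℝ)
      (H : EuclideanSpace ℝ (Fin N) → EuclideanSpace ℝ (Fin N)),
      IsWeakGradient Ω v H ∧ MemLpLoc Ω 2 v ∧ MemLpLoc Ω 2 H ∧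
      (∀ K, IsCompact K → K ⊆ Ω →
        Tendsto (fun k => eLpNorm (u (σ k) - v) 2 (volume.restrict K)) atTop (𝓝 0)) ∧
      (∀ K, IsCompact K → K ⊆ Ω →
        Tendsto (fun k => eLpNorm (G (σ k) - H) 2 (volume.restrict K)) atTop (𝓝 0)) ∧
      (∀ᵐ x ∂volume.restrict Ω, Tendsto (fun k => u (σ k) x) atTop (𝓝 (v x))) ∧
      (∀ᵐ x ∂volume.restrict Ω, Tendsto (fun k => G (σ k) x) atTop (𝓝 (H x))) := by
  have hb2 : ∀ K, IsCompact K → K ⊆ Ω → ∃ C : ℝ≥0, ∀ k, eLpNorm (u k) 2 (volume.restrict K) ≤ C ∧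
      eLpNorm (G k) 2 (volume.restrict K) ≤ C := by
    intro K hK hKΩ
    obtain ⟨C, hC⟩ := hb K hK hKΩ
    obtain ⟨C1, hC1⟩ := eLpNorm_two_le_of_eLpNorm_le (F := ℝ) hr hK C
    obtain ⟨C2, hC2⟩ := eLpNorm_two_le_of_eLpNorm_le (F := EuclideanSpace ℝ (Fin N)) hr hK C
    refine ⟨max C1 C2, fun k => ⟨?_, ?_⟩⟩
    · exact (hC1 _ ((h k).memLpLoc_fun K hK hKΩ).1 (hC k).1).trans
        (by exact_mod_cast le_max_left _ _)
    · exact (hC2 _ ((h k).memLpLoc_grad K hK hKΩ).1 (hC k).2).trans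
        (by exact_mod_cast le_max_right _ _)
  obtain ⟨σ₁, hσ₁, hcau⟩ := exists_subseq_cauchy_of_weakGradient hΩ
    (fun k => (h k).isWeakGradient) (fun k => (h k).memLpLoc_fun) (fun k => (h k).memLpLoc_grad) hb2
  have hgrad : ∀ K, IsCompact K → K ⊆ Ω → TendstoInMeasure (volume.restrict K)
      (fun p : ℕ × ℕ => G (σ₁ p.1) - G (σ₁ p.2)) atTop 0 := fun K hK hKΩ =>
    tendstoInMeasure_gradient_sub hΩ (fun k => h (σ₁ k)) (fun k => hg _)
      (fun L hL hLΩ => by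
        obtain ⟨C, hC⟩ := hb2 L hL hLΩ
        exact ⟨C, fun k => (hC _).2⟩) hK hKΩ (hcau K hK hKΩ)
  obtain ⟨K, hKc, hKΩ, -, hKabs⟩ := hΩ.exists_absorbing_compacts
  have hfun : ∀ K, IsCompact K → K ⊆ Ω → TendstoInMeasure (volume.restrict K)
      (fun p : ℕ × ℕ => u (σ₁ p.1) - u (σ₁ p.2)) atTop 0 := fun K hK hKΩ =>
    tendstoInMeasure_of_tendsto_eLpNorm (p := 2) (by norm_num)
      (fun p => (((h _).memLpLoc_fun K hK hKΩ).sub ((h _).memLpLoc_fun K hK hKΩ)).1)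
      aestronglyMeasurable_zero (by simpa using hcau K hK hKΩ)
  choose C hC using fun n => hb (K n) (hKc n) (hKΩ n)
  -- one finite measure, a weighted sum over an exhaustion of `Ω`, replaces the diagonal argument
  obtain ⟨δ, hδ, hsum⟩ := ENNReal.exists_pos_tsum_mul_lt_of_countable one_ne_zero
    (fun n => volume (K n) + (C n : ℝ≥0∞) ^ r) (fun n => by
      have : volume (K n) < ⊤ := (hKc n).measure_lt_top
      have hr0 : 0 ≤ r := by linarith
      finiteness)
  have hsum1 : ∑' n, (δ n : ℝ≥0∞) * volume (K n) ≤ 1 :=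
    (ENNReal.tsum_le_tsum fun n => by rw [mul_comm]; gcongr; exact le_self_add).trans hsum.le
  have hsum2 : ∑' n, (δ n : ℝ≥0∞) * (C n : ℝ≥0∞) ^ r ≤ 1 :=
    (ENNReal.tsum_le_tsum fun n => by rw [mul_comm]; gcongr; exact le_add_self).trans hsum.le
  set ν := weightedMeasure K δ with hν
  have hνfin : IsFiniteMeasure ν := by
    constructor
    rw [← lintegral_one, hν, lintegral_weightedMeasure]
    simpa using hsum1.trans_lt ENNReal.one_lt_top
  have hum : ∀ k, AEStronglyMeasurable (u k) ν := fun k =>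
    aestronglyMeasurable_weightedMeasure fun n => ((h k).memLpLoc_fun _ (hKc n) (hKΩ n)).1
  have hGm : ∀ k, AEStronglyMeasurable (G k) ν := fun k =>
    aestronglyMeasurable_weightedMeasure fun n => ((h k).memLpLoc_grad _ (hKc n) (hKΩ n)).1
  have hur : ∀ k, eLpNorm (u k) (ENNReal.ofReal r) ν ≤ 1 := fun k =>
    eLpNorm_weightedMeasure_le_one (by linarith) (fun n => (hC n k).1) hsum2
  have hGr : ∀ k, eLpNorm (G k) (ENNReal.ofReal r) ν ≤ 1 := fun k =>
    eLpNorm_weightedMeasure_le_one (by linarith) (fun n => (hC n k).2) hsum2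
  have h2r : (2 : ℝ≥0∞) ≤ ENNReal.ofReal r := by
    rw [← ENNReal.ofReal_ofNat]; exact ENNReal.ofReal_le_ofReal hr.le
  have h1r : (1 : ℝ≥0∞) ≤ ENNReal.ofReal r := le_trans (by norm_num) h2r
  have hu2 : ∀ k, MemLp (u k) 2 ν := fun k =>
    MemLp.mono_exponent ⟨hum k, (hur k).trans_lt ENNReal.one_lt_top⟩ h2r
  have hG2 : ∀ k, MemLp (G k) 2 ν := fun k =>
    MemLp.mono_exponent ⟨hGm k, (hGr k).trans_lt ENNReal.one_lt_top⟩ h2r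
  have hsumne : ∑' n, (δ n : ℝ≥0∞) * volume (K n) ≠ ⊤ := (hsum1.trans_lt ENNReal.one_lt_top).ne
  have ucau : Tendsto (fun p : ℕ × ℕ => eLpNorm (u (σ₁ p.1) - u (σ₁ p.2)) 2 ν) atTop (𝓝 0) :=
    tendsto_eLpNorm_two_of_tendstoInMeasure hr (C := 2) (fun p => (hum _).sub (hum _))
      (fun p => (eLpNorm_sub_le (hum _) (hum _) h1r).trans
        ((add_le_add (hur _) (hur _)).trans (by norm_num)))
      (tendstoInMeasure_weightedMeasure hsumne (fun n => hfun _ (hKc n) (hKΩ n)) fun p n =>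
        (((h _).memLpLoc_fun _ (hKc n) (hKΩ n)).sub ((h _).memLpLoc_fun _ (hKc n) (hKΩ n))).1)
  have Gcau : Tendsto (fun p : ℕ × ℕ => eLpNorm (G (σ₁ p.1) - G (σ₁ p.2)) 2 ν) atTop (𝓝 0) :=
    tendsto_eLpNorm_two_of_tendstoInMeasure hr (C := 2) (fun p => (hGm _).sub (hGm _))
      (fun p => (eLpNorm_sub_le (hGm _) (hGm _) h1r).trans
        ((add_le_add (hGr _) (hGr _)).trans (by norm_num)))
      (tendstoInMeasure_weightedMeasure hsumne (fun n => hgrad _ (hKc n) (hKΩ n)) fun p n =>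
        (((h _).memLpLoc_grad _ (hKc n) (hKΩ n)).sub ((h _).memLpLoc_grad _ (hKc n) (hKΩ n))).1)
  obtain ⟨v, hv2, hvlim⟩ := exists_tendsto_of_cauchy_eLpNorm_two (fun k => hu2 (σ₁ k)) ucau
  obtain ⟨H, hH2, hHlim⟩ := exists_tendsto_of_cauchy_eLpNorm_two (fun k => hG2 (σ₁ k)) Gcau
  obtain ⟨σ₂, hσ₂, hae₂⟩ := (tendstoInMeasure_of_tendsto_eLpNorm (p := 2) (by norm_num)
    (fun k => hum (σ₁ k)) hv2.1 hvlim).exists_seq_tendsto_ae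
  obtain ⟨σ₃, hσ₃, hae₃⟩ := (tendstoInMeasure_of_tendsto_eLpNorm (p := 2) (by norm_num)
    (fun k => hGm (σ₁ (σ₂ k))) hH2.1 (hHlim.comp hσ₂.tendsto_atTop)).exists_seq_tendsto_ae
  have hac : ∀ n, volume.restrict (K n) ≪ ν := fun n =>
    (restrict_le_weightedMeasure K hδ n).absolutelyContinuous.trans
      Measure.smul_absolutelyContinuous
  have hcover : (⋃ n, K n) = Ω := by
    refine Set.Subset.antisymm (Set.iUnion_subset hKΩ) fun x hx => ?_
    obtain ⟨n, hn⟩ := hKabs {x} isCompact_singleton (by simpa using hx)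
    exact Set.mem_iUnion.2 ⟨n, hn rfl⟩
  have hae : ∀ {p : EuclideanSpace ℝ (Fin N) → Prop}, (∀ᵐ x ∂ν, p x) →
      ∀ᵐ x ∂volume.restrict Ω, p x := by
    intro p hp
    rw [← hcover, ae_restrict_iUnion_iff]
    exact fun n => (hac n).ae_le hp
  have hmem : ∀ {F : Type} [NormedAddCommGroup F] {f : EuclideanSpace ℝ (Fin N) → F},
      MemLp f 2 ν → MemLpLoc Ω 2 f := by
    intro F _ f hf L hL hLΩ
    obtain ⟨n, hn⟩ := hKabs L hL hLΩ
    have hK2 : MemLp f 2 (volume.restrict (K n)) :=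
      (hf.smul_measure (c := (δ n : ℝ≥0∞)⁻¹) (by
        rw [Ne, ENNReal.inv_eq_top]; exact_mod_cast (hδ n).ne')).mono_measure
        (restrict_le_weightedMeasure K hδ n)
    exact hK2.mono_measure (Measure.restrict_mono_set volume hn)
  have hloc : ∀ {F : Type} [NormedAddCommGroup F] {f : ℕ → EuclideanSpace ℝ (Fin N) → F},
      Tendsto (fun k => eLpNorm (f k) 2 ν) atTop (𝓝 0) → ∀ L, IsCompact L → L ⊆ Ω →
        Tendsto (fun k => eLpNorm (f k) 2 (volume.restrict L)) atTop (𝓝 0) := by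
    intro F _ f hf L hL hLΩ
    obtain ⟨n, hn⟩ := hKabs L hL hLΩ
    exact tendsto_of_tendsto_of_tendsto_of_le_of_le tendsto_const_nhds
      (tendsto_eLpNorm_restrict_of_weightedMeasure hδ hf n) (fun _ => zero_le)
      fun k => eLpNorm_mono_measure _ (Measure.restrict_mono_set volume hn)
  have hσ : StrictMono fun k => σ₁ (σ₂ (σ₃ k)) := hσ₁.comp (hσ₂.comp hσ₃)
  have hvloc := hloc (hvlim.comp (hσ₂.comp hσ₃).tendsto_atTop)
  have hHloc := hloc (hHlim.comp (hσ₂.comp hσ₃).tendsto_atTop)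
  have hvL := hmem hv2
  have hHL := hmem hH2
  refine ⟨fun k => σ₁ (σ₂ (σ₃ k)), hσ, v, H,
    ⟨hvL.mono_exponent (by norm_num), hHL.mono_exponent (by norm_num), fun φ hφ => ?_⟩, hvL, hHL,
    hvloc, hHloc, ?_, hae hae₃⟩
  · obtain ⟨M, hM0, hM1, hM2⟩ := hφ.exists_bound
    have hK' : IsCompact (tsupport φ) := hφ.hasCompactSupport
    have l1 := tendsto_setIntegral_of_tendsto_eLpNorm_two hΩ hφ
      (f := fun k => u (σ₁ (σ₂ (σ₃ k)))) (f₀ := v) (M := M.toNNReal)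
      (h := fun k x => u (σ₁ (σ₂ (σ₃ k))) x • gradient φ x) (h₀ := fun x => v x • gradient φ x)
      (fun k => (h _).memLpLoc_fun _ hK' hφ.tsupport_subset) (hvL _ hK' hφ.tsupport_subset)
      (hvloc _ hK' hφ.tsupport_subset)
      (fun k => hφ.integrableOn_smul_gradient hΩ (h _).isWeakGradient.memLpLoc_fun)
      (hφ.integrableOn_smul_gradient hΩ (hvL.mono_exponent (by norm_num)))
      (fun k x => by
        rw [← sub_smul, norm_smul, Real.coe_toNNReal _ hM0, mul_comm]
        gcongr
        exact hM2 x)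
      (fun k x hx => by rw [hφ.gradient_eq_zero hx, smul_zero])
      (fun x hx => by rw [hφ.gradient_eq_zero hx, smul_zero])
    have l2 := tendsto_setIntegral_of_tendsto_eLpNorm_two hΩ hφ
      (f := fun k => G (σ₁ (σ₂ (σ₃ k)))) (f₀ := H) (M := M.toNNReal)
      (h := fun k x => φ x • G (σ₁ (σ₂ (σ₃ k))) x) (h₀ := fun x => φ x • H x)
      (fun k => (h _).memLpLoc_grad _ hK' hφ.tsupport_subset) (hHL _ hK' hφ.tsupport_subset)
      (hHloc _ hK' hφ.tsupport_subset)
      (fun k => hφ.integrableOn_smul hΩ (h _).isWeakGradient.memLpLoc_grad)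
      (hφ.integrableOn_smul hΩ (hHL.mono_exponent (by norm_num)))
      (fun k x => by
        rw [← smul_sub, norm_smul, Real.coe_toNNReal _ hM0]
        gcongr
        exact hM1 x)
      (fun k x hx => by rw [image_eq_zero_of_notMem_tsupport hx, zero_smul])
      (fun x hx => by rw [image_eq_zero_of_notMem_tsupport hx, zero_smul])
    refine tendsto_nhds_unique (l1.congr fun k => ?_) l2.neg
    exact (h _).isWeakGradient.integral_eq φ hφ
  · refine hae ?_
    filter_upwards [hae₂] with x hx
    exact hx.comp hσ₃.tendsto_atTop

end Compactness

/-! ### The class `C^m` -/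

section PowerInequalities

/-- The graph of `x ↦ x ^ (n + 1)` lies above its tangent at `a`. -/
theorem pow_tangent_le {a c : ℝ} (ha : 0 ≤ a) (hc : 0 ≤ c) (n : ℕ) :
    a ^ (n + 1) + (n + 1) * a ^ n * (c - a) ≤ c ^ (n + 1) := by
  induction n with
  | zero => simp
  | succ n ih =>
    have h1 : a ^ (n + 1) * c + (n + 1) * a ^ n * (c - a) * c ≤ c ^ (n + 2) := by
      calc _ = (a ^ (n + 1) + (n + 1) * a ^ n * (c - a)) * c := by ring
        _ ≤ c ^ (n + 1) * c := by gcongr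
        _ = _ := by ring
    have h2 : 0 ≤ (n + 1) * a ^ n * (c - a) ^ 2 := by positivity
    push_cast
    calc _ = a ^ (n + 1) * c + (n + 1) * a ^ n * (c - a) * c - (n + 1) * a ^ n * (c - a) ^ 2 := by
          ring
      _ ≤ _ := by linarith

/-- `(a ^ m - b ^ m) / (m a ^ (m - 1))`: the increment of `f` that the convexity of `f ^ m` provides
between points where `f` has the values `b ≤ a`. For `a = 0` (so `b = 0`) the value is `0`. -/
noncomputable def convexIncrement (m : ℕ) (a b : ℝ) : ℝ := (a - b ^ m / a ^ (m - 1)) / m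

theorem convexIncrement_eq {m : ℕ} (hm : 1 ≤ m) {a : ℝ} (ha : 0 < a) (b : ℝ) :
    convexIncrement m a b = (a ^ m - b ^ m) / (m * a ^ (m - 1)) := by
  obtain ⟨n, rfl⟩ : ∃ n, m = n + 1 := ⟨m - 1, by omega⟩
  rw [convexIncrement, Nat.add_sub_cancel]
  field_simp
  ring

theorem convexIncrement_zero {m : ℕ} (hm : 1 ≤ m) : convexIncrement m 0 0 = 0 := by
  have : (0 : ℝ) ^ m = 0 := zero_pow (by omega)
  simp [convexIncrement, this]

theorem convexIncrement_mono_left {m : ℕ} {α a b : ℝ} (hα : 0 < α) (hαa : α ≤ a) (hb : 0 ≤ b) :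
    convexIncrement m α b ≤ convexIncrement m a b := by
  unfold convexIncrement
  gcongr

theorem convexIncrement_le {m : ℕ} (hm : 1 ≤ m) {a c : ℝ} (ha : 0 < a) (hc : 0 ≤ c) :
    convexIncrement m a c ≤ a - c := by
  obtain ⟨n, rfl⟩ : ∃ n, m = n + 1 := ⟨m - 1, by omega⟩
  rw [convexIncrement_eq hm ha, Nat.add_sub_cancel, div_le_iff₀ (by positivity)]
  have := pow_tangent_le ha.le hc n
  push_cast
  linarith

theorem le_convexIncrement {m : ℕ} (hm : 1 ≤ m) {a c : ℝ} (ha : 0 < a) (hc : 0 ≤ c) :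
    (a - c) * (c / a) ^ (m - 1) ≤ convexIncrement m a c := by
  obtain ⟨n, rfl⟩ : ∃ n, m = n + 1 := ⟨m - 1, by omega⟩
  rw [convexIncrement_eq hm ha, Nat.add_sub_cancel, le_div_iff₀ (by positivity)]
  have := pow_tangent_le hc ha.le n
  have e : (a - c) * (c / a) ^ n * (((n + 1 : ℕ) : ℝ) * a ^ n) = (n + 1) * c ^ n * (a - c) := by
    rw [div_pow]
    push_cast
    field_simp
  rw [e]
  linarith

theorem sub_le_mul_convexIncrement {m : ℕ} (hm : 1 ≤ m) {a c : ℝ} (ha : 0 ≤ a) (hc : 0 ≤ c)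
    (hca : c ≤ a) : a - c ≤ m * convexIncrement m a c := by
  obtain ⟨n, rfl⟩ : ∃ n, m = n + 1 := ⟨m - 1, by omega⟩
  rw [convexIncrement, Nat.add_sub_cancel, mul_div_cancel₀ _ (by positivity)]
  have : c ^ (n + 1) / a ^ n ≤ c := by
    rcases ha.eq_or_lt with rfl | ha'
    · have : c = 0 := le_antisymm hca hc
      simp [this]
    · rw [div_le_iff₀ (by positivity), pow_succ, mul_comm]
      gcongr
  linarith

end PowerInequalities

section Nonlinearity

variable {m : ℕ} {f : ℝ → ℝ≥0∞}

theorem LowerSemicontinuous.le_of_forall_lt {g : ℝ → ℝ≥0∞} (hg : LowerSemicontinuous g) {z : ℝ}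
    {c : ℝ≥0∞} (h : ∀ s < z, g s ≤ c) : g z ≤ c := by
  by_contra! hc
  obtain ⟨s, hs1, hs2⟩ := ((hg z c hc).filter_mono nhdsWithin_le_nhds |>.and
    (self_mem_nhdsWithin (s := Set.Iio z))).exists
  exact absurd (h s hs2) (not_le.2 hs1)

/-- The convexity of `f ^ m` on the half-line where `f` is finite amounts to the convexity of
`f ^ m` as a function on `ℝ` with values in `[0, ∞]`. -/
theorem IsMConvexNonlinearity.pow_le (hm : 1 ≤ m) (hf : IsMConvexNonlinearity m f) {a b : ℝ}
    (ha : 0 < a) (hb : 0 < b) (hab : a + b = 1) (x y : ℝ) :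
    f (a * x + b * y) ^ m ≤ ENNReal.ofReal a * f x ^ m + ENNReal.ofReal b * f y ^ m := by
  have hm0 : m ≠ 0 := by omega
  by_cases hx : f x = ⊤
  · rw [hx, ENNReal.top_pow hm0, ENNReal.mul_top (by simpa using ha), top_add]; exact le_top
  by_cases hy : f y = ⊤
  · rw [hy, ENNReal.top_pow hm0, ENNReal.mul_top (by simpa using hb), add_top]; exact le_top
  have hlsc : LowerSemicontinuous fun t => f t ^ m :=
    (ENNReal.continuous_pow m).comp_lowerSemicontinuous hf.lowerSemicontinuous
      fun _ _ h => by dsimp only; gcongr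
  refine hlsc.le_of_forall_lt fun s hs => ?_
  -- shift both points to the left, into the open half-line of convexity
  set ε := a * x + b * y - s with hε
  have hεpos : 0 < ε := by linarith
  have hdom : ∀ w, f w ≠ ⊤ →
      w - ε ∈ {t : ℝ | (t : EReal) < ⨆ (s : ℝ) (_ : f s < ⊤), (s : EReal)} := fun w hw => by
    refine lt_of_lt_of_le (EReal.coe_lt_coe_iff.2 (by linarith : w - ε < w)) ?_
    exact le_iSup₂_of_le w (lt_top_iff_ne_top.2 hw) le_rfl
  have hfin : ∀ w, f w ≠ ⊤ → f (w - ε) ≠ ⊤ := fun w hw =>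
    ne_top_of_le_ne_top hw (hf.monotone (by linarith))
  have hconv := hf.convexOn.2 (hdom x hx) (hdom y hy) ha.le hb.le hab
  have hs' : a • (x - ε) + b • (y - ε) = s := by
    simp only [smul_eq_mul]
    calc _ = a * x + b * y - (a + b) * ε := by ring
      _ = s := by rw [hab]; linarith
  rw [hs'] at hconv
  have hsfin : f s ≠ ⊤ := by
    rcases le_total x y with hxy | hxy
    · refine ne_top_of_le_ne_top hy (hf.monotone ?_)
      have h1 : a * x ≤ a * y := mul_le_mul_of_nonneg_left hxy ha.le
      have h2 : a * y + b * y = y := by rw [← add_mul, hab, one_mul]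
      linarith
    · refine ne_top_of_le_ne_top hx (hf.monotone ?_)
      have h1 : b * y ≤ b * x := mul_le_mul_of_nonneg_left hxy hb.le
      have h2 : a * x + b * x = x := by rw [← add_mul, hab, one_mul]
      linarith
  calc f s ^ m = ENNReal.ofReal ((f s).toReal ^ m) := by
        rw [ENNReal.ofReal_pow ENNReal.toReal_nonneg, ENNReal.ofReal_toReal hsfin]
    _ ≤ ENNReal.ofReal (a • (f (x - ε)).toReal ^ m + b • (f (y - ε)).toReal ^ m) :=
        ENNReal.ofReal_le_ofReal hconv
    _ = ENNReal.ofReal a * f (x - ε) ^ m + ENNReal.ofReal b * f (y - ε) ^ m := by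
        rw [ENNReal.ofReal_add (by positivity) (by positivity), smul_eq_mul, smul_eq_mul,
          ENNReal.ofReal_mul ha.le, ENNReal.ofReal_mul hb.le,
          ENNReal.ofReal_pow ENNReal.toReal_nonneg, ENNReal.ofReal_pow ENNReal.toReal_nonneg,
          ENNReal.ofReal_toReal (hfin x hx), ENNReal.ofReal_toReal (hfin y hy)]
    _ ≤ _ := by
        gcongr
        · exact hf.monotone (by linarith)
        · exact hf.monotone (by linarith)

/-- The converse of `IsMConvexNonlinearity.pow_le`. -/
theorem isMConvexNonlinearity_of_pow_le (hlsc : LowerSemicontinuous f) (hmono : Monotone f)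
    (h : ∀ a b : ℝ, 0 < a → 0 < b → a + b = 1 → ∀ x y : ℝ,
      f (a * x + b * y) ^ m ≤ ENNReal.ofReal a * f x ^ m + ENNReal.ofReal b * f y ^ m) :
    IsMConvexNonlinearity m f where
  lowerSemicontinuous := hlsc
  monotone := hmono
  convexOn := by
    have hfin : ∀ t ∈ {t : ℝ | (t : EReal) < ⨆ (s : ℝ) (_ : f s < ⊤), (s : EReal)}, f t ≠ ⊤ := by
      intro t ht
      obtain ⟨s, hs⟩ := lt_iSup_iff.1 (show (t : EReal) < _ from ht)
      obtain ⟨hs1, hs2⟩ := lt_iSup_iff.1 hs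
      exact ne_top_of_le_ne_top hs1.ne (hmono (EReal.coe_lt_coe_iff.1 hs2).le)
    have hconvex : Convex ℝ {t : ℝ | (t : EReal) < ⨆ (s : ℝ) (_ : f s < ⊤), (s : EReal)} := by
      refine Set.OrdConnected.convex ⟨fun x _ y hy z hz => ?_⟩
      exact lt_of_le_of_lt (EReal.coe_le_coe_iff.2 hz.2) hy
    refine convexOn_iff_forall_pos.2 ⟨hconvex, fun x hx y hy a b ha hb hab => ?_⟩
    have hz := hconvex hx hy ha.le hb.le hab
    have h1 := h a b ha hb hab x y
    have hr : ENNReal.ofReal a * f x ^ m + ENNReal.ofReal b * f y ^ m ≠ ⊤ := by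
      have := hfin x hx
      have := hfin y hy
      finiteness
    have h2 := ENNReal.toReal_mono hr h1
    rw [ENNReal.toReal_add (by have := hfin x hx; finiteness) (by have := hfin y hy; finiteness),
      ENNReal.toReal_mul, ENNReal.toReal_mul, ENNReal.toReal_ofReal ha.le,
      ENNReal.toReal_ofReal hb.le] at h2
    simpa using h2

theorem IsMConvexNonlinearity.tendsto_left (hf : IsMConvexNonlinearity m f) (t : ℝ) :
    Tendsto (fun k : ℝ => f (t - k)) (𝓝[>] 0) (𝓝 (f t)) := by
  have h0 : Tendsto (fun k : ℝ => t - k) (𝓝[>] 0) (𝓝 t) := by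
    have : Tendsto (fun k : ℝ => t - k) (𝓝 0) (𝓝 (t - 0)) := tendsto_const_nhds.sub tendsto_id
    rw [sub_zero] at this
    exact this.mono_left nhdsWithin_le_nhds
  refine tendsto_order.2 ⟨fun c hc => h0.eventually (hf.lowerSemicontinuous t c hc), fun c hc => ?_⟩
  filter_upwards [self_mem_nhdsWithin] with k hk
  have hk' : 0 < k := hk
  exact (hf.monotone (by linarith)).trans_lt hc

/-- Chords of `f ^ m` ending at a fixed point become steeper. -/
theorem IsMConvexNonlinearity.slope_le (hm : 1 ≤ m) (hf : IsMConvexNonlinearity m f) {r s t : ℝ}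
    (hrs : r < s) (hst : s < t) (ht : f t ≠ ⊤) :
    ((f t).toReal ^ m - (f r).toReal ^ m) / (t - r)
      ≤ ((f t).toReal ^ m - (f s).toReal ^ m) / (t - s) := by
  have hs : f s ≠ ⊤ := ne_top_of_le_ne_top ht (hf.monotone hst.le)
  have hr : f r ≠ ⊤ := ne_top_of_le_ne_top hs (hf.monotone hrs.le)
  have hrt : 0 < t - r := by linarith
  have h1 := hf.pow_le hm (a := (t - s) / (t - r)) (b := (s - r) / (t - r))
    (div_pos (by linarith) hrt) (div_pos (by linarith) hrt) (by field_simp; ring) r t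
  have e : (t - s) / (t - r) * r + (s - r) / (t - r) * t = s := by field_simp; ring
  rw [e] at h1
  have h2 := ENNReal.toReal_mono (by finiteness) h1
  rw [ENNReal.toReal_add (by finiteness) (by finiteness), ENNReal.toReal_mul, ENNReal.toReal_mul,
    ENNReal.toReal_ofReal (div_pos (by linarith) hrt).le,
    ENNReal.toReal_ofReal (div_pos (by linarith) hrt).le, ENNReal.toReal_pow, ENNReal.toReal_pow,
    ENNReal.toReal_pow] at h2
  rw [div_mul_eq_mul_div, div_mul_eq_mul_div, ← add_div, le_div_iff₀ hrt] at h2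
  rw [div_le_div_iff₀ hrt (by linarith)]
  linarith

theorem IsMConvexNonlinearity.convexIncrement_div_le (hm : 1 ≤ m) (hf : IsMConvexNonlinearity m f)
    {r s t : ℝ} (hrs : r < s) (hst : s < t) (ht : f t ≠ ⊤) :
    convexIncrement m (f t).toReal (f r).toReal / (t - r)
      ≤ convexIncrement m (f t).toReal (f s).toReal / (t - s) := by
  have hs : f s ≠ ⊤ := ne_top_of_le_ne_top ht (hf.monotone hst.le)
  rcases (ENNReal.toReal_nonneg (a := f t)).eq_or_lt with h0 | h0
  · have hs0 : (f s).toReal = 0 := le_antisymm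
      ((ENNReal.toReal_mono ht (hf.monotone hst.le)).trans h0.symm.le) ENNReal.toReal_nonneg
    have hr0 : (f r).toReal = 0 := le_antisymm
      ((ENNReal.toReal_mono ht (hf.monotone (hrs.trans hst).le)).trans h0.symm.le)
      ENNReal.toReal_nonneg
    rw [← h0, hs0, hr0, convexIncrement_zero hm]
    simp
  · have e : ∀ x y : ℝ, x / (m * (f t).toReal ^ (m - 1)) / y
        = x / y / (m * (f t).toReal ^ (m - 1)) := fun x y => div_right_comm _ _ _
    rw [convexIncrement_eq hm h0, convexIncrement_eq hm h0, e, e]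
    exact div_le_div_of_nonneg_right (hf.slope_le hm hrs hst ht) (by positivity)

/-- The left derivative of `f` dominates the difference quotients that come from the convexity of
`f ^ m`. -/
theorem IsMConvexNonlinearity.le_leftDerivative (hm : 1 ≤ m) (hf : IsMConvexNonlinearity m f)
    {r t : ℝ} (hrt : r < t) (ht : f t ≠ ⊤) :
    ENNReal.ofReal (convexIncrement m (f t).toReal (f r).toReal / (t - r))
      ≤ leftDerivative f t := by
  rw [leftDerivative, if_neg ht]
  rcases (ENNReal.toReal_nonneg (a := f t)).eq_or_lt with h0 | h0
  · have hr0 : (f r).toReal = 0 := le_antisymm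
      ((ENNReal.toReal_mono ht (hf.monotone hrt.le)).trans h0.symm.le) ENNReal.toReal_nonneg
    rw [← h0, hr0, convexIncrement_zero hm]
    simp
  rw [← limsup_const (f := 𝓝[>] (0 : ℝ))
    (ENNReal.ofReal (convexIncrement m (f t).toReal (f r).toReal / (t - r)))]
  refine limsup_le_limsup ?_
  filter_upwards [Ioo_mem_nhdsGT (sub_pos.2 hrt)] with k hk
  have hfk : f (t - k) ≠ ⊤ := ne_top_of_le_ne_top ht (hf.monotone (by linarith [hk.1]))
  have h1 := hf.convexIncrement_div_le hm (r := r) (s := t - k) (by linarith [hk.2])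
    (by linarith [hk.1]) ht
  have h2 := convexIncrement_le hm h0 (ENNReal.toReal_nonneg (a := f (t - k)))
  rw [sub_sub_cancel] at h1
  calc _ ≤ ENNReal.ofReal (((f t).toReal - (f (t - k)).toReal) / k) := by
        refine ENNReal.ofReal_le_ofReal (h1.trans ?_)
        have := hk.1
        gcongr
    _ = _ := by
        rw [ENNReal.ofReal_div_of_pos hk.1, ENNReal.ofReal_sub _ ENNReal.toReal_nonneg,
          ENNReal.ofReal_toReal ht, ENNReal.ofReal_toReal hfk]

/-- The left derivative of `f` is the least upper bound of the difference quotients that come from the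
convexity of `f ^ m`; rational base points suffice. -/
theorem IsMConvexNonlinearity.leftDerivative_le (hm : 1 ≤ m) (hf : IsMConvexNonlinearity m f)
    {t : ℝ} (ht : f t ≠ ⊤) {S : ℝ≥0∞} (hS : ∀ q : ℚ, (q : ℝ) < t →
      ENNReal.ofReal (convexIncrement m (f t).toReal (f q).toReal / (t - q)) ≤ S) :
    leftDerivative f t ≤ S := by
  rw [leftDerivative, if_neg ht]
  have hmono : ∀ k : ℝ, 0 < k → (f (t - k)).toReal ≤ (f t).toReal := fun k hk =>
    ENNReal.toReal_mono ht (hf.monotone (by linarith))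
  have hfin : ∀ k : ℝ, 0 < k → f (t - k) ≠ ⊤ := fun k hk =>
    ne_top_of_le_ne_top ht (hf.monotone (by linarith))
  rcases (ENNReal.toReal_nonneg (a := f t)).eq_or_lt with h0 | h0
  · have hz : f t = 0 := by
      have := (ENNReal.toReal_eq_zero_iff _).1 h0.symm
      tauto
    have : (fun k : ℝ => (f t - f (t - k)) / ENNReal.ofReal k) = fun _ => 0 := by
      funext k; simp [hz]
    rw [this, limsup_const]
    exact zero_le
  rcases eq_or_ne S ⊤ with rfl | hSt
  · exact le_top
  -- the bound by `S` holds for real base points as well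
  have hreal : ∀ k : ℝ, 0 < k →
      convexIncrement m (f t).toReal (f (t - k)).toReal ≤ S.toReal * k := by
    intro k hk
    obtain ⟨q, hq1, hq2⟩ := exists_rat_btwn (show t - k < t by linarith)
    have h1 := hf.convexIncrement_div_le hm hq1 hq2 ht
    rw [sub_sub_cancel] at h1
    have h2 := (ENNReal.ofReal_le_iff_le_toReal hSt).1 (hS q hq2)
    exact (div_le_iff₀ hk).1 (h1.trans h2)
  have hlim : Tendsto (fun k : ℝ => (f (t - k)).toReal) (𝓝[>] 0) (𝓝 (f t).toReal) :=
    (ENNReal.tendsto_toReal ht).comp (hf.tendsto_left t)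
  have hlim2 : Tendsto (fun k : ℝ => ENNReal.ofReal
      (S.toReal * ((f t).toReal / (f (t - k)).toReal) ^ (m - 1))) (𝓝[>] 0) (𝓝 S) := by
    have h1 : Tendsto (fun k : ℝ => S.toReal * ((f t).toReal / (f (t - k)).toReal) ^ (m - 1))
        (𝓝[>] 0) (𝓝 (S.toReal * ((f t).toReal / (f t).toReal) ^ (m - 1))) :=
      ((tendsto_const_nhds.div hlim h0.ne').pow _).const_mul _
    rw [div_self h0.ne', one_pow, mul_one] at h1
    have h2 := ENNReal.tendsto_ofReal h1
    rwa [ENNReal.ofReal_toReal hSt] at h2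
  rw [← hlim2.limsup_eq]
  refine limsup_le_limsup ?_
  filter_upwards [self_mem_nhdsWithin, hlim.eventually_const_lt h0] with k hk hck
  have hk' : 0 < k := hk
  have h1 := (le_convexIncrement hm h0 hck.le).trans (hreal k hk')
  have h2 : ((f t).toReal - (f (t - k)).toReal) / k
      ≤ S.toReal * ((f t).toReal / (f (t - k)).toReal) ^ (m - 1) := by
    rw [div_le_iff₀ hk']
    have hp : 0 < ((f t).toReal / (f (t - k)).toReal) ^ (m - 1) := by positivity
    calc (f t).toReal - (f (t - k)).toReal
        = ((f t).toReal - (f (t - k)).toReal) * ((f (t - k)).toReal / (f t).toReal) ^ (m - 1)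
          * ((f t).toReal / (f (t - k)).toReal) ^ (m - 1) := by
          rw [mul_assoc, ← mul_pow, div_mul_div_cancel₀ h0.ne', div_self hck.ne', one_pow, mul_one]
      _ ≤ S.toReal * k * ((f t).toReal / (f (t - k)).toReal) ^ (m - 1) := by gcongr
      _ = _ := by ring
  calc (f t - f (t - k)) / ENNReal.ofReal k
      = ENNReal.ofReal (((f t).toReal - (f (t - k)).toReal) / k) := by
        rw [ENNReal.ofReal_div_of_pos hk', ENNReal.ofReal_sub _ ENNReal.toReal_nonneg,
          ENNReal.ofReal_toReal ht, ENNReal.ofReal_toReal (hfin k hk')]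
    _ ≤ _ := ENNReal.ofReal_le_ofReal h2

/-- By the above, the left derivative is a countable supremum of measurable functions. -/
theorem IsMConvexNonlinearity.measurable_leftDerivative (hm : 1 ≤ m)
    (hf : IsMConvexNonlinearity m f) : Measurable (leftDerivative f) := by
  classical
  have hfm : Measurable f := hf.monotone.measurable
  have e : leftDerivative f = fun t => if f t = ⊤ then ⊤ else ⨆ q : ℚ, if (q : ℝ) < t then
      ENNReal.ofReal (convexIncrement m (f t).toReal (f q).toReal / (t - q)) else 0 := by
    funext t
    by_cases ht : f t = ⊤
    · simp [leftDerivative, ht]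
    · rw [if_neg ht]
      refine le_antisymm (hf.leftDerivative_le hm ht fun q hq => ?_) (iSup_le fun q => ?_)
      · exact le_iSup_of_le q (by rw [if_pos hq])
      · split_ifs with hq
        · exact hf.le_leftDerivative hm hq ht
        · exact zero_le
  rw [e]
  refine Measurable.ite (hfm (measurableSet_singleton _)) measurable_const
    (Measurable.iSup fun q => Measurable.ite measurableSet_Ioi ?_ measurable_const)
  unfold convexIncrement
  have := hfm.ennreal_toReal
  fun_prop

/-- Beyond a level `t₀` the nonlinearity is controlled by its left derivative. For `t ≤ t₀` the factor
`ENNReal.ofReal (m * (t - t₀))` is zero. -/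
theorem IsMConvexNonlinearity.le_add_leftDerivative (hm : 1 ≤ m) (hf : IsMConvexNonlinearity m f)
    (t₀ t : ℝ) :
    f t ≤ f (min t t₀) + ENNReal.ofReal (m * (t - t₀)) * leftDerivative f t := by
  rcases le_or_gt t t₀ with h | h
  · rw [min_eq_left h]; exact le_self_add
  rw [min_eq_right h.le]
  have hpos : 0 < (m : ℝ) * (t - t₀) := mul_pos (by exact_mod_cast hm) (by linarith)
  by_cases ht : f t = ⊤
  · have : leftDerivative f t = ⊤ := by simp [leftDerivative, ht]
    rw [this, ENNReal.mul_top (ENNReal.ofReal_pos.2 hpos).ne', add_top]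
    exact le_top
  have ht₀ : f t₀ ≠ ⊤ := ne_top_of_le_ne_top ht (hf.monotone h.le)
  have h1 := sub_le_mul_convexIncrement hm (ENNReal.toReal_nonneg (a := f t))
    (ENNReal.toReal_nonneg (a := f t₀)) (ENNReal.toReal_mono ht (hf.monotone h.le))
  calc f t = ENNReal.ofReal (f t).toReal := (ENNReal.ofReal_toReal ht).symm
    _ ≤ ENNReal.ofReal ((f t₀).toReal + (m * (t - t₀)) *
        (convexIncrement m (f t).toReal (f t₀).toReal / (t - t₀))) := by
        refine ENNReal.ofReal_le_ofReal ?_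
        have : (m * (t - t₀)) * (convexIncrement m (f t).toReal (f t₀).toReal / (t - t₀))
            = m * convexIncrement m (f t).toReal (f t₀).toReal := by
          have : t - t₀ ≠ 0 := by linarith
          field_simp
        rw [this]; linarith
    _ ≤ ENNReal.ofReal (f t₀).toReal + ENNReal.ofReal ((m * (t - t₀)) *
        (convexIncrement m (f t).toReal (f t₀).toReal / (t - t₀))) := ENNReal.ofReal_add_le
    _ ≤ _ := by
        rw [ENNReal.ofReal_toReal ht₀, ENNReal.ofReal_mul hpos.le]
        gcongr
        exact hf.le_leftDerivative hm h ht

end Nonlinearity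

/-! ### Limits of nonlinearities -/

section LimitNonlinearity

/-- The left-continuous nondecreasing function on `ℝ` determined by nondecreasing values `h` on `ℚ`. The
supremum over `q < t`, rather than `q ≤ t`, makes it lower semicontinuous. -/
noncomputable def leftLimitExtension (h : ℚ → ℝ≥0∞) (t : ℝ) : ℝ≥0∞ :=
  ⨆ (q : ℚ) (_ : (q : ℝ) < t), h q

variable {m : ℕ} {f : ℕ → ℝ → ℝ≥0∞} {h : ℚ → ℝ≥0∞}

theorem lt_leftLimitExtension {t : ℝ} {c : ℝ≥0∞} :
    c < leftLimitExtension h t ↔ ∃ q : ℚ, (q : ℝ) < t ∧ c < h q := by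
  simp [leftLimitExtension, lt_iSup_iff]

theorem le_leftLimitExtension {t : ℝ} {q : ℚ} (hq : (q : ℝ) < t) : h q ≤ leftLimitExtension h t :=
  le_iSup₂_of_le q hq le_rfl

theorem monotone_leftLimitExtension : Monotone (leftLimitExtension h) := fun _ _ hst =>
  iSup₂_le fun _ hq => le_leftLimitExtension (hq.trans_le hst)

theorem lowerSemicontinuous_leftLimitExtension : LowerSemicontinuous (leftLimitExtension h) := by
  intro t c hc
  obtain ⟨q, hq, hcq⟩ := lt_leftLimitExtension.1 hc
  filter_upwards [lt_mem_nhds hq] with s hs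
  exact hcq.trans_le (le_leftLimitExtension hs)

/-- The class `C^m` is closed under pointwise limits on `ℚ`. -/
theorem isMConvexNonlinearity_leftLimitExtension (hm : 1 ≤ m)
    (hf : ∀ k, IsMConvexNonlinearity m (f k))
    (hlim : ∀ q : ℚ, Tendsto (fun k => f k q) atTop (𝓝 (h q))) :
    IsMConvexNonlinearity m (leftLimitExtension h) := by
  refine isMConvexNonlinearity_of_pow_le lowerSemicontinuous_leftLimitExtension
    monotone_leftLimitExtension fun a b ha hb hab x y => ?_
  have hlsc : LowerSemicontinuous fun t => leftLimitExtension h t ^ m :=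
    (ENNReal.continuous_pow m).comp_lowerSemicontinuous lowerSemicontinuous_leftLimitExtension
      fun _ _ h => by dsimp only; gcongr
  refine hlsc.le_of_forall_lt fun s hs => ?_
  -- between `s` and `a x + b y` there is room for rational points slightly to the left of `x`, `y`
  set ε := a * x + b * y - s with hε
  have hεpos : 0 < ε := by linarith
  obtain ⟨p, hp1, hp2⟩ := exists_rat_btwn (show x - ε < x by linarith)
  obtain ⟨q, hq1, hq2⟩ := exists_rat_btwn (show y - ε < y by linarith)
  have hspq : s < a * p + b * q := by
    have h1 : a * (x - ε) < a * p := mul_lt_mul_of_pos_left hp1 ha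
    have h2 : b * (y - ε) < b * q := mul_lt_mul_of_pos_left hq1 hb
    have h3 : a * (x - ε) + b * (y - ε) = s := by
      calc _ = a * x + b * y - (a + b) * ε := by ring
        _ = s := by rw [hab]; linarith
    linarith
  have hr : ∀ r : ℚ, (r : ℝ) < s →
      h r ^ m ≤ ENNReal.ofReal a * h p ^ m + ENNReal.ofReal b * h q ^ m := by
    intro r hr
    have l1 := ((ENNReal.continuous_pow m).tendsto _).comp (hlim r)
    have l2 := (ENNReal.Tendsto.const_mul (a := ENNReal.ofReal a)
      (((ENNReal.continuous_pow m).tendsto _).comp (hlim p)) (Or.inr ENNReal.ofReal_ne_top)).add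
      (ENNReal.Tendsto.const_mul (a := ENNReal.ofReal b)
      (((ENNReal.continuous_pow m).tendsto _).comp (hlim q)) (Or.inr ENNReal.ofReal_ne_top))
    refine le_of_tendsto_of_tendsto' l1 l2 fun k => ?_
    refine le_trans ?_ ((hf k).pow_le hm ha hb hab p q)
    simp only [Function.comp_apply]
    gcongr
    exact (hf k).monotone (by linarith)
  have hsup : leftLimitExtension h s ^ m ≤ ENNReal.ofReal a * h p ^ m + ENNReal.ofReal b * h q ^ m := by
    by_contra! hcon
    obtain ⟨c, hc1, hc2⟩ : ∃ c, c < leftLimitExtension h s ∧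
        ENNReal.ofReal a * h p ^ m + ENNReal.ofReal b * h q ^ m < c ^ m := by
      by_contra! hcc
      have hm0 : (m : ℝ) ≠ 0 := by positivity
      have h1 : leftLimitExtension h s
          ≤ (ENNReal.ofReal a * h p ^ m + ENNReal.ofReal b * h q ^ m) ^ ((m : ℝ)⁻¹) := by
        refine le_of_forall_lt fun c hc => ?_
        obtain ⟨c', hc', hc''⟩ := exists_between hc
        refine hc'.trans_le ?_
        rw [ENNReal.le_rpow_inv_iff (by positivity), ENNReal.rpow_natCast]
        exact hcc c' hc''
      rw [ENNReal.le_rpow_inv_iff (by positivity), ENNReal.rpow_natCast] at h1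
      exact absurd hcon (not_lt.2 h1)
    obtain ⟨r, hr1, hr2⟩ := lt_leftLimitExtension.1 hc1
    have : c ^ m ≤ h r ^ m := by gcongr
    exact absurd (hc2.trans_le (this.trans (hr r hr1))) (lt_irrefl _)
  refine hsup.trans ?_
  gcongr
  · exact le_leftLimitExtension hp2
  · exact le_leftLimitExtension hq2

theorem eventually_lt_of_lt_leftLimitExtension (hmono : ∀ k, Monotone (f k))
    (hlim : ∀ q : ℚ, Tendsto (fun k => f k q) atTop (𝓝 (h q))) {s : ℕ → ℝ} {t : ℝ}
    (hs : Tendsto s atTop (𝓝 t)) {c : ℝ≥0∞} (hc : c < leftLimitExtension h t) :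
    ∀ᶠ k in atTop, c < f k (s k) := by
  obtain ⟨q, hq, hcq⟩ := lt_leftLimitExtension.1 hc
  filter_upwards [hs.eventually_const_lt hq, (hlim q).eventually_const_lt hcq] with k h1 h2
  exact h2.trans_le (hmono k h1.le)

theorem leftLimitExtension_le_liminf (hmono : ∀ k, Monotone (f k))
    (hlim : ∀ q : ℚ, Tendsto (fun k => f k q) atTop (𝓝 (h q))) {s : ℕ → ℝ} {t : ℝ}
    (hs : Tendsto s atTop (𝓝 t)) : leftLimitExtension h t ≤ liminf (fun k => f k (s k)) atTop := by
  refine le_of_forall_lt fun c hc => ?_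
  obtain ⟨c', h1, h2⟩ := exists_between hc
  refine h1.trans_le (le_liminf_of_le (by isBoundedDefault) ?_)
  filter_upwards [eventually_lt_of_lt_leftLimitExtension hmono hlim hs h2] with k hk
  exact hk.le

/-- In the interior of the half-line of finiteness the limit nonlinearity is continuous, so that it
also bounds the approximating ones from above. -/
theorem eventually_lt_of_leftLimitExtension_lt (hm : 1 ≤ m)
    (hf : ∀ k, IsMConvexNonlinearity m (f k))
    (hlim : ∀ q : ℚ, Tendsto (fun k => f k q) atTop (𝓝 (h q))) {s : ℕ → ℝ} {t t' : ℝ}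
    (hs : Tendsto s atTop (𝓝 t)) (htt' : t < t') (ht' : leftLimitExtension h t' ≠ ⊤) {c : ℝ≥0∞}
    (hc : leftLimitExtension h t < c) : ∀ᶠ k in atTop, f k (s k) < c := by
  have hF := isMConvexNonlinearity_leftLimitExtension hm hf hlim
  set F := leftLimitExtension h with hFdef
  have hm0 : m ≠ 0 := by omega
  have hlt : F t ^ m < c ^ m := (ENNReal.pow_lt_pow_left_iff hm0).2 hc
  have hcont : Tendsto (fun l : ℝ => ENNReal.ofReal (1 - l) * F t ^ m + ENNReal.ofReal l * F t' ^ m)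
      (𝓝 0) (𝓝 (F t ^ m)) := by
    have a1 : Tendsto (fun l : ℝ => ENNReal.ofReal (1 - l)) (𝓝 0) (𝓝 1) := by
      have : Tendsto (fun l : ℝ => 1 - l) (𝓝 0) (𝓝 (1 - 0)) := tendsto_const_nhds.sub tendsto_id
      simpa using ENNReal.tendsto_ofReal this
    have a2 : Tendsto (fun l : ℝ => ENNReal.ofReal l) (𝓝 0) (𝓝 0) := by
      simpa using ENNReal.tendsto_ofReal (tendsto_id (α := ℝ) (x := 𝓝 0))
    have b1 := ENNReal.Tendsto.mul_const (b := F t ^ m) a1 (Or.inl one_ne_zero)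
    have b2 := ENNReal.Tendsto.mul_const (b := F t' ^ m) a2 (Or.inr (by finiteness))
    simpa using b1.add b2
  obtain ⟨l, hl1, hl2⟩ := ((hcont.mono_left nhdsWithin_le_nhds).eventually_lt_const hlt |>.and
    (Ioo_mem_nhdsGT (zero_lt_one' ℝ))).exists
  have hconv := hF.pow_le hm (a := 1 - l) (b := l) (by linarith [hl2.2]) hl2.1 (by ring) t t'
  have hlt2 : F ((1 - l) * t + l * t') < c :=
    (ENNReal.pow_lt_pow_left_iff hm0).1 (hconv.trans_lt hl1)
  have hpos : t < (1 - l) * t + l * t' := by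
    have := mul_lt_mul_of_pos_left htt' hl2.1
    linarith
  obtain ⟨q, hq1, hq2⟩ := exists_rat_btwn hpos
  have hqc : h q < c := (le_leftLimitExtension hq2).trans_lt hlt2
  filter_upwards [hs.eventually_lt_const hq1, (hlim q).eventually_lt_const hqc] with k h1 h2
  exact ((hf k).monotone h1.le).trans_lt h2

theorem tendsto_of_leftLimitExtension_ne_top (hm : 1 ≤ m)
    (hf : ∀ k, IsMConvexNonlinearity m (f k))
    (hlim : ∀ q : ℚ, Tendsto (fun k => f k q) atTop (𝓝 (h q))) {s : ℕ → ℝ} {t t' : ℝ}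
    (hs : Tendsto s atTop (𝓝 t)) (htt' : t < t') (ht' : leftLimitExtension h t' ≠ ⊤) :
    Tendsto (fun k => f k (s k)) atTop (𝓝 (leftLimitExtension h t)) :=
  tendsto_order.2 ⟨fun _ hc => eventually_lt_of_lt_leftLimitExtension (fun k => (hf k).monotone)
    hlim hs hc, fun _ hc => eventually_lt_of_leftLimitExtension_lt hm hf hlim hs htt' ht' hc⟩

/-- Lower semicontinuity of the left derivatives under convergence of the nonlinearities. -/
theorem leftDerivative_leftLimitExtension_le_liminf (hm : 1 ≤ m)
    (hf : ∀ k, IsMConvexNonlinearity m (f k))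
    (hlim : ∀ q : ℚ, Tendsto (fun k => f k q) atTop (𝓝 (h q))) {s : ℕ → ℝ} {t : ℝ}
    (hs : Tendsto s atTop (𝓝 t)) (ht : leftLimitExtension h t ≠ ⊤) :
    leftDerivative (leftLimitExtension h) t
      ≤ liminf (fun k => leftDerivative (f k) (s k)) atTop := by
  have hF := isMConvexNonlinearity_leftLimitExtension hm hf hlim
  refine hF.leftDerivative_le hm ht fun q hq => ?_
  set F := leftLimitExtension h with hFdef
  rcases (ENNReal.toReal_nonneg (a := F t)).eq_or_lt with h0 | h0
  · have hq0 : (F q).toReal = 0 := le_antisymm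
      ((ENNReal.toReal_mono ht (hF.monotone hq.le)).trans h0.symm.le) ENNReal.toReal_nonneg
    rw [← h0, hq0, convexIncrement_zero hm]
    simp
  have hFq : F q ≠ ⊤ := ne_top_of_le_ne_top ht (hF.monotone hq.le)
  have hb : Tendsto (fun k => (f k q).toReal) atTop (𝓝 (F q).toReal) :=
    (ENNReal.tendsto_toReal hFq).comp
      (tendsto_of_leftLimitExtension_ne_top hm hf hlim tendsto_const_nhds hq ht)
  have hfq : ∀ᶠ k in atTop, f k q ≠ ⊤ := by
    filter_upwards [eventually_lt_of_leftLimitExtension_lt hm hf hlim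
      (tendsto_const_nhds (x := (q : ℝ))) hq ht (lt_top_iff_ne_top.2 hFq)] with k hk
    exact hk.ne
  -- the bound with a level `α < F t` in place of `F t`
  have key : ∀ α : ℝ, 0 < α → α < (F t).toReal →
      ENNReal.ofReal (convexIncrement m α (F q).toReal / (t - q))
        ≤ liminf (fun k => leftDerivative (f k) (s k)) atTop := by
    intro α hα hαt
    have hα' : ENNReal.ofReal α < F t := (ENNReal.ofReal_lt_iff_lt_toReal hα.le ht).2 hαt
    have hlimk : Tendsto (fun k => ENNReal.ofReal
        (convexIncrement m α (f k q).toReal / (s k - q))) atTop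
        (𝓝 (ENNReal.ofReal (convexIncrement m α (F q).toReal / (t - q)))) := by
      refine ENNReal.tendsto_ofReal (Tendsto.div ?_ (hs.sub_const _) (by linarith))
      unfold convexIncrement
      exact ((tendsto_const_nhds.sub ((hb.pow m).div_const _)).div_const _)
    rw [← hlimk.liminf_eq]
    refine liminf_le_liminf ?_
    filter_upwards [eventually_lt_of_lt_leftLimitExtension (fun k => (hf k).monotone) hlim hs hα',
      hs.eventually_const_lt hq] with k hk1 hk2
    by_cases hkt : f k (s k) = ⊤
    · simp [leftDerivative, hkt]
    refine le_trans (ENNReal.ofReal_le_ofReal ?_) ((hf k).le_leftDerivative hm hk2 hkt)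
    have : 0 < s k - q := by linarith
    gcongr
    exact convexIncrement_mono_left hα ((ENNReal.ofReal_le_iff_le_toReal hkt).1 hk1.le)
      ENNReal.toReal_nonneg
  have hlimα : Tendsto (fun α : ℝ => ENNReal.ofReal (convexIncrement m α (F q).toReal / (t - q)))
      (𝓝[<] (F t).toReal)
      (𝓝 (ENNReal.ofReal (convexIncrement m (F t).toReal (F q).toReal / (t - q)))) := by
    refine ENNReal.tendsto_ofReal (Tendsto.div_const ?_ _)
    unfold convexIncrement
    have hid : Tendsto (fun α : ℝ => α) (𝓝[<] (F t).toReal) (𝓝 (F t).toReal) :=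
      tendsto_id.mono_left nhdsWithin_le_nhds
    exact (hid.sub (tendsto_const_nhds.div (hid.pow _) (pow_ne_zero _ h0.ne'))).div_const _
  refine le_of_tendsto hlimα ?_
  filter_upwards [Ioo_mem_nhdsLT h0] with α hα
  exact key α hα.1 hα.2

end LimitNonlinearity

/-! ### Testing stability with functions of the solution -/

section SoftPositivePart

/-- A smooth majorant of the positive part `(s - t)₊`, with slope in `[0, 1]`, that differs from it by at
most `ε`. -/
noncomputable def softPositivePart (t ε s : ℝ) : ℝ := ((s - t) + √((s - t) ^ 2 + ε ^ 2)) / 2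

variable {t ε : ℝ}

theorem abs_lt_sqrt_sq_add_sq (hε : 0 < ε) (y : ℝ) : |y| < √(y ^ 2 + ε ^ 2) := by
  rw [← Real.sqrt_sq_eq_abs]
  exact Real.sqrt_lt_sqrt (sq_nonneg y) (by nlinarith)

theorem sqrt_sq_add_sq_le (hε : 0 < ε) (y : ℝ) : √(y ^ 2 + ε ^ 2) ≤ |y| + ε := by
  rw [Real.sqrt_le_left (by positivity)]
  nlinarith [abs_nonneg y, sq_abs y]

theorem contDiff_softPositivePart (hε : 0 < ε) : ContDiff ℝ ∞ (softPositivePart t ε) := by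
  unfold softPositivePart
  have h1 : ContDiff ℝ ∞ fun s : ℝ => s - t := contDiff_id.sub contDiff_const
  exact (h1.add (((h1.pow 2).add contDiff_const).sqrt fun s =>
    (add_pos_of_nonneg_of_pos (sq_nonneg _) (pow_pos hε 2)).ne')).div_const _

theorem sub_le_softPositivePart (hε : 0 < ε) (s : ℝ) : s - t ≤ softPositivePart t ε s := by
  have h1 := abs_lt_sqrt_sq_add_sq hε (s - t)
  have h2 := le_abs_self (s - t)
  rw [softPositivePart]
  linarith

theorem softPositivePart_nonneg (hε : 0 < ε) (s : ℝ) : 0 ≤ softPositivePart t ε s := by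
  have h1 := abs_lt_sqrt_sq_add_sq hε (s - t)
  have h2 := neg_abs_le (s - t)
  rw [softPositivePart]
  linarith

theorem softPositivePart_le (hε : 0 < ε) (s : ℝ) : softPositivePart t ε s ≤ max (s - t) 0 + ε := by
  have h1 := sqrt_sq_add_sq_le hε (s - t)
  rw [softPositivePart]
  rcases le_total (s - t) 0 with h | h
  · rw [max_eq_right h]; rw [abs_of_nonpos h] at h1; linarith
  · rw [max_eq_left h]; rw [abs_of_nonneg h] at h1; linarith

theorem deriv_softPositivePart (hε : 0 < ε) (s : ℝ) :
    deriv (softPositivePart t ε) s = (1 + (s - t) / √((s - t) ^ 2 + ε ^ 2)) / 2 := by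
  have h1 : HasDerivAt (fun s : ℝ => s - t) 1 s := (hasDerivAt_id s).sub_const t
  have h2 := ((h1.pow 2).add_const (ε ^ 2)).sqrt
    (add_pos_of_nonneg_of_pos (sq_nonneg _) (pow_pos hε 2)).ne'
  have h3 : HasDerivAt (softPositivePart t ε) _ s := (h1.add h2).div_const 2
  rw [h3.deriv]
  simp only [Nat.cast_ofNat, Nat.add_one_sub_one, pow_one, mul_one]
  rw [mul_div_mul_left _ _ two_ne_zero]
  rfl

theorem deriv_softPositivePart_nonneg (hε : 0 < ε) (s : ℝ) :
    0 ≤ deriv (softPositivePart t ε) s := by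
  rw [deriv_softPositivePart hε]
  have h1 := abs_lt_sqrt_sq_add_sq hε (s - t)
  have h2 := neg_abs_le (s - t)
  have : -1 ≤ (s - t) / √((s - t) ^ 2 + ε ^ 2) := by
    rw [le_div_iff₀ (lt_of_le_of_lt (abs_nonneg _) h1)]; linarith
  linarith

theorem deriv_softPositivePart_le_one (hε : 0 < ε) (s : ℝ) :
    deriv (softPositivePart t ε) s ≤ 1 := by
  rw [deriv_softPositivePart hε]
  have h1 := abs_lt_sqrt_sq_add_sq hε (s - t)
  have h2 := le_abs_self (s - t)
  have : (s - t) / √((s - t) ^ 2 + ε ^ 2) ≤ 1 := by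
    rw [div_le_iff₀ (lt_of_le_of_lt (abs_nonneg _) h1)]; linarith
  linarith

theorem abs_deriv_softPositivePart_le_one (hε : 0 < ε) (s : ℝ) :
    |deriv (softPositivePart t ε) s| ≤ 1 := by
  rw [abs_of_nonneg (deriv_softPositivePart_nonneg hε s)]
  exact deriv_softPositivePart_le_one hε s

theorem deriv_softPositivePart_le (hε : 0 < ε) {c : ℝ} (hc : 0 < c) {s : ℝ} (hs : s ≤ t - c) :
    deriv (softPositivePart t ε) s ≤ (ε / c) ^ 2 := by
  rw [deriv_softPositivePart hε]
  set y := s - t with hy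
  have hyc : y ≤ -c := by linarith
  set R := √(y ^ 2 + ε ^ 2) with hR
  have hRsq : R ^ 2 = y ^ 2 + ε ^ 2 := Real.sq_sqrt (by positivity)
  have hRc : c ≤ R := by
    have h1 := abs_lt_sqrt_sq_add_sq hε y
    have h2 := neg_abs_le y
    linarith
  have hRpos : 0 < R := by linarith
  rw [div_pow, div_le_iff₀ two_pos, one_add_div hRpos.ne', div_mul_eq_mul_div,
    div_le_div_iff₀ hRpos (by positivity)]
  have h3 : (R + y) * (R - y) = ε ^ 2 := by nlinarith
  have h4 : c ^ 2 ≤ R * (R - y) := by nlinarith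
  have h5 : 0 ≤ R + y := by
    have h1 := abs_lt_sqrt_sq_add_sq hε y
    have h2 := neg_abs_le y
    linarith
  nlinarith [mul_le_mul_of_nonneg_left h4 h5, mul_pos hRpos (pow_pos hε 2)]

end SoftPositivePart

section Uniqueness

variable {N : ℕ}

theorem ae_restrict_of_forall_isCompact {Ω : Set (EuclideanSpace ℝ (Fin N))} (hΩ : IsOpen Ω)
    {p : EuclideanSpace ℝ (Fin N) → Prop}
    (h : ∀ K, IsCompact K → K ⊆ Ω → ∀ᵐ x ∂volume.restrict K, p x) :
    ∀ᵐ x ∂volume.restrict Ω, p x := by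
  obtain ⟨K, hKc, hKΩ, -, hKabs⟩ := hΩ.exists_absorbing_compacts
  have hcover : (⋃ n, K n) = Ω := by
    refine Set.Subset.antisymm (Set.iUnion_subset hKΩ) fun x hx => ?_
    obtain ⟨n, hn⟩ := hKabs {x} isCompact_singleton (by simpa using hx)
    exact Set.mem_iUnion.2 ⟨n, hn rfl⟩
  rw [← hcover, ae_restrict_iUnion_iff]
  exact fun n => h _ (hKc n) (hKΩ n)

/-- Weak gradients are unique up to null sets. -/
theorem IsWeakGradient.ae_eq {Ω : Set (EuclideanSpace ℝ (Fin N))} (hΩ : IsOpen Ω)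
    {u : EuclideanSpace ℝ (Fin N) → ℝ} {G G' : EuclideanSpace ℝ (Fin N) → EuclideanSpace ℝ (Fin N)}
    (h : IsWeakGradient Ω u G) (h' : IsWeakGradient Ω u G') : G =ᵐ[volume.restrict Ω] G' := by
  have hloc : MemLpLoc Ω 1 (G - G') := h.memLpLoc_grad.sub h'.memLpLoc_grad
  have hli : LocallyIntegrableOn (G - G') Ω volume := by
    rw [locallyIntegrableOn_iff hΩ.isLocallyClosed]
    exact fun K hKΩ hK => memLp_one_iff_integrable.1 (hloc K hK hKΩ)
  have h0 := hΩ.ae_eq_zero_of_integral_contDiff_smul_eq_zero hli fun φ hφ1 hφ2 hφ3 => by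
    have hφ : IsTestFunction Ω φ := ⟨hφ1, hφ2, hφ3⟩
    have hz : ∫ x, φ x • (G - G') x = ∫ x in Ω, φ x • (G - G') x := by
      rw [setIntegral_eq_integral_of_forall_compl_eq_zero fun x hx => by
        rw [image_eq_zero_of_notMem_tsupport fun h => hx (hφ3 h), zero_smul]]
    rw [hz]
    simp only [Pi.sub_apply, smul_sub]
    rw [integral_sub (hφ.integrableOn_smul hΩ h.memLpLoc_grad)
      (hφ.integrableOn_smul hΩ h'.memLpLoc_grad), sub_eq_zero]
    have h1 := h.integral_eq φ hφ
    have h2 := h'.integral_eq φ hφ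
    exact neg_inj.1 (h1.symm.trans h2)
  rw [EventuallyEq, ae_restrict_iff' hΩ.measurableSet]
  filter_upwards [h0] with x hx hxΩ
  exact sub_eq_zero.1 (hx hxΩ)

end Uniqueness

section StabilityTest

variable {N : ℕ}

theorem tendsto_eLpNorm_two_of_dominated {α F : Type*} [MeasurableSpace α] [NormedAddCommGroup F]
    {μ : Measure α} {f : ℕ → α → F} {b : α → ℝ} (hb : MemLp b 2 μ)
    (hm : ∀ n, AEStronglyMeasurable (f n) μ) (hle : ∀ n x, ‖f n x‖ ≤ b x)
    (hlim : ∀ᵐ x ∂μ, Tendsto (fun n => f n x) atTop (𝓝 0)) :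
    Tendsto (fun n => eLpNorm (f n) 2 μ) atTop (𝓝 0) := by
  have h1 : Tendsto (fun n => eLpNorm (f n) 2 μ ^ 2) atTop (𝓝 0) := by
    simp_rw [eLpNorm_two_sq]
    have h0 : ∫⁻ _x, (0 : ℝ≥0∞) ∂μ = 0 := by simp
    rw [← h0]
    refine tendsto_lintegral_of_dominated_convergence' (fun x => ‖b x‖ₑ ^ 2)
      (fun n => (hm n).enorm.pow_const 2) (fun n => Eventually.of_forall fun x => ?_) ?_ ?_
    · refine pow_le_pow_left' ?_ 2
      rw [← ofReal_norm, ← ofReal_norm]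
      exact ENNReal.ofReal_le_ofReal ((hle n x).trans (le_abs_self _))
    · rw [← eLpNorm_two_sq]
      have := hb.2.ne
      finiteness
    · filter_upwards [hlim] with x hx
      have := ((ENNReal.continuous_pow 2).tendsto _).comp hx.enorm
      simpa [Function.comp_def] using this
  have h2 := ((ENNReal.continuous_rpow_const (y := 1 / 2)).tendsto _).comp h1
  rw [ENNReal.zero_rpow_of_pos (by norm_num)] at h2
  refine h2.congr fun n => ?_
  rw [Function.comp_apply, ← ENNReal.rpow_natCast, ← ENNReal.rpow_mul]
  norm_num

/-- An upper bound for the `L^2` norm of the gradient of `ψ(u) η`, where `G` is the gradient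
of `u`. -/
noncomputable def compMulGradientBound (ψ : ℝ → ℝ) (η : EuclideanSpace ℝ (Fin N) → ℝ)
    (u : EuclideanSpace ℝ (Fin N) → ℝ) (G : EuclideanSpace ℝ (Fin N) → EuclideanSpace ℝ (Fin N)) :
    ℝ≥0∞ :=
  eLpNorm (fun x => ψ (u x) • gradient η x) 2 (volume.restrict (tsupport η)) +
    eLpNorm (fun x => (η x * deriv ψ (u x)) • G x) 2 (volume.restrict (tsupport η))

/-- Upper semicontinuity of `compMulGradientBound` under convergence in `W^{1,2}`. -/
theorem exists_compMulGradientBound_le {Ω : Set (EuclideanSpace ℝ (Fin N))}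
    {ψ : ℝ → ℝ} (hψ : ContDiff ℝ ∞ ψ) (hψ' : ∀ s, |deriv ψ s| ≤ 1)
    {η : EuclideanSpace ℝ (Fin N) → ℝ} (hη : IsTestFunction Ω η)
    {w : ℕ → EuclideanSpace ℝ (Fin N) → ℝ}
    {W : ℕ → EuclideanSpace ℝ (Fin N) → EuclideanSpace ℝ (Fin N)}
    {u : EuclideanSpace ℝ (Fin N) → ℝ} {G : EuclideanSpace ℝ (Fin N) → EuclideanSpace ℝ (Fin N)}
    (hw : ∀ n, AEStronglyMeasurable (w n) (volume.restrict (tsupport η)))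
    (hW : ∀ n, AEStronglyMeasurable (W n) (volume.restrict (tsupport η)))
    (hu : AEStronglyMeasurable u (volume.restrict (tsupport η)))
    (hG : MemLp G 2 (volume.restrict (tsupport η)))
    (h1 : Tendsto (fun n => eLpNorm (w n - u) 2 (volume.restrict (tsupport η))) atTop (𝓝 0))
    (h2 : Tendsto (fun n => eLpNorm (W n - G) 2 (volume.restrict (tsupport η))) atTop (𝓝 0))
    (h3 : ∀ᵐ x ∂volume.restrict (tsupport η), Tendsto (fun n => w n x) atTop (𝓝 (u x))) :
    ∃ e : ℕ → ℝ≥0∞, Tendsto e atTop (𝓝 0) ∧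
      ∀ n, compMulGradientBound ψ η (w n) (W n) ≤ compMulGradientBound ψ η u G + e n := by
  obtain ⟨M, hM0, hM1, hM2⟩ := hη.exists_bound
  set μ := volume.restrict (tsupport η) with hμ
  have hψc : Continuous ψ := hψ.continuous
  have hψ'c : Continuous (deriv ψ) := hψ.continuous_deriv (by simp)
  have hlip : ∀ a b, |ψ a - ψ b| ≤ |a - b| := by
    have : LipschitzWith 1 ψ := lipschitzWith_of_nnnorm_deriv_le (hψ.differentiable (by simp))
      fun s => by exact_mod_cast hψ' s
    intro a b
    have := this.dist_le_mul a b
    simpa [Real.dist_eq] using this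
  have hηm : AEStronglyMeasurable η μ := hη.continuous.aestronglyMeasurable
  have hgm : AEStronglyMeasurable (gradient η) μ := hη.continuous_gradient.aestronglyMeasurable
  set e3 : ℕ → ℝ≥0∞ := fun n =>
    eLpNorm (fun x => (η x * (deriv ψ (w n x) - deriv ψ (u x))) • G x) 2 μ with he3
  have l3 : Tendsto e3 atTop (𝓝 0) := by
    refine tendsto_eLpNorm_two_of_dominated (b := fun x => (M * 2) * ‖G x‖) (hG.norm.const_mul _)
      (fun n => (hηm.mul ((hψ'c.comp_aestronglyMeasurable (hw n)).sub
        (hψ'c.comp_aestronglyMeasurable hu))).smul hG.1) (fun n x => ?_) ?_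
    · rw [norm_smul, norm_mul]
      gcongr
      · exact hM1 x
      · refine (norm_sub_le _ _).trans ?_
        have a1 := hψ' (w n x)
        have a2 := hψ' (u x)
        rw [Real.norm_eq_abs, Real.norm_eq_abs]
        linarith
    · filter_upwards [h3] with x hx
      have : Tendsto (fun n => (η x * (deriv ψ (w n x) - deriv ψ (u x))) • G x) atTop
          (𝓝 ((η x * (deriv ψ (u x) - deriv ψ (u x))) • G x)) :=
        ((((hψ'c.tendsto _).comp hx).sub_const _).const_mul _).smul_const _
      simpa using this
  refine ⟨fun n => M.toNNReal • eLpNorm (w n - u) 2 μ +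
    (M.toNNReal • eLpNorm (W n - G) 2 μ + e3 n), ?_, fun n => ?_⟩
  · have a1 := ENNReal.Tendsto.const_mul (a := (M.toNNReal : ℝ≥0∞)) h1 (Or.inr ENNReal.coe_ne_top)
    have a2 := ENNReal.Tendsto.const_mul (a := (M.toNNReal : ℝ≥0∞)) h2 (Or.inr ENNReal.coe_ne_top)
    simpa [ENNReal.smul_def] using a1.add (a2.add l3)
  · have b1 : eLpNorm (fun x => ψ (w n x) • gradient η x) 2 μ ≤
        eLpNorm (fun x => ψ (u x) • gradient η x) 2 μ + M.toNNReal • eLpNorm (w n - u) 2 μ := by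
      have e : (fun x => ψ (w n x) • gradient η x) = (fun x => ψ (u x) • gradient η x) +
          fun x => (ψ (w n x) - ψ (u x)) • gradient η x := by
        funext x; simp [sub_smul]
      rw [e]
      refine (eLpNorm_add_le ((hψc.comp_aestronglyMeasurable hu).smul hgm)
        (((hψc.comp_aestronglyMeasurable (hw n)).sub (hψc.comp_aestronglyMeasurable hu)).smul hgm)
        (by norm_num)).trans (add_le_add le_rfl ?_)
      refine eLpNorm_le_nnreal_smul_eLpNorm_of_ae_le_mul (Eventually.of_forall fun x => ?_) 2
      rw [← NNReal.coe_le_coe]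
      simp only [NNReal.coe_mul, coe_nnnorm, Real.coe_toNNReal _ hM0, Pi.sub_apply, Pi.smul_apply',
        norm_smul, Real.norm_eq_abs]
      rw [mul_comm]
      exact mul_le_mul (hM2 x) (hlip _ _) (abs_nonneg _) hM0
    have b2 : eLpNorm (fun x => (η x * deriv ψ (w n x)) • W n x) 2 μ ≤
        eLpNorm (fun x => (η x * deriv ψ (u x)) • G x) 2 μ +
          (M.toNNReal • eLpNorm (W n - G) 2 μ + e3 n) := by
      have e : (fun x => (η x * deriv ψ (w n x)) • W n x) = (fun x => (η x * deriv ψ (u x)) • G x) +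
          ((fun x => (η x * deriv ψ (w n x)) • (W n - G) x) +
          fun x => (η x * (deriv ψ (w n x) - deriv ψ (u x))) • G x) := by
        funext x
        simp only [Pi.add_apply, Pi.sub_apply, smul_sub, mul_sub, sub_smul]
        abel
      have mw := hψ'c.comp_aestronglyMeasurable (hw n)
      have mu := hψ'c.comp_aestronglyMeasurable hu
      rw [e]
      refine (eLpNorm_add_le ((hηm.mul mu).smul hG.1)
        (((hηm.mul mw).smul ((hW n).sub hG.1)).add ((hηm.mul (mw.sub mu)).smul hG.1))
        (by norm_num)).trans (add_le_add le_rfl ?_)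
      refine (eLpNorm_add_le ((hηm.mul mw).smul ((hW n).sub hG.1)) ((hηm.mul (mw.sub mu)).smul hG.1)
        (by norm_num)).trans (add_le_add ?_ le_rfl)
      refine eLpNorm_le_nnreal_smul_eLpNorm_of_ae_le_mul (Eventually.of_forall fun x => ?_) 2
      rw [← NNReal.coe_le_coe]
      simp only [NNReal.coe_mul, coe_nnnorm, Real.coe_toNNReal _ hM0, Pi.smul_apply', Pi.mul_apply,
        norm_smul, norm_mul]
      gcongr
      calc ‖η x‖ * ‖deriv ψ (w n x)‖ ≤ M * 1 := by
            gcongr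
            · exact hM1 x
            · exact hψ' _
        _ = M := mul_one M
    calc _ ≤ _ := add_le_add b1 b2
      _ = _ := add_add_add_comm _ _ _ _

/-- The stability inequality may be tested with `ψ(u) η`, although `u` is not smooth: test with
`ψ(w n) η` for smooth `w n → u` and apply Fatou's lemma. -/
theorem lintegral_leftDerivative_comp_mul_le {Ω : Set (EuclideanSpace ℝ (Fin N))} (hΩ : IsOpen Ω)
    {u : EuclideanSpace ℝ (Fin N) → ℝ} {G : EuclideanSpace ℝ (Fin N) → EuclideanSpace ℝ (Fin N)}
    (hG : IsWeakGradient Ω u G) (hu2 : MemLpLoc Ω 2 u) (hG2 : MemLpLoc Ω 2 G)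
    {D : EuclideanSpace ℝ (Fin N) → ℝ≥0∞} (hD : LocIntegrableENNReal Ω D)
    (hstab : ∀ ξ : EuclideanSpace ℝ (Fin N) → ℝ, IsTestFunction Ω ξ →
      ∫⁻ x in Ω, D x * ENNReal.ofReal (ξ x ^ 2)
        ≤ ∫⁻ x in Ω, ENNReal.ofReal (‖gradient ξ x‖ ^ 2))
    {ψ : ℝ → ℝ} (hψ : ContDiff ℝ ∞ ψ) (hψ' : ∀ s, |deriv ψ s| ≤ 1)
    {η : EuclideanSpace ℝ (Fin N) → ℝ} (hη : IsTestFunction Ω η) :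
    ∫⁻ x in tsupport η, D x * ENNReal.ofReal ((ψ (u x) * η x) ^ 2)
      ≤ compMulGradientBound ψ η u G ^ 2 := by
  have hK : IsCompact (tsupport η) := hη.hasCompactSupport
  have hKΩ := hη.tsupport_subset
  obtain ⟨w, hw, h1, h2, h3⟩ := hG.exists_smooth_approx hΩ hu2 hG2 hK hKΩ
  obtain ⟨e, he, hle⟩ := exists_compMulGradientBound_le hψ hψ' hη
    (fun n => (hw n).continuous.aestronglyMeasurable)
    (fun n => (continuous_gradient (hw n)).aestronglyMeasurable) (hu2 _ hK hKΩ).1 (hG2 _ hK hKΩ)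
    h1 h2 h3
  have hn : ∀ n, ∫⁻ x in tsupport η, D x * ENNReal.ofReal ((ψ (w n x) * η x) ^ 2)
      ≤ (compMulGradientBound ψ η u G + e n) ^ 2 := by
    intro n
    have hξ := hη.comp_mul hψ (hw n)
    have hg0 : ∀ x, gradient (fun y => ψ (w n y) * η y) x
        = ψ (w n x) • gradient η x + (η x * deriv ψ (w n x)) • gradient (w n) x := fun x =>
      gradient_comp_mul (hψ.differentiable (by simp)) ((hw n).differentiable (by simp) x)
        (hη.contDiff.differentiable (by simp) x)
    calc _ ≤ ∫⁻ x in Ω, D x * ENNReal.ofReal ((ψ (w n x) * η x) ^ 2) :=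
          lintegral_mono_set hKΩ
      _ ≤ ∫⁻ x in Ω, ENNReal.ofReal (‖gradient (fun y => ψ (w n y) * η y) x‖ ^ 2) := hstab _ hξ
      _ = ∫⁻ x in tsupport η, ENNReal.ofReal (‖gradient (fun y => ψ (w n y) * η y) x‖ ^ 2) := by
          rw [← lintegral_indicator hΩ.measurableSet, ← lintegral_indicator hK.measurableSet]
          refine lintegral_congr fun x => ?_
          by_cases hx : x ∈ tsupport η
          · simp [hx, hKΩ hx]
          · have : gradient (fun y => ψ (w n y) * η y) x = 0 := by
              rw [hg0, hη.gradient_eq_zero hx, image_eq_zero_of_notMem_tsupport hx]; simp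
            by_cases hxΩ : x ∈ Ω <;> simp [hx, hxΩ, this]
      _ = eLpNorm (gradient (fun y => ψ (w n y) * η y)) 2 (volume.restrict (tsupport η)) ^ 2 := by
          rw [eLpNorm_two_sq]
          refine lintegral_congr fun x => ?_
          rw [ENNReal.ofReal_pow (norm_nonneg _), ofReal_norm]
      _ ≤ compMulGradientBound ψ η (w n) (gradient (w n)) ^ 2 := by
          gcongr
          have : gradient (fun y => ψ (w n y) * η y) = (fun x => ψ (w n x) • gradient η x) +
            fun x => (η x * deriv ψ (w n x)) • gradient (w n) x := by
            funext x; rw [hg0]; rfl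
          rw [this]
          have hψ'c : Continuous (deriv ψ) := hψ.continuous_deriv (by simp)
          refine eLpNorm_add_le (Continuous.aestronglyMeasurable ?_)
            (Continuous.aestronglyMeasurable ?_) (by norm_num)
          · exact (hψ.continuous.comp (hw n).continuous).smul hη.continuous_gradient
          · exact (hη.continuous.mul (hψ'c.comp (hw n).continuous)).smul
              (continuous_gradient (hw n))
      _ ≤ _ := by gcongr; exact hle n
  have hlim : Tendsto (fun n => (compMulGradientBound ψ η u G + e n) ^ 2) atTop
      (𝓝 (compMulGradientBound ψ η u G ^ 2)) := by
    have := ((ENNReal.continuous_pow 2).tendsto _).comp (he.const_add (compMulGradientBound ψ η u G))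
    simpa [Function.comp_def] using this
  calc ∫⁻ x in tsupport η, D x * ENNReal.ofReal ((ψ (u x) * η x) ^ 2)
      ≤ ∫⁻ x in tsupport η, liminf (fun n => D x * ENNReal.ofReal ((ψ (w n x) * η x) ^ 2)) atTop := by
        refine lintegral_mono_ae ?_
        have hDfin : ∀ᵐ x ∂volume.restrict (tsupport η), D x < ⊤ :=
          ae_lt_top' (hD _ hK hKΩ).1 (hD _ hK hKΩ).2.ne
        filter_upwards [h3, hDfin] with x hx hxD
        have h4 : Tendsto (fun n => (ψ (w n x) * η x) ^ 2) atTop (𝓝 ((ψ (u x) * η x) ^ 2)) :=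
          (((hψ.continuous.tendsto _).comp hx).mul_const _).pow 2
        exact (ENNReal.Tendsto.const_mul (ENNReal.tendsto_ofReal h4) (Or.inr hxD.ne)).liminf_eq.ge
    _ ≤ liminf (fun n => ∫⁻ x in tsupport η, D x * ENNReal.ofReal ((ψ (w n x) * η x) ^ 2)) atTop := by
        refine lintegral_liminf_le' fun n => (hD _ hK hKΩ).1.mul (Measurable.aemeasurable ?_)
        have := (hψ.continuous.comp (hw n).continuous).mul hη.continuous
        exact (this.pow 2).measurable.ennreal_ofReal
    _ ≤ liminf (fun n => (compMulGradientBound ψ η u G + e n) ^ 2) atTop :=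
        liminf_le_liminf (Eventually.of_forall hn)
    _ = _ := hlim.liminf_eq

end StabilityTest

/-! ### Passing to the limit -/

section LocIntegrable

theorem mul_le_liminf_mul {s : ℕ → ℝ≥0∞} {a b : ℝ≥0∞} (hb : b ≠ ⊤) (h : a ≤ liminf s atTop) :
    a * b ≤ liminf (fun k => s k * b) atTop := by
  calc a * b ≤ liminf s atTop * b := by gcongr
    _ = _ := by
      simpa [mul_comm] using (ENNReal.liminf_const_mul_of_ne_top (u := s) (f := atTop) hb).symm

variable {N : ℕ} {Ω : Set (EuclideanSpace ℝ (Fin N))}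

theorem LocIntegrableENNReal.ae_lt_top (hΩ : IsOpen Ω) {F : EuclideanSpace ℝ (Fin N) → ℝ≥0∞}
    (hF : LocIntegrableENNReal Ω F) : ∀ᵐ x ∂volume.restrict Ω, F x < ⊤ :=
  ae_restrict_of_forall_isCompact hΩ fun K hK hKΩ => ae_lt_top' (hF K hK hKΩ).1 (hF K hK hKΩ).2.ne

theorem LocIntegrableENNReal.memLpLoc_toReal {F : EuclideanSpace ℝ (Fin N) → ℝ≥0∞}
    (hF : LocIntegrableENNReal Ω F) : MemLpLoc Ω 1 (fun x => (F x).toReal) := fun K hK hKΩ =>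
  memLp_one_iff_integrable.2 (integrable_toReal_of_lintegral_ne_top (hF K hK hKΩ).1
    (hF K hK hKΩ).2.ne)

theorem IsTestFunction.integrableOn_mul (hΩ : IsOpen Ω) {φ : EuclideanSpace ℝ (Fin N) → ℝ}
    (hφ : IsTestFunction Ω φ) {g : EuclideanSpace ℝ (Fin N) → ℝ} (hg : MemLpLoc Ω 1 g) :
    IntegrableOn (fun x => g x * φ x) Ω volume := by
  simpa [mul_comm] using hφ.integrableOn_smul hΩ hg

theorem LocIntegrableENNReal.ofReal_integral_toReal_mul (hΩ : IsOpen Ω)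
    {F : EuclideanSpace ℝ (Fin N) → ℝ≥0∞} (hF : LocIntegrableENNReal Ω F)
    {φ : EuclideanSpace ℝ (Fin N) → ℝ} (hφ : IsTestFunction Ω φ) (hφ0 : ∀ x, 0 ≤ φ x) :
    ENNReal.ofReal (∫ x in Ω, (F x).toReal * φ x) = ∫⁻ x in Ω, F x * ENNReal.ofReal (φ x) := by
  rw [ofReal_integral_eq_lintegral_ofReal (hφ.integrableOn_mul hΩ hF.memLpLoc_toReal)
    (Eventually.of_forall fun x => mul_nonneg ENNReal.toReal_nonneg (hφ0 x))]
  refine lintegral_congr_ae ?_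
  filter_upwards [hF.ae_lt_top hΩ] with x hx
  rw [ENNReal.ofReal_mul ENNReal.toReal_nonneg, ENNReal.ofReal_toReal hx.ne]

theorem setLIntegral_eq_tsupport (hΩ : IsOpen Ω) {φ : EuclideanSpace ℝ (Fin N) → ℝ}
    (hφ : IsTestFunction Ω φ) {f : EuclideanSpace ℝ (Fin N) → ℝ≥0∞}
    (hf : ∀ x, x ∉ tsupport φ → f x = 0) : ∫⁻ x in Ω, f x = ∫⁻ x in tsupport φ, f x := by
  rw [← lintegral_indicator hΩ.measurableSet,
    ← lintegral_indicator hφ.hasCompactSupport.measurableSet]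
  refine lintegral_congr fun x => ?_
  by_cases hx : x ∈ tsupport φ
  · simp [hx, hφ.tsupport_subset hx]
  · by_cases hxΩ : x ∈ Ω <;> simp [hx, hxΩ, hf x hx]

theorem IsTestFunction.lintegral_norm_gradient_sq_lt_top (hΩ : IsOpen Ω)
    {φ : EuclideanSpace ℝ (Fin N) → ℝ}
    (hφ : IsTestFunction Ω φ) : ∫⁻ x in Ω, ENNReal.ofReal (‖gradient φ x‖ ^ 2) < ⊤ := by
  obtain ⟨M, hM0, hM1, hM2⟩ := hφ.exists_bound
  rw [setLIntegral_eq_tsupport hΩ hφ fun x hx => by simp [hφ.gradient_eq_zero hx]]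
  refine setLIntegral_lt_top_of_le_nnreal hφ.hasCompactSupport.measure_lt_top.ne
    ⟨(M ^ 2).toNNReal, fun x _ => ?_⟩
  exact ENNReal.ofReal_le_ofReal (pow_le_pow_left₀ (norm_nonneg _) (hM2 x) 2)

theorem lintegral_le_lintegral_mul_of_eq_one {K : Set (EuclideanSpace ℝ (Fin N))}
    (hK : IsCompact K) (hKΩ : K ⊆ Ω) {η : EuclideanSpace ℝ (Fin N) → ℝ}
    (hη : ∀ x ∈ K, η x = 1) (F : EuclideanSpace ℝ (Fin N) → ℝ≥0∞) :
    ∫⁻ x in K, F x ≤ ∫⁻ x in Ω, F x * ENNReal.ofReal (η x) :=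
  (setLIntegral_mono_ae' hK.measurableSet (Eventually.of_forall fun x hx => by
    simp [hη x hx])).trans (lintegral_mono_set hKΩ)

end LocIntegrable

section Limit

variable {N : ℕ}

/-- Stable solutions `u k` of `-Δu = f k (u)` with gradients `G k` that converge in
`W^{1,2}_loc` and almost everywhere to `v`, with gradient `H`, while `f k → h` on `ℚ`. -/
structure IsStableLimit (m : ℕ) (Ω : Set (EuclideanSpace ℝ (Fin N))) (f : ℕ → ℝ → ℝ≥0∞)
    (u : ℕ → EuclideanSpace ℝ (Fin N) → ℝ)
    (G : ℕ → EuclideanSpace ℝ (Fin N) → EuclideanSpace ℝ (Fin N)) (h : ℚ → ℝ≥0∞)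
    (v : EuclideanSpace ℝ (Fin N) → ℝ) (H : EuclideanSpace ℝ (Fin N) → EuclideanSpace ℝ (Fin N)) :
    Prop where
  isMConvexNonlinearity : ∀ k, IsMConvexNonlinearity m (f k)
  isPoissonSolution : ∀ k, IsPoissonSolution Ω (u k) (G k) fun x => (f k (u k x)).toReal
  locIntegrable : ∀ k, LocIntegrableENNReal Ω fun x => f k (u k x)
  locIntegrable_leftDerivative : ∀ k, LocIntegrableENNReal Ω fun x => leftDerivative (f k) (u k x)
  stable : ∀ k, ∀ ξ : EuclideanSpace ℝ (Fin N) → ℝ, IsTestFunction Ω ξ →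
    ∫⁻ x in Ω, leftDerivative (f k) (u k x) * ENNReal.ofReal (ξ x ^ 2)
      ≤ ∫⁻ x in Ω, ENNReal.ofReal (‖gradient ξ x‖ ^ 2)
  bounded : ∀ K, IsCompact K → K ⊆ Ω → ∃ C : ℝ≥0, ∀ k, eLpNorm (G k) 2 (volume.restrict K) ≤ C
  isWeakGradient : IsWeakGradient Ω v H
  memLpLoc_fun : MemLpLoc Ω 2 v
  memLpLoc_grad : MemLpLoc Ω 2 H
  tendsto_fun : ∀ K, IsCompact K → K ⊆ Ω →
    Tendsto (fun k => eLpNorm (u k - v) 2 (volume.restrict K)) atTop (𝓝 0)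
  tendsto_grad : ∀ K, IsCompact K → K ⊆ Ω →
    Tendsto (fun k => eLpNorm (G k - H) 2 (volume.restrict K)) atTop (𝓝 0)
  ae_tendsto_fun : ∀ᵐ x ∂volume.restrict Ω, Tendsto (fun k => u k x) atTop (𝓝 (v x))
  ae_tendsto_grad : ∀ᵐ x ∂volume.restrict Ω, Tendsto (fun k => G k x) atTop (𝓝 (H x))
  tendsto_rat : ∀ q : ℚ, Tendsto (fun k => f k q) atTop (𝓝 (h q))

namespace IsStableLimit

variable {m : ℕ} {Ω : Set (EuclideanSpace ℝ (Fin N))} {f : ℕ → ℝ → ℝ≥0∞}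
  {u : ℕ → EuclideanSpace ℝ (Fin N) → ℝ}
  {G : ℕ → EuclideanSpace ℝ (Fin N) → EuclideanSpace ℝ (Fin N)} {h : ℚ → ℝ≥0∞}
  {v : EuclideanSpace ℝ (Fin N) → ℝ} {H : EuclideanSpace ℝ (Fin N) → EuclideanSpace ℝ (Fin N)}

theorem ofReal_flux (hΩ : IsOpen Ω) (hL : IsStableLimit m Ω f u G h v H)
    {φ : EuclideanSpace ℝ (Fin N) → ℝ} (hφ : IsTestFunction Ω φ) (hφ0 : ∀ x, 0 ≤ φ x) (k : ℕ) :
    ENNReal.ofReal (∫ x in Ω, inner ℝ (G k x) (gradient φ x))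
      = ∫⁻ x in Ω, f k (u k x) * ENNReal.ofReal (φ x) := by
  rw [(hL.isPoissonSolution k).integral_eq φ hφ, (hL.locIntegrable k).ofReal_integral_toReal_mul hΩ hφ hφ0]

theorem tendsto_flux (hΩ : IsOpen Ω) (hL : IsStableLimit m Ω f u G h v H)
    {φ : EuclideanSpace ℝ (Fin N) → ℝ} (hφ : IsTestFunction Ω φ) :
    Tendsto (fun k => ∫ x in Ω, inner ℝ (G k x) (gradient φ x)) atTop
      (𝓝 (∫ x in Ω, inner ℝ (H x) (gradient φ x))) := by
  obtain ⟨M, hM0, hM1, hM2⟩ := hφ.exists_bound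
  have hK : IsCompact (tsupport φ) := hφ.hasCompactSupport
  refine tendsto_setIntegral_of_tendsto_eLpNorm_two hΩ hφ (M := M.toNNReal)
    (fun k => (hL.isPoissonSolution k).memLpLoc_grad _ hK hφ.tsupport_subset)
    (hL.memLpLoc_grad _ hK hφ.tsupport_subset) (hL.tendsto_grad _ hK hφ.tsupport_subset)
    (fun k => hφ.integrableOn_inner_gradient hΩ (hL.isPoissonSolution k).isWeakGradient.memLpLoc_grad)
    (hφ.integrableOn_inner_gradient hΩ hL.isWeakGradient.memLpLoc_grad) (fun k x => ?_)
    (fun k x hx => by rw [hφ.gradient_eq_zero hx, inner_zero_right])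
    (fun x hx => by rw [hφ.gradient_eq_zero hx, inner_zero_right])
  rw [← inner_sub_left, Real.coe_toNNReal _ hM0, mul_comm]
  exact (norm_inner_le_norm _ _).trans (by gcongr; exact hM2 x)

theorem flux_nonneg (hΩ : IsOpen Ω) (hL : IsStableLimit m Ω f u G h v H)
    {φ : EuclideanSpace ℝ (Fin N) → ℝ} (hφ : IsTestFunction Ω φ) (hφ0 : ∀ x, 0 ≤ φ x) :
    0 ≤ ∫ x in Ω, inner ℝ (H x) (gradient φ x) := by
  refine ge_of_tendsto' (hL.tendsto_flux hΩ hφ) fun k => ?_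
  rw [(hL.isPoissonSolution k).integral_eq φ hφ]
  exact integral_nonneg fun x => mul_nonneg ENNReal.toReal_nonneg (hφ0 x)

theorem isMConvexNonlinearity_limit (hm : 1 ≤ m) (hL : IsStableLimit m Ω f u G h v H) :
    IsMConvexNonlinearity m (leftLimitExtension h) :=
  isMConvexNonlinearity_leftLimitExtension hm hL.isMConvexNonlinearity hL.tendsto_rat

/-- Half of the limit equation, by Fatou's lemma. -/
theorem lintegral_limit_mul_le (hΩ : IsOpen Ω) (hL : IsStableLimit m Ω f u G h v H)
    {φ : EuclideanSpace ℝ (Fin N) → ℝ} (hφ : IsTestFunction Ω φ) (hφ0 : ∀ x, 0 ≤ φ x) :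
    ∫⁻ x in Ω, leftLimitExtension h (v x) * ENNReal.ofReal (φ x)
      ≤ ENNReal.ofReal (∫ x in Ω, inner ℝ (H x) (gradient φ x)) := by
  have hK : IsCompact (tsupport φ) := hφ.hasCompactSupport
  have hz : ∀ g : EuclideanSpace ℝ (Fin N) → ℝ≥0∞, ∀ x, x ∉ tsupport φ →
      g x * ENNReal.ofReal (φ x) = 0 := fun g x hx => by
    simp [image_eq_zero_of_notMem_tsupport hx]
  have hae := ae_restrict_of_ae_restrict_of_subset hφ.tsupport_subset hL.ae_tendsto_fun
  rw [setLIntegral_eq_tsupport hΩ hφ (hz _)]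
  calc ∫⁻ x in tsupport φ, leftLimitExtension h (v x) * ENNReal.ofReal (φ x)
      ≤ ∫⁻ x in tsupport φ, liminf (fun k => f k (u k x) * ENNReal.ofReal (φ x)) atTop := by
        refine lintegral_mono_ae ?_
        filter_upwards [hae] with x hx
        exact mul_le_liminf_mul ENNReal.ofReal_ne_top (leftLimitExtension_le_liminf
          (fun k => (hL.isMConvexNonlinearity k).monotone) hL.tendsto_rat hx)
    _ ≤ liminf (fun k => ∫⁻ x in tsupport φ, f k (u k x) * ENNReal.ofReal (φ x)) atTop :=
        lintegral_liminf_le' fun k => ((hL.locIntegrable k) _ hK hφ.tsupport_subset).1.mul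
          hφ.continuous.measurable.ennreal_ofReal.aemeasurable
    _ = liminf (fun k => ENNReal.ofReal (∫ x in Ω, inner ℝ (G k x) (gradient φ x))) atTop := by
        simp_rw [hL.ofReal_flux hΩ hφ hφ0]
        congr 1
        funext k
        rw [setLIntegral_eq_tsupport hΩ hφ (hz _)]
    _ = _ := (ENNReal.tendsto_ofReal (hL.tendsto_flux hΩ hφ)).liminf_eq

theorem locIntegrable_limit (hΩ : IsOpen Ω) (hL : IsStableLimit m Ω f u G h v H) :
    LocIntegrableENNReal Ω fun x => leftLimitExtension h (v x) := by
  intro K hK hKΩ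
  refine ⟨monotone_leftLimitExtension.measurable.comp_aemeasurable
    (hL.memLpLoc_fun K hK hKΩ).1.aemeasurable, ?_⟩
  obtain ⟨η, hη, hη0, -, hηK⟩ := exists_cutoff hΩ hK hKΩ
  exact ((lintegral_le_lintegral_mul_of_eq_one hK hKΩ hηK _).trans
    (hL.lintegral_limit_mul_le hΩ hη hη0)).trans_lt ENNReal.ofReal_lt_top

/-- The stability inequality passes to the limit, by Fatou's lemma. -/
theorem stable_limit (hΩ : IsOpen Ω) (hm : 1 ≤ m) (hL : IsStableLimit m Ω f u G h v H)
    {ξ : EuclideanSpace ℝ (Fin N) → ℝ} (hξ : IsTestFunction Ω ξ) :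
    ∫⁻ x in Ω, leftDerivative (leftLimitExtension h) (v x) * ENNReal.ofReal (ξ x ^ 2)
      ≤ ∫⁻ x in Ω, ENNReal.ofReal (‖gradient ξ x‖ ^ 2) := by
  have hK : IsCompact (tsupport ξ) := hξ.hasCompactSupport
  have hz : ∀ g : EuclideanSpace ℝ (Fin N) → ℝ≥0∞, ∀ x, x ∉ tsupport ξ →
      g x * ENNReal.ofReal (ξ x ^ 2) = 0 := fun g x hx => by
    simp [image_eq_zero_of_notMem_tsupport hx]
  have hae := ae_restrict_of_ae_restrict_of_subset hξ.tsupport_subset hL.ae_tendsto_fun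
  have hsq : AEMeasurable (fun x => ENNReal.ofReal (ξ x ^ 2)) (volume.restrict (tsupport ξ)) :=
    (hξ.continuous.measurable.pow_const 2).ennreal_ofReal.aemeasurable
  have hfin := ae_restrict_of_ae_restrict_of_subset hξ.tsupport_subset
    ((hL.locIntegrable_limit hΩ).ae_lt_top hΩ)
  rw [setLIntegral_eq_tsupport hΩ hξ (hz _)]
  calc ∫⁻ x in tsupport ξ, leftDerivative (leftLimitExtension h) (v x) * ENNReal.ofReal (ξ x ^ 2)
      ≤ ∫⁻ x in tsupport ξ,
          liminf (fun k => leftDerivative (f k) (u k x) * ENNReal.ofReal (ξ x ^ 2)) atTop := by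
        refine lintegral_mono_ae ?_
        filter_upwards [hae, hfin] with x hx hx'
        exact mul_le_liminf_mul ENNReal.ofReal_ne_top (leftDerivative_leftLimitExtension_le_liminf
          hm hL.isMConvexNonlinearity hL.tendsto_rat hx hx'.ne)
    _ ≤ liminf (fun k => ∫⁻ x in tsupport ξ,
          leftDerivative (f k) (u k x) * ENNReal.ofReal (ξ x ^ 2)) atTop :=
        lintegral_liminf_le' fun k => ((hL.locIntegrable_leftDerivative k) _ hK
          hξ.tsupport_subset).1.mul hsq
    _ ≤ _ := by
        refine liminf_le_of_le (by isBoundedDefault) fun b hb => ?_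
        obtain ⟨k, hk⟩ := hb.exists
        refine hk.trans ?_
        rw [← setLIntegral_eq_tsupport hΩ hξ (hz _)]
        exact hL.stable k ξ hξ

theorem locIntegrable_leftDerivative_limit (hΩ : IsOpen Ω) (hm : 1 ≤ m)
    (hL : IsStableLimit m Ω f u G h v H) :
    LocIntegrableENNReal Ω fun x => leftDerivative (leftLimitExtension h) (v x) := by
  intro K hK hKΩ
  refine ⟨((hL.isMConvexNonlinearity_limit hm).measurable_leftDerivative hm).comp_aemeasurable
    (hL.memLpLoc_fun K hK hKΩ).1.aemeasurable, ?_⟩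
  obtain ⟨η, hη, -, -, hηK⟩ := exists_cutoff hΩ hK hKΩ
  exact ((lintegral_le_lintegral_mul_of_eq_one hK hKΩ (η := fun x => η x ^ 2)
    (fun x hx => by simp [hηK x hx]) _).trans
    (hL.stable_limit hΩ hm hη)).trans_lt (hη.lintegral_norm_gradient_sq_lt_top hΩ)

/-- The gradient of the limit vanishes on level sets. The truncations `T` of slope one at height
`c` and of size `O(ε)` give `∫ T'(u k) |∇u k|² = O(ε)`, uniformly in `k`. -/
theorem ae_gradient_eq_zero_of_eq (hΩ : IsOpen Ω) (hL : IsStableLimit m Ω f u G h v H) (c : ℝ) :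
    ∀ᵐ x ∂volume.restrict Ω, v x = c → H x = 0 := by
  refine ae_restrict_of_forall_isCompact hΩ fun K hK hKΩ => ?_
  obtain ⟨η, hη, hη0, -, hηK⟩ := exists_cutoff hΩ hK hKΩ
  have hKη : K ⊆ tsupport η := fun x hx => subset_tsupport η (by simp [hηK x hx])
  obtain ⟨C, hC0, hC⟩ := exists_bound_rhs_and_flux hΩ hL.isPoissonSolution
    (fun k x => ENNReal.toReal_nonneg) hL.bounded hη hη0
  have hfun := ae_restrict_of_ae_restrict_of_subset hKΩ hL.ae_tendsto_fun
  have hgrad := ae_restrict_of_ae_restrict_of_subset hKΩ hL.ae_tendsto_grad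
  have hk : ∀ ε > 0, ∀ k, ∫⁻ x in K,
      ENNReal.ofReal (deriv (arctanTruncation c ε) (u k x) * ‖G k x‖ ^ 2)
        ≤ ENNReal.ofReal (4 * C * ε) := by
    intro ε hε k
    have hT := contDiff_arctanTruncation c ε
    have hA := abs_arctanTruncation_le c hε
    have hB := abs_deriv_arctanTruncation_le c hε
    have h0 : ∀ x, 0 ≤ η x * deriv (arctanTruncation c ε) (u k x) * ‖G k x‖ ^ 2 := fun x =>
      mul_nonneg (mul_nonneg (hη0 x) (deriv_arctanTruncation_nonneg c hε _)) (sq_nonneg _)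
    have h1 := (hL.isPoissonSolution k).integral_deriv_mul_sq_le hΩ hT hA hB hη
    obtain ⟨h2, -⟩ := (hL.isPoissonSolution k).integral_comp_mul hΩ hT hA hB hη
    calc _ ≤ ∫⁻ x in K, ENNReal.ofReal (η x * deriv (arctanTruncation c ε) (u k x) * ‖G k x‖ ^ 2) :=
          setLIntegral_mono_ae' hK.measurableSet (Eventually.of_forall fun x hx => by
            rw [hηK x hx, one_mul])
      _ ≤ ∫⁻ x in tsupport η,
            ENNReal.ofReal (η x * deriv (arctanTruncation c ε) (u k x) * ‖G k x‖ ^ 2) :=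
          lintegral_mono_set hKη
      _ = ENNReal.ofReal (∫ x in tsupport η,
            η x * deriv (arctanTruncation c ε) (u k x) * ‖G k x‖ ^ 2) :=
          (ofReal_integral_eq_lintegral_ofReal h2 (Eventually.of_forall h0)).symm
      _ ≤ _ := by
          refine ENNReal.ofReal_le_ofReal (h1.trans ?_)
          calc _ ≤ 2 * ε * (C + C) := by
                gcongr
                · exact (hC k).1
                · exact (hC k).2
            _ = 4 * C * ε := by ring
  have hlim : ∀ ε > 0, ∫⁻ x in K,
      ENNReal.ofReal (deriv (arctanTruncation c ε) (v x) * ‖H x‖ ^ 2)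
        ≤ ENNReal.ofReal (4 * C * ε) := by
    intro ε hε
    have hd : Continuous (deriv (arctanTruncation c ε)) :=
      (contDiff_arctanTruncation c ε).continuous_deriv (by simp)
    calc _ ≤ ∫⁻ x in K, liminf (fun k =>
          ENNReal.ofReal (deriv (arctanTruncation c ε) (u k x) * ‖G k x‖ ^ 2)) atTop := by
          refine lintegral_mono_ae ?_
          filter_upwards [hfun, hgrad] with x hx hx'
          exact (ENNReal.tendsto_ofReal (((hd.tendsto _).comp hx).mul
            (hx'.norm.pow 2))).liminf_eq.ge
      _ ≤ liminf (fun k => ∫⁻ x in K,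
            ENNReal.ofReal (deriv (arctanTruncation c ε) (u k x) * ‖G k x‖ ^ 2)) atTop := by
          refine lintegral_liminf_le' fun k => AEMeasurable.ennreal_ofReal ?_
          have a1 := ((hL.isPoissonSolution k).memLpLoc_fun K hK hKΩ).1.aemeasurable
          have a2 := ((hL.isPoissonSolution k).memLpLoc_grad K hK hKΩ).1.norm.aemeasurable
          exact (hd.measurable.comp_aemeasurable a1).mul (a2.pow_const 2)
      _ ≤ _ := by
          refine liminf_le_of_le (by isBoundedDefault) fun b hb => ?_
          obtain ⟨k, hk'⟩ := hb.exists
          exact hk'.trans (hk ε hε k)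
  set χ : ℝ → ℝ≥0∞ := Set.indicator {c} 1 with hχ
  have hχm : Measurable χ := measurable_one.indicator (measurableSet_singleton c)
  have hzero : ∫⁻ x in K, χ (v x) * ENNReal.ofReal (‖H x‖ ^ 2) = 0 := by
    refine le_antisymm ?_ zero_le
    have hle : ∀ ε > 0, ∫⁻ x in K, χ (v x) * ENNReal.ofReal (‖H x‖ ^ 2)
        ≤ ENNReal.ofReal (4 * C * ε) := by
      intro ε hε
      refine (lintegral_mono fun x => ?_).trans (hlim ε hε)
      by_cases hx : v x = c
      · simp [hχ, hx, deriv_arctanTruncation c hε]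
      · simp [hχ, hx]
    have ht : Tendsto (fun ε : ℝ => ENNReal.ofReal (4 * C * ε)) (𝓝[>] 0) (𝓝 0) := by
      have : Tendsto (fun ε : ℝ => 4 * C * ε) (𝓝 0) (𝓝 (4 * C * 0)) := tendsto_id.const_mul _
      simpa using ENNReal.tendsto_ofReal (this.mono_left nhdsWithin_le_nhds)
    exact ge_of_tendsto ht (eventually_mem_nhdsWithin.mono fun ε hε => hle ε hε)
  have hmeas : AEMeasurable (fun x => χ (v x) * ENNReal.ofReal (‖H x‖ ^ 2)) (volume.restrict K) :=
    (hχm.comp_aemeasurable (hL.memLpLoc_fun K hK hKΩ).1.aemeasurable).mul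
      ((hL.memLpLoc_grad K hK hKΩ).1.norm.aemeasurable.pow_const 2).ennreal_ofReal
  rw [lintegral_eq_zero_iff' hmeas] at hzero
  filter_upwards [hzero] with x hx hxc
  have : ENNReal.ofReal (‖H x‖ ^ 2) = 0 := by simpa [hχ, hxc] using hx
  have h2 : ‖H x‖ ^ 2 ≤ 0 := ENNReal.ofReal_eq_zero.1 this
  exact norm_eq_zero.1 (pow_eq_zero_iff two_ne_zero |>.1 (le_antisymm h2 (sq_nonneg _)))

end IsStableLimit

end Limit

/-! ### No loss of mass at the end of the half-line of finiteness -/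

section TruncationLevels

/-- Levels `t j` in the interior of the half-line on which `F` is finite that tend to its end. A point of
the half-line is eventually below the levels by a margin, unless it is the end point `c₀`. -/
theorem exists_truncation_levels {F : ℝ → ℝ≥0∞} (hF : ∃ s, F s ≠ ⊤) :
    ∃ (t : ℕ → ℝ) (c₀ : ℝ), (∀ j, t 0 ≤ t j) ∧ (∀ j, ∃ t', t j < t' ∧ F t' ≠ ⊤) ∧
      ∀ s, F s ≠ ⊤ → (∃ c > 0, ∀ᶠ j in atTop, s ≤ t j - c) ∨ (s = c₀ ∧ Tendsto t atTop (𝓝 c₀)) := by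
  set D := {s | F s ≠ ⊤} with hD
  have hne : D.Nonempty := hF
  by_cases hb : BddAbove D
  · have hlim : Tendsto (fun j : ℕ => sSup D - 1 / ((j : ℝ) + 1)) atTop (𝓝 (sSup D)) := by
      simpa using tendsto_one_div_add_atTop_nhds_zero_nat.const_sub (sSup D)
    refine ⟨fun j => sSup D - 1 / ((j : ℝ) + 1), sSup D, fun j => ?_, fun j => ?_, fun s hs => ?_⟩
    · have : 1 / ((j : ℝ) + 1) ≤ 1 := by
        rw [div_le_one (by positivity)]; linarith [(Nat.cast_nonneg j : (0 : ℝ) ≤ j)]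
      norm_num
      norm_num at this
      linarith
    · have : 0 < 1 / ((j : ℝ) + 1) := by positivity
      obtain ⟨t', ht', h⟩ := exists_lt_of_lt_csSup hne
        (show sSup D - 1 / ((j : ℝ) + 1) < sSup D by linarith)
      exact ⟨t', h, ht'⟩
    · rcases (le_csSup hb hs).eq_or_lt with h | h
      · exact Or.inr ⟨h, hlim⟩
      · refine Or.inl ⟨(sSup D - s) / 2, by linarith, ?_⟩
        filter_upwards [hlim.eventually_const_lt (show (s + sSup D) / 2 < sSup D by linarith)]
          with j hj
        linarith
  · rw [not_bddAbove_iff] at hb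
    refine ⟨fun j => (j : ℝ), 0, fun j => by simp, fun j => ?_, fun s _ => Or.inl ⟨1, one_pos, ?_⟩⟩
    · obtain ⟨t', ht', h⟩ := hb j
      exact ⟨t', h, ht'⟩
    · filter_upwards [tendsto_natCast_atTop_atTop.eventually_ge_atTop (s + 1)] with j hj
      linarith

end TruncationLevels

section LimitEquation

variable {N : ℕ}

namespace IsStableLimit

variable {m : ℕ} {Ω : Set (EuclideanSpace ℝ (Fin N))} {f : ℕ → ℝ → ℝ≥0∞}
  {u : ℕ → EuclideanSpace ℝ (Fin N) → ℝ}
  {G : ℕ → EuclideanSpace ℝ (Fin N) → EuclideanSpace ℝ (Fin N)} {h : ℚ → ℝ≥0∞}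
  {v : EuclideanSpace ℝ (Fin N) → ℝ} {H : EuclideanSpace ℝ (Fin N) → EuclideanSpace ℝ (Fin N)}

/-- Below a level `t` in the interior of the half-line of finiteness, `f k (u k)` is bounded and
converges. -/
theorem tendsto_lintegral_min (hm : 1 ≤ m) (hL : IsStableLimit m Ω f u G h v H)
    {η : EuclideanSpace ℝ (Fin N) → ℝ} (hη : IsTestFunction Ω η) {t t' : ℝ} (htt' : t < t')
    (ht' : leftLimitExtension h t' ≠ ⊤) :
    Tendsto (fun k => ∫⁻ x in tsupport η, f k (min (u k x) t) * ENNReal.ofReal (η x ^ 2)) atTop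
      (𝓝 (∫⁻ x in tsupport η, leftLimitExtension h (min (v x) t) * ENNReal.ofReal (η x ^ 2))) := by
  have hK : IsCompact (tsupport η) := hη.hasCompactSupport
  obtain ⟨M, hM0, hM1, hM2⟩ := hη.exists_bound
  have hsq : AEMeasurable (fun x => ENNReal.ofReal (η x ^ 2)) (volume.restrict (tsupport η)) :=
    (hη.continuous.measurable.pow_const 2).ennreal_ofReal.aemeasurable
  have hae := ae_restrict_of_ae_restrict_of_subset hη.tsupport_subset hL.ae_tendsto_fun
  have ht : leftLimitExtension h t ≠ ⊤ :=
    ((monotone_leftLimitExtension htt'.le).trans_lt ht'.lt_top).ne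
  have hev : ∀ᶠ k in atTop, f k t ≤ leftLimitExtension h t + 1 :=
    (eventually_lt_of_leftLimitExtension_lt hm hL.isMConvexNonlinearity hL.tendsto_rat
      tendsto_const_nhds htt' ht' (ENNReal.lt_add_right ht one_ne_zero)).mono fun _ hk => hk.le
  refine tendsto_lintegral_filter_of_dominated_convergence'
    (fun _ => (leftLimitExtension h t + 1) * ENNReal.ofReal (M ^ 2)) ?_ ?_ ?_ ?_
  · refine Eventually.of_forall fun k => AEMeasurable.mul ?_ hsq
    exact (hL.isMConvexNonlinearity k).monotone.measurable.comp_aemeasurable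
      (((hL.isPoissonSolution k).memLpLoc_fun _ hK hη.tsupport_subset).1.aemeasurable.min
        aemeasurable_const)
  · filter_upwards [hev] with k hk
    refine Eventually.of_forall fun x => mul_le_mul' ?_ (ENNReal.ofReal_le_ofReal ?_)
    · exact ((hL.isMConvexNonlinearity k).monotone (min_le_right _ _)).trans hk
    · exact sq_le_sq.2 ((hM1 x).trans (le_abs_self _))
  · rw [lintegral_const, Measure.restrict_apply_univ]
    have := hK.measure_lt_top (μ := volume).ne
    finiteness
  · filter_upwards [hae] with x hx
    refine ENNReal.Tendsto.mul_const ?_ (Or.inr ENNReal.ofReal_ne_top)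
    refine tendsto_of_leftLimitExtension_ne_top hm hL.isMConvexNonlinearity hL.tendsto_rat
      (hx.min tendsto_const_nhds) ((min_le_right _ _).trans_lt htt') ht'

/-- Stability controls the part of `f k (u k)` above a level `t`, since by convexity it is at most
`m (u k - t)₊` times the left derivative. -/
theorem ofReal_flux_sq_le_add (hΩ : IsOpen Ω) (hm : 1 ≤ m) (hL : IsStableLimit m Ω f u G h v H)
    {η : EuclideanSpace ℝ (Fin N) → ℝ} (hη : IsTestFunction Ω η)
    (hη2 : IsTestFunction Ω fun x => η x ^ 2) {t t' : ℝ} (htt' : t < t')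
    (ht' : leftLimitExtension h t' ≠ ⊤) {ε l : ℝ} (hε : 0 < ε) (hl : 0 < l) :
    ENNReal.ofReal (∫ x in Ω, inner ℝ (H x) (gradient (fun y => η y ^ 2) x))
      ≤ (∫⁻ x in Ω, leftLimitExtension h (v x) * ENNReal.ofReal (η x ^ 2))
        + (ENNReal.ofReal (m * l) * (∫⁻ x in Ω, ENNReal.ofReal (‖gradient η x‖ ^ 2))
        + ENNReal.ofReal (m / l) * compMulGradientBound (softPositivePart t ε) η v H ^ 2) := by
  have hK : IsCompact (tsupport η) := hη.hasCompactSupport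
  have hKΩ := hη.tsupport_subset
  have hψ : ContDiff ℝ ∞ (softPositivePart t ε) := contDiff_softPositivePart hε
  have hψ' := abs_deriv_softPositivePart_le_one (t := t) hε
  have hz : ∀ g : EuclideanSpace ℝ (Fin N) → ℝ≥0∞, ∀ x, x ∉ tsupport η →
      g x * ENNReal.ofReal (η x ^ 2) = 0 := fun g x hx => by
    simp [image_eq_zero_of_notMem_tsupport hx]
  have hsq : AEMeasurable (fun x => ENNReal.ofReal (η x ^ 2)) (volume.restrict (tsupport η)) :=
    (hη.continuous.measurable.pow_const 2).ennreal_ofReal.aemeasurable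
  set A := ∫⁻ x in Ω, ENNReal.ofReal (‖gradient η x‖ ^ 2) with hA
  obtain ⟨e, he, hle⟩ := exists_compMulGradientBound_le hψ hψ' hη
    (fun k => ((hL.isPoissonSolution k).memLpLoc_fun _ hK hKΩ).1)
    (fun k => ((hL.isPoissonSolution k).memLpLoc_grad _ hK hKΩ).1)
    (hL.memLpLoc_fun _ hK hKΩ).1 (hL.memLpLoc_grad _ hK hKΩ) (hL.tendsto_fun _ hK hKΩ)
    (hL.tendsto_grad _ hK hKΩ) (ae_restrict_of_ae_restrict_of_subset hKΩ hL.ae_tendsto_fun)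
  set R := compMulGradientBound (softPositivePart t ε) η v H with hR
  have hk : ∀ k, ENNReal.ofReal (∫ x in Ω, inner ℝ (G k x) (gradient (fun y => η y ^ 2) x))
      ≤ (∫⁻ x in tsupport η, f k (min (u k x) t) * ENNReal.ofReal (η x ^ 2))
        + (ENNReal.ofReal (m * l) * A + ENNReal.ofReal (m / l) * (R + e k) ^ 2) := by
    intro k
    have hD := hL.locIntegrable_leftDerivative k _ hK hKΩ
    have hum := ((hL.isPoissonSolution k).memLpLoc_fun _ hK hKΩ).1.aemeasurable
    have h1 : ∫⁻ x in tsupport η, leftDerivative (f k) (u k x) * ENNReal.ofReal (η x ^ 2) ≤ A := by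
      rw [← setLIntegral_eq_tsupport hΩ hη (hz _)]
      exact hL.stable k η hη
    have h2 : ∫⁻ x in tsupport η, leftDerivative (f k) (u k x) *
        ENNReal.ofReal ((softPositivePart t ε (u k x) * η x) ^ 2) ≤ (R + e k) ^ 2 :=
      (lintegral_leftDerivative_comp_mul_le hΩ (hL.isPoissonSolution k).isWeakGradient
        (hL.isPoissonSolution k).memLpLoc_fun (hL.isPoissonSolution k).memLpLoc_grad
        (hL.locIntegrable_leftDerivative k) (hL.stable k) hψ hψ' hη).trans
        (pow_le_pow_left' (hle k) 2)
    have hm1 : AEMeasurable (fun x => f k (min (u k x) t) * ENNReal.ofReal (η x ^ 2))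
        (volume.restrict (tsupport η)) :=
      ((hL.isMConvexNonlinearity k).monotone.measurable.comp_aemeasurable
        (hum.min aemeasurable_const)).mul hsq
    have hm2 : AEMeasurable (fun x => leftDerivative (f k) (u k x) * ENNReal.ofReal (η x ^ 2))
        (volume.restrict (tsupport η)) := hD.1.mul hsq
    rw [hL.ofReal_flux hΩ hη2 (fun x => sq_nonneg _), setLIntegral_eq_tsupport hΩ hη (hz _)]
    calc ∫⁻ x in tsupport η, f k (u k x) * ENNReal.ofReal (η x ^ 2)
        ≤ ∫⁻ x in tsupport η, (f k (min (u k x) t) * ENNReal.ofReal (η x ^ 2)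
            + (ENNReal.ofReal (m * l) * (leftDerivative (f k) (u k x) * ENNReal.ofReal (η x ^ 2))
            + ENNReal.ofReal (m / l) * (leftDerivative (f k) (u k x) *
                ENNReal.ofReal ((softPositivePart t ε (u k x) * η x) ^ 2)))) := by
          refine lintegral_mono fun x => ?_
          have a1 := (hL.isMConvexNonlinearity k).le_add_leftDerivative hm t (u k x)
          have a2 : ENNReal.ofReal (m * (u k x - t)) * ENNReal.ofReal (η x ^ 2)
              ≤ ENNReal.ofReal (m * l) * ENNReal.ofReal (η x ^ 2) + ENNReal.ofReal (m / l) *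
                ENNReal.ofReal ((softPositivePart t ε (u k x) * η x) ^ 2) := by
            rw [← ENNReal.ofReal_mul' (sq_nonneg _), ← ENNReal.ofReal_mul' (sq_nonneg _),
              ← ENNReal.ofReal_mul' (sq_nonneg _),
              ← ENNReal.ofReal_add (by positivity) (by positivity)]
            refine ENNReal.ofReal_le_ofReal ?_
            set s := softPositivePart t ε (u k x) with hs
            have b1 : u k x - t ≤ s := sub_le_softPositivePart hε _
            -- `s ≤ l + s ^ 2 / l`
            have b2 : s ≤ l + s ^ 2 / l := by
              rw [← sub_le_iff_le_add', le_div_iff₀ hl]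
              nlinarith [sq_nonneg (s - l), sq_nonneg s]
            calc m * (u k x - t) * η x ^ 2 ≤ m * (l + s ^ 2 / l) * η x ^ 2 := by
                  gcongr; exact b1.trans b2
              _ = _ := by ring
          calc f k (u k x) * ENNReal.ofReal (η x ^ 2)
              ≤ (f k (min (u k x) t) + ENNReal.ofReal (m * (u k x - t)) *
                  leftDerivative (f k) (u k x)) * ENNReal.ofReal (η x ^ 2) := mul_le_mul' a1 le_rfl
            _ = f k (min (u k x) t) * ENNReal.ofReal (η x ^ 2) + leftDerivative (f k) (u k x) *
                  (ENNReal.ofReal (m * (u k x - t)) * ENNReal.ofReal (η x ^ 2)) := by ring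
            _ ≤ f k (min (u k x) t) * ENNReal.ofReal (η x ^ 2) + leftDerivative (f k) (u k x) *
                  (ENNReal.ofReal (m * l) * ENNReal.ofReal (η x ^ 2) + ENNReal.ofReal (m / l) *
                ENNReal.ofReal ((softPositivePart t ε (u k x) * η x) ^ 2)) := by gcongr
            _ = _ := by ring
      _ = _ := by
          rw [lintegral_add_left' hm1, lintegral_add_left' (hm2.const_mul _),
            lintegral_const_mul' _ _ ENNReal.ofReal_ne_top,
            lintegral_const_mul' _ _ ENNReal.ofReal_ne_top]
      _ ≤ _ := by gcongr
  have hlimR : Tendsto (fun k => (R + e k) ^ 2) atTop (𝓝 (R ^ 2)) := by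
    have := ((ENNReal.continuous_pow 2).tendsto _).comp (he.const_add R)
    simpa [Function.comp_def] using this
  have hlim := (hL.tendsto_lintegral_min hm hη htt' ht').add
    ((tendsto_const_nhds (x := ENNReal.ofReal (m * l) * A)).add
      (ENNReal.Tendsto.const_mul (a := ENNReal.ofReal (m / l)) hlimR
        (Or.inr ENNReal.ofReal_ne_top)))
  refine (le_of_tendsto_of_tendsto' (ENNReal.tendsto_ofReal (hL.tendsto_flux hΩ hη2)) hlim
    hk).trans ?_
  rw [setLIntegral_eq_tsupport hΩ hη (hz _)]
  gcongr with x
  exact monotone_leftLimitExtension (min_le_left _ _)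

/-- As the level `t j` tends to the end of the half-line of finiteness, the part of `v` above it
disappears in `W^{1,2}`; where `v` equals the end point, this uses that the gradient of `v` vanishes
on level sets. -/
theorem tendsto_compMulGradientBound (hΩ : IsOpen Ω) (hL : IsStableLimit m Ω f u G h v H)
    {η : EuclideanSpace ℝ (Fin N) → ℝ} (hη : IsTestFunction Ω η) {t : ℕ → ℝ} {c₀ : ℝ}
    (ht0 : ∀ j, t 0 ≤ t j)
    (ht : ∀ s, leftLimitExtension h s ≠ ⊤ →
      (∃ c > 0, ∀ᶠ j in atTop, s ≤ t j - c) ∨ (s = c₀ ∧ Tendsto t atTop (𝓝 c₀))) :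
    Tendsto (fun j : ℕ => compMulGradientBound (softPositivePart (t j) (1 / ((j : ℝ) + 1))) η v H)
      atTop (𝓝 0) := by
  have hK : IsCompact (tsupport η) := hη.hasCompactSupport
  have hKΩ := hη.tsupport_subset
  have hfinK : IsFiniteMeasure (volume.restrict (tsupport η)) :=
    isFiniteMeasure_restrict.2 hK.measure_lt_top.ne
  obtain ⟨M, hM0, hM1, hM2⟩ := hη.exists_bound
  have hε : ∀ j : ℕ, 0 < 1 / ((j : ℝ) + 1) := fun j => by positivity
  have hε1 : ∀ j : ℕ, 1 / ((j : ℝ) + 1) ≤ 1 := fun j => by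
    rw [div_le_one (by positivity)]; linarith [(Nat.cast_nonneg j : (0 : ℝ) ≤ j)]
  have hεlim : Tendsto (fun j : ℕ => 1 / ((j : ℝ) + 1)) atTop (𝓝 0) :=
    tendsto_one_div_add_atTop_nhds_zero_nat
  have hv := hL.memLpLoc_fun _ hK hKΩ
  have hH := hL.memLpLoc_grad _ hK hKΩ
  have hlev := ae_restrict_of_ae_restrict_of_subset hKΩ (hL.ae_gradient_eq_zero_of_eq hΩ c₀)
  have hfin := ae_restrict_of_ae_restrict_of_subset hKΩ
    ((hL.locIntegrable_limit hΩ).ae_lt_top hΩ)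
  have hψ : ∀ j : ℕ, ContDiff ℝ ∞ (softPositivePart (t j) (1 / ((j : ℝ) + 1))) := fun j =>
    contDiff_softPositivePart (hε j)
  have key1 : ∀ᵐ x ∂volume.restrict (tsupport η),
      Tendsto (fun j : ℕ => softPositivePart (t j) (1 / ((j : ℝ) + 1)) (v x)) atTop (𝓝 0) := by
    filter_upwards [hfin] with x hx
    rcases ht (v x) hx.ne with ⟨c, hc, hcj⟩ | ⟨hxc, hlim⟩
    · refine tendsto_of_tendsto_of_tendsto_of_le_of_le' tendsto_const_nhds hεlim
        (Eventually.of_forall fun j => softPositivePart_nonneg (hε j) _) ?_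
      filter_upwards [hcj] with j hj
      have := softPositivePart_le (t := t j) (hε j) (v x)
      rwa [max_eq_right (by linarith), zero_add] at this
    · have h2 : Tendsto (fun j : ℕ => max (v x - t j) 0 + 1 / ((j : ℝ) + 1)) atTop (𝓝 0) := by
        have := ((hlim.const_sub (v x)).max (tendsto_const_nhds (x := (0 : ℝ)))).add hεlim
        simpa [hxc] using this
      exact tendsto_of_tendsto_of_tendsto_of_le_of_le tendsto_const_nhds h2
        (fun j => softPositivePart_nonneg (hε j) _) fun j => softPositivePart_le (hε j) _
  have l1 : Tendsto (fun j : ℕ => eLpNorm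
      (fun x => softPositivePart (t j) (1 / ((j : ℝ) + 1)) (v x) • gradient η x) 2
      (volume.restrict (tsupport η))) atTop (𝓝 0) := by
    refine tendsto_eLpNorm_two_of_dominated (b := fun x => (|v x| + (|t 0| + 1)) * M)
      ((hv.norm.add (memLp_const _)).mul_const M)
      (fun j => ((hψ j).continuous.comp_aestronglyMeasurable hv.1).smul
        hη.continuous_gradient.aestronglyMeasurable) (fun j x => ?_) ?_
    · rw [norm_smul, Real.norm_of_nonneg (softPositivePart_nonneg (hε j) _)]
      refine mul_le_mul ?_ (hM2 x) (norm_nonneg _) (by positivity)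
      refine (softPositivePart_le (hε j) _).trans ?_
      have a1 : max (v x - t j) 0 ≤ |v x| + |t 0| :=
        max_le (by linarith [le_abs_self (v x), neg_abs_le (t 0), ht0 j]) (by positivity)
      linarith [hε1 j]
    · filter_upwards [key1] with x hx
      simpa using hx.smul_const (gradient η x)
  have l2 : Tendsto (fun j : ℕ => eLpNorm
      (fun x => (η x * deriv (softPositivePart (t j) (1 / ((j : ℝ) + 1))) (v x)) • H x) 2
      (volume.restrict (tsupport η))) atTop (𝓝 0) := by
    refine tendsto_eLpNorm_two_of_dominated (b := fun x => M * ‖H x‖) (hH.norm.const_mul M)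
      (fun j => (hη.continuous.aestronglyMeasurable.mul
        (((hψ j).continuous_deriv (by simp)).comp_aestronglyMeasurable hv.1)).smul hH.1)
      (fun j x => ?_) ?_
    · rw [norm_smul, norm_mul]
      gcongr
      calc ‖η x‖ * _ ≤ M * 1 :=
            mul_le_mul (hM1 x) (abs_deriv_softPositivePart_le_one (hε j) _) (abs_nonneg _) hM0
        _ = M := mul_one M
    · filter_upwards [hfin, hlev] with x hx hx'
      rcases ht (v x) hx.ne with ⟨c, hc, hcj⟩ | ⟨hxc, -⟩
      · have hd : Tendsto (fun j : ℕ =>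
            deriv (softPositivePart (t j) (1 / ((j : ℝ) + 1))) (v x)) atTop (𝓝 0) := by
          have h2 : Tendsto (fun j : ℕ => (1 / ((j : ℝ) + 1) / c) ^ 2) atTop (𝓝 0) := by
            simpa using (hεlim.div_const c).pow 2
          refine tendsto_of_tendsto_of_tendsto_of_le_of_le' tendsto_const_nhds h2
            (Eventually.of_forall fun j => deriv_softPositivePart_nonneg (hε j) _) ?_
          filter_upwards [hcj] with j hj
          exact deriv_softPositivePart_le (hε j) hc hj
        simpa using (hd.const_mul (η x)).smul_const (H x)
      · simp [hx' hxc]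
  simpa [compMulGradientBound] using l1.add l2

/-- The other half of the limit equation: no mass of `f k (u k)` is lost in the limit. -/
theorem ofReal_flux_sq_le (hΩ : IsOpen Ω) (hm : 1 ≤ m) (hL : IsStableLimit m Ω f u G h v H)
    (hne : ∃ s, leftLimitExtension h s ≠ ⊤)
    {η : EuclideanSpace ℝ (Fin N) → ℝ} (hη : IsTestFunction Ω η)
    (hη2 : IsTestFunction Ω fun x => η x ^ 2) :
    ENNReal.ofReal (∫ x in Ω, inner ℝ (H x) (gradient (fun y => η y ^ 2) x))
      ≤ ∫⁻ x in Ω, leftLimitExtension h (v x) * ENNReal.ofReal (η x ^ 2) := by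
  obtain ⟨t, c₀, ht0, ht', ht⟩ := exists_truncation_levels hne
  have hR := hL.tendsto_compMulGradientBound hΩ hη ht0 ht
  set A := ∫⁻ x in Ω, ENNReal.ofReal (‖gradient η x‖ ^ 2) with hA
  set S := ∫⁻ x in Ω, leftLimitExtension h (v x) * ENNReal.ofReal (η x ^ 2) with hS
  have h1 : ∀ l : ℝ, 0 < l →
      ENNReal.ofReal (∫ x in Ω, inner ℝ (H x) (gradient (fun y => η y ^ 2) x))
        ≤ S + ENNReal.ofReal (m * l) * A := by
    intro l hl
    have hR2 : Tendsto (fun j : ℕ => compMulGradientBound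
        (softPositivePart (t j) (1 / ((j : ℝ) + 1))) η v H ^ 2) atTop (𝓝 0) := by
      have := ((ENNReal.continuous_pow 2).tendsto _).comp hR
      simpa [Function.comp_def] using this
    have hlim := (ENNReal.Tendsto.const_mul (a := ENNReal.ofReal (m / l)) hR2
      (Or.inr ENNReal.ofReal_ne_top)).const_add (ENNReal.ofReal (m * l) * A) |>.const_add S
    rw [mul_zero, add_zero] at hlim
    refine ge_of_tendsto' hlim fun j => ?_
    obtain ⟨t', htt', hfin⟩ := ht' j
    exact hL.ofReal_flux_sq_le_add hΩ hm hη hη2 htt' hfin (by positivity) hl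
  have hlim : Tendsto (fun l : ℝ => S + ENNReal.ofReal (m * l) * A) (𝓝[>] 0) (𝓝 S) := by
    have a1 : Tendsto (fun l : ℝ => (m : ℝ) * l) (𝓝 0) (𝓝 (m * 0)) := tendsto_id.const_mul _
    have a2 := ENNReal.Tendsto.mul_const (b := A)
      (ENNReal.tendsto_ofReal (a1.mono_left (nhdsWithin_le_nhds (s := Set.Ioi 0))))
      (Or.inr (hη.lintegral_norm_gradient_sq_lt_top hΩ).ne)
    simpa using a2.const_add S
  exact ge_of_tendsto hlim (eventually_mem_nhdsWithin.mono fun l hl => h1 l hl)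

end IsStableLimit

end LimitEquation

/-! ### The limit equation -/

section TestFunctionAlgebra

variable {N : ℕ} {Ω : Set (EuclideanSpace ℝ (Fin N))}

theorem IsTestFunction.add {φ ψ : EuclideanSpace ℝ (Fin N) → ℝ} (hφ : IsTestFunction Ω φ)
    (hψ : IsTestFunction Ω ψ) : IsTestFunction Ω fun x => φ x + ψ x where
  contDiff := hφ.contDiff.add hψ.contDiff
  hasCompactSupport := hφ.hasCompactSupport.add hψ.hasCompactSupport
  tsupport_subset := (tsupport_add φ ψ).trans
    (Set.union_subset hφ.tsupport_subset hψ.tsupport_subset)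

theorem IsTestFunction.mul_left {φ ψ : EuclideanSpace ℝ (Fin N) → ℝ} (hφ : IsTestFunction Ω φ)
    (hψ : ContDiff ℝ ∞ ψ) : IsTestFunction Ω fun x => ψ x * φ x where
  contDiff := hψ.mul hφ.contDiff
  hasCompactSupport := hφ.hasCompactSupport.mul_left
  tsupport_subset := (tsupport_mul_subset_right).trans hφ.tsupport_subset

theorem IsTestFunction.sq {φ : EuclideanSpace ℝ (Fin N) → ℝ} (hφ : IsTestFunction Ω φ) :
    IsTestFunction Ω fun x => φ x ^ 2 := by
  simpa [pow_two] using hφ.mul_left hφ.contDiff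

/-- The flux of a vector field is linear in the test function. -/
theorem integral_inner_gradient_combination (hΩ : IsOpen Ω)
    {H : EuclideanSpace ℝ (Fin N) → EuclideanSpace ℝ (Fin N)} (hH : MemLpLoc Ω 1 H)
    {φ ψ : EuclideanSpace ℝ (Fin N) → ℝ} (hφ : IsTestFunction Ω φ)
    (hψ : IsTestFunction Ω ψ) (a b : ℝ) :
    ∫ x in Ω, inner ℝ (H x) (gradient (fun y => a * φ y + b * ψ y) x)
      = a * (∫ x in Ω, inner ℝ (H x) (gradient φ x))
        + b * ∫ x in Ω, inner ℝ (H x) (gradient ψ x) := by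
  have hg : ∀ x, gradient (fun y => a * φ y + b * ψ y) x = a • gradient φ x + b • gradient ψ x := by
    intro x
    have h1 : DifferentiableAt ℝ φ x := hφ.contDiff.differentiable (by simp) x
    have h2 : DifferentiableAt ℝ ψ x := hψ.contDiff.differentiable (by simp) x
    simp only [gradient]
    rw [fderiv_fun_add (h1.const_mul a) (h2.const_mul b), fderiv_const_mul h1, fderiv_const_mul h2,
      map_add, map_smul, map_smul]
  simp_rw [hg, inner_add_right, inner_smul_right]
  rw [integral_add ((hφ.integrableOn_inner_gradient hΩ hH).const_mul a)
    ((hψ.integrableOn_inner_gradient hΩ hH).const_mul b), integral_const_mul, integral_const_mul]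

theorem integral_mul_combination (hΩ : IsOpen Ω)
    {g : EuclideanSpace ℝ (Fin N) → ℝ} (hg : MemLpLoc Ω 1 g)
    {φ ψ : EuclideanSpace ℝ (Fin N) → ℝ} (hφ : IsTestFunction Ω φ)
    (hψ : IsTestFunction Ω ψ) (a b : ℝ) :
    ∫ x in Ω, g x * (a * φ x + b * ψ x)
      = a * (∫ x in Ω, g x * φ x) + b * ∫ x in Ω, g x * ψ x := by
  rw [← integral_const_mul, ← integral_const_mul, ← integral_add
    ((hφ.integrableOn_mul hΩ hg).const_mul a) ((hψ.integrableOn_mul hΩ hg).const_mul b)]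
  congr 1
  funext x
  ring

end TestFunctionAlgebra

section Compactness

variable {N : ℕ}

namespace IsStableLimit

variable {m : ℕ} {Ω : Set (EuclideanSpace ℝ (Fin N))} {f : ℕ → ℝ → ℝ≥0∞}
  {u : ℕ → EuclideanSpace ℝ (Fin N) → ℝ}
  {G : ℕ → EuclideanSpace ℝ (Fin N) → EuclideanSpace ℝ (Fin N)} {h : ℚ → ℝ≥0∞}
  {v : EuclideanSpace ℝ (Fin N) → ℝ} {H : EuclideanSpace ℝ (Fin N) → EuclideanSpace ℝ (Fin N)}

theorem exists_limit_ne_top (hΩ : IsOpen Ω) (hne : Ω.Nonempty)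
    (hL : IsStableLimit m Ω f u G h v H) : ∃ s, leftLimitExtension h s ≠ ⊤ := by
  have : (ae (volume.restrict Ω)).NeBot := by
    rw [ae_neBot, Ne, Measure.restrict_eq_zero]
    exact (hΩ.measure_pos _ hne).ne'
  obtain ⟨x, hx⟩ := ((hL.locIntegrable_limit hΩ).ae_lt_top hΩ).exists
  exact ⟨v x, hx.ne⟩

/-- The limit equation for a test function `φ`: the one-sided inequality, applied to `M η² ± φ`,
becomes an equality since there is no loss for `η²`. -/
theorem limit_equation (hΩ : IsOpen Ω) (hne : Ω.Nonempty) (hm : 1 ≤ m)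
    (hL : IsStableLimit m Ω f u G h v H)
    {φ : EuclideanSpace ℝ (Fin N) → ℝ} (hφ : IsTestFunction Ω φ) :
    ∫ x in Ω, inner ℝ (H x) (gradient φ x)
      = ∫ x in Ω, (leftLimitExtension h (v x)).toReal * φ x := by
  obtain ⟨η, hη, hη0, -, hηK⟩ := exists_cutoff hΩ hφ.hasCompactSupport hφ.tsupport_subset
  obtain ⟨M, hM0, hM1, -⟩ := hφ.exists_bound
  have hF := hL.locIntegrable_limit hΩ
  have hle : ∀ ψ : EuclideanSpace ℝ (Fin N) → ℝ, IsTestFunction Ω ψ → (∀ x, 0 ≤ ψ x) →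
      ∫ x in Ω, (leftLimitExtension h (v x)).toReal * ψ x
        ≤ ∫ x in Ω, inner ℝ (H x) (gradient ψ x) := by
    intro ψ hψ hψ0
    have h1 := hL.lintegral_limit_mul_le hΩ hψ hψ0
    rw [← hF.ofReal_integral_toReal_mul hΩ hψ hψ0] at h1
    exact (ENNReal.ofReal_le_ofReal_iff (hL.flux_nonneg hΩ hψ hψ0)).1 h1
  have hge : ∫ x in Ω, inner ℝ (H x) (gradient (fun y => η y ^ 2) x)
      ≤ ∫ x in Ω, (leftLimitExtension h (v x)).toReal * η x ^ 2 := by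
    have h1 := hL.ofReal_flux_sq_le hΩ hm (hL.exists_limit_ne_top hΩ hne) hη hη.sq
    rw [← hF.ofReal_integral_toReal_mul hΩ hη.sq fun x => sq_nonneg _] at h1
    exact (ENNReal.ofReal_le_ofReal_iff (integral_nonneg fun x =>
      mul_nonneg ENNReal.toReal_nonneg (sq_nonneg _))).1 h1
  have hcomb : ∀ b : ℝ, |b| ≤ 1 →
      M * (∫ x in Ω, (leftLimitExtension h (v x)).toReal * η x ^ 2)
        + b * (∫ x in Ω, (leftLimitExtension h (v x)).toReal * φ x)
      ≤ M * (∫ x in Ω, inner ℝ (H x) (gradient (fun y => η y ^ 2) x))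
        + b * ∫ x in Ω, inner ℝ (H x) (gradient φ x) := by
    intro b hb
    have hT : IsTestFunction Ω fun x => M * η x ^ 2 + b * φ x :=
      (hη.sq.mul_left contDiff_const).add (hφ.mul_left contDiff_const)
    have h0 : ∀ x, 0 ≤ M * η x ^ 2 + b * φ x := by
      intro x
      by_cases hx : x ∈ tsupport φ
      · have h1 : |b * φ x| ≤ M := by
          rw [abs_mul]
          exact (mul_le_mul hb (hM1 x) (abs_nonneg _) zero_le_one).trans_eq (one_mul M)
        rw [hηK x hx]
        linarith [neg_abs_le (b * φ x)]
      · rw [image_eq_zero_of_notMem_tsupport hx]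
        have := mul_nonneg hM0 (sq_nonneg (η x))
        linarith
    have h1 := hle _ hT h0
    rwa [integral_mul_combination hΩ hF.memLpLoc_toReal hη.sq hφ M b,
      integral_inner_gradient_combination hΩ hL.isWeakGradient.memLpLoc_grad hη.sq hφ M b] at h1
  have h1 := hcomb 1 (by simp)
  have h2 := hcomb (-1) (by simp)
  have h3 := mul_le_mul_of_nonneg_left hge hM0
  linarith

theorem isStableSolution_limit (hΩ : IsOpen Ω) (hne : Ω.Nonempty) (hm : 1 ≤ m)
    (hL : IsStableLimit m Ω f u G h v H) : IsStableSolution Ω (leftLimitExtension h) v :=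
  ⟨⟨hL.locIntegrable_limit hΩ, H, hL.isWeakGradient, hL.memLpLoc_fun, hL.memLpLoc_grad,
    fun _ hφ => hL.limit_equation hΩ hne hm hφ⟩, hL.locIntegrable_leftDerivative_limit hΩ hm,
    fun _ hξ => hL.stable_limit hΩ hm hξ⟩

end IsStableLimit

end Compactness

theorem proposition2p2 {N : ℕ} (hN : 1 ≤ N) {m : ℕ} (hm : 1 ≤ m) {γ : ℝ} (hγ : 0 < γ)
    {Ω : Set (EuclideanSpace ℝ (Fin N))} (hΩ_open : IsOpen Ω) (hΩ_conn : IsConnected Ω)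
    (u : ℕ → EuclideanSpace ℝ (Fin N) → ℝ)
    (hu : ∀ k, u k ∈ stableClass m Ω)
    (hbdd : LocallyBoundedW1 Ω (ENNReal.ofReal (2 + γ)) u) :
    ∃ σ : ℕ → ℕ, StrictMono σ ∧
      ∃ v ∈ stableClass m Ω, TendstoW1Loc Ω 2 (fun j => u (σ j)) v := by
  choose f hf hsol using hu
  have hweak := fun k => (hsol k).1
  choose hfi G hG hu2 hG2 heq using hweak
  have hpois : ∀ k, IsPoissonSolution Ω (u k) (G k) fun x => (f k (u k x)).toReal := fun k =>
    ⟨hG k, hu2 k, hG2 k, (hfi k).memLpLoc_toReal, heq k⟩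
  have hb : ∀ K, IsCompact K → K ⊆ Ω → ∃ C : ℝ≥0, ∀ k,
      eLpNorm (u k) (ENNReal.ofReal (2 + γ)) (volume.restrict K) ≤ C ∧
      eLpNorm (G k) (ENNReal.ofReal (2 + γ)) (volume.restrict K) ≤ C := by
    obtain ⟨G', hG', hb'⟩ := hbdd
    intro K hK hKΩ
    obtain ⟨C, hC⟩ := hb' K hK hKΩ
    refine ⟨C, fun k => ⟨le_self_add.trans (hC k), ?_⟩⟩
    rw [eLpNorm_congr_ae (ae_restrict_of_ae_restrict_of_subset hKΩ
      ((hG k).ae_eq hΩ_open (hG' k)))]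
    exact le_add_self.trans (hC k)
  have hb2 : ∀ K, IsCompact K → K ⊆ Ω → ∃ C : ℝ≥0, ∀ k,
      eLpNorm (G k) 2 (volume.restrict K) ≤ C := by
    intro K hK hKΩ
    obtain ⟨C, hC⟩ := hb K hK hKΩ
    obtain ⟨C', hC'⟩ := eLpNorm_two_le_of_eLpNorm_le
      (F := EuclideanSpace ℝ (Fin N)) (show 2 < 2 + γ by linarith) hK C
    exact ⟨C', fun k => hC' _ (hG2 k K hK hKΩ).1 (hC k).2⟩
  obtain ⟨σ, hσ, v, H, hvH, hv2, hH2, hlimu, hlimG, haeu, haeG⟩ :=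
    exists_subseq_tendsto_W1Loc hΩ_open hpois (fun k x => ENNReal.toReal_nonneg)
      (show 2 < 2 + γ by linarith) hb
  -- a further subsequence along which the nonlinearities converge on `ℚ`
  obtain ⟨h, τ, hτ, hlim⟩ := CompactSpace.tendsto_subseq fun k => fun q : ℚ => f (σ k) q
  have hL : IsStableLimit m Ω (fun j => f (σ (τ j))) (fun j => u (σ (τ j)))
      (fun j => G (σ (τ j))) h v H :=
    { isMConvexNonlinearity := fun j => hf _
      isPoissonSolution := fun j => hpois _
      locIntegrable := fun j => hfi _
      locIntegrable_leftDerivative := fun j => (hsol _).2.1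
      stable := fun j => (hsol _).2.2
      bounded := fun K hK hKΩ => (hb2 K hK hKΩ).imp fun C hC j => hC _
      isWeakGradient := hvH
      memLpLoc_fun := hv2
      memLpLoc_grad := hH2
      tendsto_fun := fun K hK hKΩ => (hlimu K hK hKΩ).comp hτ.tendsto_atTop
      tendsto_grad := fun K hK hKΩ => (hlimG K hK hKΩ).comp hτ.tendsto_atTop
      ae_tendsto_fun := haeu.mono fun x hx => hx.comp hτ.tendsto_atTop
      ae_tendsto_grad := haeG.mono fun x hx => hx.comp hτ.tendsto_atTop
      tendsto_rat := fun q => (tendsto_pi_nhds.1 hlim) q }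
  refine ⟨fun j => σ (τ j), hσ.comp hτ, v, ⟨leftLimitExtension h,
    hL.isMConvexNonlinearity_limit hm, hL.isStableSolution_limit hΩ_open hΩ_conn.nonempty hm⟩,
    fun j => G (σ (τ j)), H, fun j => hG _, hvH, fun K hK hKΩ => ?_⟩
  simpa using (hL.tendsto_fun K hK hKΩ).add (hL.tendsto_grad K hK hKΩ)
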